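/- Let $p\ge 1$, $q\ge 0$, and let $M$ be a smooth manifold (Hausdorff, second countable) of dimension $p+q$. Let $(X_1,\dots,X_p,F_1,\dots,F_q)$ be a smooth integrable system of type $(p,q)$ on $M$: smooth vector fields $X_i$ and smooth functions $F_j$ with $[X_i,X_{i'}]=0$ and $X_i(F_j)=0$ for all $i,i',j$, such that $X_1\wedge\dots\wedge X_p\neq 0$ and $dF_1\wedge\dots\wedge dF_q\neq0$ almost everywhere. A point is called regular if both wedge products are nonzero there. A Liouville torus is a compact connected component of a common level set of $F_1,\dots,F_q$ all of whose points are regular. Let $N=\{F_1=c_1,\dots,F_q=c_q\}$ be a Liouville torus. A Liouville torus action on an open neighbourhood $U$ of $N$, all of whose points are regular, is a smooth free action $\rho$ of $\mathbb T^p=(\mathbb R/\mathbb Z)^p$ on $U$ that preserves every $X_i$ and every $F_j$ and whose orbits are the common level sets of $F_1,\dots,F_q$ in $U$. A tubular neighbourhood of $N$ is an open set $V$ with a diffeomorphism $\mathbb T^p\times B^q\to V$ that takes $\mathbb T^p\times\{0\}$ to $N$, where $B^q$ is the open unit ball in $\mathbb R^q$. Let $\mathcal G\in\Gamma(\otimes^kTM\otimes^hT^*M)$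 be a smooth tensor field that satisfies at least one of the following conditions: (i) $\mathcal L_{X_i}\mathcal G=0$ for all $i=1,\dots,p$; (ii) $\mathcal L_{X_1}\mathcal G=0$, and the orbits of $X_1$ are dense in a dense family of Liouville tori near $N$, that is, $N$ has an open neighbourhood $W$ with a dense subset of points $x$ that lie on a Liouville torus in which the orbit of $X_1$ through $x$ is dense. Then $\mathcal G$ is invariant under the Liouville $\mathbb T^p$-action in a tubular neighbourhood of $N$. Precisely: there is a Liouville torus action on some tubular neighbourhood of $N$; and for every Liouville torus action $\rho$ on an open neighbourhood $U$ of $N$ there is a $\rho$-invariant tubular neighbourhood $V\subseteq U$ of $N$ on which $\mathcal G$ is invariant under $\rho_g$ for every $g\in\mathbb T^p$. -/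

import Mathlib

open Set MeasureTheory VectorField
open scoped Manifold ContDiff

namespace LiouvilleSystem

/-- The `n`-dimensional Euclidean space on which manifolds are modelled. -/
abbrev E (n : ℕ) : Type := EuclideanSpace ℝ (Fin n)

/-- The torus `𝕋^p = (ℝ/ℤ)^p`. -/
abbrev Torus (p : ℕ) : Type := Fin p → UnitAddCircle

/-- The covering homomorphism `ℝ^p → 𝕋^p`. -/
def toTorus {p : ℕ} (t : Fin p → ℝ) : Torus p := fun i => (t i : UnitAddCircle)

section Fields

variable {n : ℕ} {M : Type*} [TopologicalSpace M] [ChartedSpace (E n) M]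

/-- Smooth real functions on `M`. -/
def IsSmoothFunction (f : M → ℝ) : Prop := ContMDiff (𝓡 n) 𝓘(ℝ, ℝ) ∞ f

/-- Smooth vector fields on `M`, as smooth sections of the tangent bundle. -/
def IsSmoothVectorField [IsManifold (𝓡 n) ∞ M] (Y : (x : M) → TangentSpace (𝓡 n) x) : Prop :=
  ContMDiff (𝓡 n) (𝓡 n).tangent ∞ (fun x => (⟨x, Y x⟩ : TangentBundle (𝓡 n) M))

/-- The differential `df_x` of a real function, as a covector at `x`. -/
noncomputable def diff (f : M → ℝ) (x : M) : TangentSpace (𝓡 n) x →L[ℝ] ℝ :=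
  mvfderiv (𝓡 n) f x

/-- Smooth one-forms: fields of covectors that take smooth values on smooth vector fields. -/
def IsSmoothOneForm [IsManifold (𝓡 n) ∞ M]
    (α : (x : M) → TangentSpace (𝓡 n) x →L[ℝ] ℝ) : Prop :=
  ∀ Y : (x : M) → TangentSpace (𝓡 n) x, IsSmoothVectorField Y →
    IsSmoothFunction (n := n) (fun x => α x (Y x))

/-- A (not necessarily smooth) section of `⊗^k TM ⊗ ⊗^h T*M`: at each point `x`, a multilinear
function of `k` covectors and `h` tangent vectors at `x`. -/
abbrev TensorField (n : ℕ) (M : Type*) [TopologicalSpace M] [ChartedSpace (E n) M]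
    (k h : ℕ) : Type _ :=
  (x : M) → MultilinearMap ℝ (fun _ : Fin k => TangentSpace (𝓡 n) x →L[ℝ] ℝ)
    (MultilinearMap ℝ (fun _ : Fin h => TangentSpace (𝓡 n) x) ℝ)

/-- A tensor field is smooth if its values on smooth one-forms and smooth vector fields are
smooth functions. -/
def IsSmoothTensorField [IsManifold (𝓡 n) ∞ M] {k h : ℕ} (G : TensorField n M k h) : Prop :=
  ∀ (α : Fin k → (x : M) → TangentSpace (𝓡 n) x →L[ℝ] ℝ)
    (Y : Fin h → (x : M) → TangentSpace (𝓡 n) x),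
    (∀ i, IsSmoothOneForm (α i)) → (∀ j, IsSmoothVectorField (Y j)) →
    IsSmoothFunction (n := n) (fun x => G x (fun i => α i x) (fun j => Y j x))

/-- `L_X G = 0`. By the Leibniz rule, `L_X (df) = d(X f)` and `L_X Y = [X, Y]`,
`(L_X G)(df_1, …, df_k, Y_1, …, Y_h) = X (G(df_1, …, df_k, Y_1, …, Y_h))
  - ∑_i G(df_1, …, d(X f_i), …, df_k, Y_1, …, Y_h)
  - ∑_j G(df_1, …, df_k, Y_1, …, [X, Y_j], …, Y_h)`,
and these values for all smooth `f_i` and `Y_j` determine `L_X G`, because every covector at a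
point is the differential of a smooth function and every vector is the value of a smooth field. -/
def IsInvariantUnder [IsManifold (𝓡 n) ∞ M] {k h : ℕ} (G : TensorField n M k h)
    (X : (x : M) → TangentSpace (𝓡 n) x) : Prop :=
  ∀ (f : Fin k → M → ℝ) (Y : Fin h → (x : M) → TangentSpace (𝓡 n) x),
    (∀ i, IsSmoothFunction (n := n) (f i)) → (∀ j, IsSmoothVectorField (Y j)) →
    ∀ x : M,
      diff (n := n) (fun y => G y (fun i => diff (f i) y) (fun j => Y j y)) x (X x) =
        (∑ i, G x (Function.update (fun i' => diff (f i') x) i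
            (diff (fun y => diff (f i) y (X y)) x)) (fun j => Y j x)) +
        ∑ j, G x (fun i => diff (f i) x)
            (Function.update (fun j' => Y j' x) j (mlieBracket (𝓡 n) X (Y j) x))

/-- A property holds almost everywhere on `M`: in each chart, the set of points where it fails has
Lebesgue measure zero. -/
def AlmostEverywhere (P : M → Prop) : Prop :=
  ∀ x₀ : M, volume ((extChartAt (𝓡 n) x₀ '' {x ∈ (extChartAt (𝓡 n) x₀).source | ¬ P x} :
    Set (E n))) = 0

end Fields

section Systems

variable {p q : ℕ} {M : Type*} [TopologicalSpace M] [ChartedSpace (E (p + q)) M]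

/-- `X_1 ∧ … ∧ X_p ≠ 0` at `x`. -/
def VectorsIndependentAt (X : Fin p → (x : M) → TangentSpace (𝓡 (p + q)) x) (x : M) : Prop :=
  LinearIndependent ℝ (fun i => X i x)

/-- `dF_1 ∧ … ∧ dF_q ≠ 0` at `x`. -/
def DifferentialsIndependentAt (p : ℕ) {q : ℕ} {M : Type*} [TopologicalSpace M]
    [ChartedSpace (E (p + q)) M] (F : Fin q → M → ℝ) (x : M) : Prop :=
  LinearIndependent ℝ (fun j => diff (n := p + q) (F j) x)

/-- A smooth integrable system of type `(p, q)` on a manifold of dimension `p + q`. -/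
structure IsIntegrableSystem [IsManifold (𝓡 (p + q)) ∞ M]
    (X : Fin p → (x : M) → TangentSpace (𝓡 (p + q)) x) (F : Fin q → M → ℝ) : Prop where
  one_le : 1 ≤ p
  smooth_fields : ∀ i, IsSmoothVectorField (X i)
  smooth_integrals : ∀ j, IsSmoothFunction (n := p + q) (F j)
  commute : ∀ i j x, mlieBracket (𝓡 (p + q)) (X i) (X j) x = 0
  first_integrals : ∀ i j x, diff (F j) x (X i x) = 0
  fields_independent : AlmostEverywhere (n := p + q) (VectorsIndependentAt X)
  differentials_independent :
    AlmostEverywhere (n := p + q) (DifferentialsIndependentAt (M := M) p F)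

/-- The common level set of `F_1, …, F_q` through `x`. -/
def levelSet (F : Fin q → M → ℝ) (x : M) : Set M := {y | ∀ j, F j y = F j x}

/-- The system is regular at `x`. -/
def IsRegularAt (X : Fin p → (x : M) → TangentSpace (𝓡 (p + q)) x) (F : Fin q → M → ℝ)
    (x : M) : Prop :=
  VectorsIndependentAt X x ∧ DifferentialsIndependentAt p F x

/-- A Liouville torus: a compact connected component of a common level set of `F_1, …, F_q`, at
all points of which the system is regular. -/
def IsLiouvilleTorus (X : Fin p → (x : M) → TangentSpace (𝓡 (p + q)) x) (F : Fin q → M → ℝ)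
    (T : Set M) : Prop :=
  IsCompact T ∧ (∃ x : M, T = connectedComponentIn (levelSet F x) x) ∧
    ∀ y ∈ T, IsRegularAt X F y

/-- `U` is a tubular neighbourhood of `N` with typical fibre a ball: there is a diffeomorphism
`𝕋^p × B^q → U` onto the open set `U` that takes `𝕋^p × {0}` to `N`. Smoothness and
differentials are read on the covering `ℝ^p × B^q` of `𝕋^p × B^q`; a smooth injective map whose
differentials are all invertible is a diffeomorphism onto its image. -/
def IsTubularNeighborhood (p q : ℕ) {M : Type*} [TopologicalSpace M]
    [ChartedSpace (E (p + q)) M] (N U : Set M) : Prop :=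
  IsOpen U ∧ ∃ Φ : Torus p × E q → M,
    InjOn Φ (univ ×ˢ Metric.ball (0 : E q) 1) ∧
    Φ '' (univ ×ˢ Metric.ball (0 : E q) 1) = U ∧
    Φ '' (univ ×ˢ {(0 : E q)}) = N ∧
    ContMDiffOn 𝓘(ℝ, (Fin p → ℝ) × E q) (𝓡 (p + q)) ∞
      (fun w : (Fin p → ℝ) × E q => Φ (toTorus w.1, w.2)) (univ ×ˢ Metric.ball (0 : E q) 1) ∧
    ∀ w ∈ (univ : Set (Fin p → ℝ)) ×ˢ Metric.ball (0 : E q) 1,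
      Function.Bijective (mfderiv 𝓘(ℝ, (Fin p → ℝ) × E q) (𝓡 (p + q))
        (fun w : (Fin p → ℝ) × E q => Φ (toTorus w.1, w.2)) w)

/-- `ρ` restricts to a Liouville torus action on the open neighbourhood `U` of `N`: a smooth free
action of `𝕋^p` on `U` that preserves the system `(X_1, …, X_p, F_1, …, F_q)` and whose orbits
are the (regular) level sets of the system in `U`. Smoothness is read on the covering `ℝ^p × U` of
`𝕋^p × U`. The values of `ρ` outside `U` play no role. -/
structure IsLiouvilleTorusAction (X : Fin p → (x : M) → TangentSpace (𝓡 (p + q)) x)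
    (F : Fin q → M → ℝ) (N U : Set M) (ρ : Torus p → M → M) : Prop where
  isOpen : IsOpen U
  subset : N ⊆ U
  mapsTo : ∀ g, MapsTo (ρ g) U U
  zero : ∀ x ∈ U, ρ 0 x = x
  add : ∀ g g', ∀ x ∈ U, ρ (g + g') x = ρ g (ρ g' x)
  smooth : ContMDiffOn (𝓘(ℝ, Fin p → ℝ).prod (𝓡 (p + q))) (𝓡 (p + q)) ∞
    (fun w : (Fin p → ℝ) × M => ρ (toTorus w.1) w.2) (univ ×ˢ U)
  free : ∀ x ∈ U, ∀ g, ρ g x = x → g = 0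
  preserves_fields : ∀ g, ∀ x ∈ U, ∀ i,
    mfderiv (𝓡 (p + q)) (𝓡 (p + q)) (ρ g) x (X i x) = X i (ρ g x)
  preserves_integrals : ∀ g, ∀ x ∈ U, ∀ j, F j (ρ g x) = F j x
  orbits : ∀ x ∈ U, range (fun g => ρ g x) = levelSet F x ∩ U
  regular : ∀ x ∈ U, IsRegularAt X F x

/-- The orbits of the vector field `Y` are dense in a dense family of Liouville tori in some
neighbourhood `W` of `N`: the points `x` of `W` that lie on a Liouville torus `T` in which the
orbit of `Y` through `x` is dense form a dense subset of `W`. -/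
def HasDenseOrbitsOnDenseFamily (X : Fin p → (x : M) → TangentSpace (𝓡 (p + q)) x)
    (F : Fin q → M → ℝ) (Y : (x : M) → TangentSpace (𝓡 (p + q)) x) (N : Set M) : Prop :=
  ∃ W : Set M, IsOpen W ∧ N ⊆ W ∧
    W ⊆ closure {x ∈ W | ∃ T : Set M, IsLiouvilleTorus X F T ∧ x ∈ T ∧
      ∃ γ : ℝ → M, IsMIntegralCurve γ Y ∧ γ 0 = x ∧ T ⊆ closure (range γ)}

/-- On the set `V`, the tensor field `G` is invariant under the diffeomorphisms `ρ g`: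
`G_{ρ_g(x)}(α_1, …, α_k, dρ_g v_1, …, dρ_g v_h) = G_x(ρ_g^* α_1, …, ρ_g^* α_k, v_1, …, v_h)`. -/
def IsInvariantUnderActionOn {n : ℕ} {M : Type*} [TopologicalSpace M] [ChartedSpace (E n) M]
    {p k h : ℕ} (G : TensorField n M k h) (ρ : Torus p → M → M) (V : Set M) : Prop :=
  ∀ g, ∀ x ∈ V, ∀ (α : Fin k → (TangentSpace (𝓡 n) (ρ g x) →L[ℝ] ℝ))
    (v : Fin h → TangentSpace (𝓡 n) x),
    G (ρ g x) α (fun j => mfderiv (𝓡 n) (𝓡 n) (ρ g) x (v j)) =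
      G x (fun i => (α i).comp (mfderiv (𝓡 n) (𝓡 n) (ρ g) x)) v

end Systems

end LiouvilleSystem

/-! The argument has two halves: a Liouville theorem that produces the torus action and angle
coordinates, and a transport argument for tensor coefficients in those coordinates.

Near a regular point the commuting fields are rectified together with the integrals
(`exists_isBox`), so that locally the `X_i` are coordinate fields and the last coordinates are the
`F_j`. The set `N` is a whole common level set and is compact, so it has an open neighbourhood that
connected pieces of level sets cannot leave; translations of a uniform size in the boxes then
assemble to an action of `ℝ^p` there (`exists_isLeafAction_of_isCompact`). On `N` this action is
transitive and its stabilizer is a lattice (`exists_periods`). The periods extend smoothly to the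
neighbouring levels (`exists_smooth_periods`), and no further periods appear
(`eventually_toTorus_eq_zero`). Reparametrizing time by the periods yields a free torus action
(`exists_isLiouvilleTorusAction`).

Now let `ρ` be any Liouville torus action. A section `s` of the integrals gives coordinates `(θ, z)
↦ ρ_θ (s z)` on a tubular neighbourhood. Since `ρ` preserves `X_i` and `X_i` preserves the
integrals, `X_i` has the form `∑ ω_{ia}(z) ∂/∂θ_a` there, with coefficients independent of `θ`
(`IsToricSection.dmap_frequency`). Hence the equation `L_{X_i} G = 0` says that along a flow line
the coefficients of `G` evolve by a fixed endomorphism, the derivative of the frequency. It maps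
`z`-directions to `θ`-directions and kills the latter, so it has square zero. Coefficients could
thus grow only polynomially in time, but they are functions on a compact torus and so are bounded;
therefore they are constant along the flow line (`eq_of_hasDerivAt_nilpotent`,
`IsToricSection.toricCoeff_add_smul`).

Under (i), the frequencies span `ℝ^p` and the coefficients do not depend on `θ`. Under (ii), the
same holds by continuity on a torus with a dense orbit, then on all tori by density of such tori.
Coefficients independent of `θ` mean exactly invariance under `ρ`. -/

section Euclid
-- Smooth dependence on parameters and a Poincaré lemma with parameters
open Filter Topology

/-- Integrals over `[0, 1]` depend smoothly on parameters. -/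
theorem contDiff_intervalIntegral_param {E G : Type} [NormedAddCommGroup E] [NormedSpace ℝ E]
    [FiniteDimensional ℝ E] [NormedAddCommGroup G] [NormedSpace ℝ G]
    {f : E × ℝ → G} (hf : ContDiff ℝ ∞ f) :
    ContDiff ℝ ∞ (fun x => ∫ s in (0 : ℝ)..1, f (x, s)) := by
  -- The codomain is generalized in the induction because the derivative of the integrand takes
  -- values in `E →L[ℝ] G`.
  have key : ∀ (n : ℕ) (G : Type) [NormedAddCommGroup G] [NormedSpace ℝ G]
      (f : E × ℝ → G), ContDiff ℝ ∞ f →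
      ContDiff ℝ n (fun x => ∫ s in (0 : ℝ)..1, f (x, s)) := by
    intro n
    induction n with
    | zero =>
      intro G _ _ f hf
      exact contDiff_zero.2
        (intervalIntegral.continuous_parametric_intervalIntegral_of_continuous'
          (f := fun x s => f (x, s)) (by simpa using! hf.continuous) 0 1)
    | succ n ih =>
      intro G _ _ f hf
      have hd : ∀ x s, HasFDerivAt (fun y => f (y, s))
          ((fderiv ℝ f (x, s)).comp (ContinuousLinearMap.inl ℝ E ℝ)) x := by
        intro x s
        have h1 : HasFDerivAt f (fderiv ℝ f (x, s)) (x, s) :=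
          (hf.differentiable (by simp)).differentiableAt.hasFDerivAt
        exact h1.comp x (hasFDerivAt_prodMk_left x s)
      have hg : ContDiff ℝ ∞ (fun w : E × ℝ =>
          (fderiv ℝ f w).comp (ContinuousLinearMap.inl ℝ E ℝ)) :=
        (hf.fderiv_right (m := ∞) (by simp)).clm_comp contDiff_const
      have hder : ∀ x, HasFDerivAt (fun x => ∫ s in (0 : ℝ)..1, f (x, s))
          (∫ s in (0 : ℝ)..1, (fderiv ℝ f (x, s)).comp (ContinuousLinearMap.inl ℝ E ℝ)) x := by
        intro x
        have hK : IsCompact (Metric.closedBall x 1 ×ˢ Icc (0 : ℝ) 1) :=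
          (isCompact_closedBall x 1).prod isCompact_Icc
        obtain ⟨C, hC⟩ := hK.exists_bound_of_continuousOn hg.continuous.continuousOn
        refine intervalIntegral.hasFDerivAt_integral_of_dominated_of_fderiv_le
          (bound := fun _ => C) (s := Metric.closedBall x 1)
          (F' := fun x s => (fderiv ℝ f (x, s)).comp (ContinuousLinearMap.inl ℝ E ℝ))
          (Metric.closedBall_mem_nhds x one_pos) ?_ ?_ ?_ ?_ ?_ ?_
        · exact Eventually.of_forall fun y =>
            (hf.continuous.comp (by fun_prop : Continuous fun s : ℝ => (y, s))).aestronglyMeasurable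
        · exact (hf.continuous.comp
            (by fun_prop : Continuous fun s : ℝ => (x, s))).intervalIntegrable 0 1
        · exact (hg.continuous.comp
            (by fun_prop : Continuous fun s : ℝ => (x, s))).aestronglyMeasurable
        · refine ae_of_all _ fun s hs y hy => hC (y, s) ⟨hy, ?_⟩
          rw [uIoc_of_le zero_le_one] at hs
          exact ⟨hs.1.le, hs.2⟩
        · exact intervalIntegrable_const
        · exact ae_of_all _ fun s _ y _ => hd y s
      rw [show ((n + 1 : ℕ) : WithTop ℕ∞) = (n : WithTop ℕ∞) + 1 by push_cast; rfl,
        contDiff_succ_iff_fderiv]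
      refine ⟨fun x => (hder x).differentiableAt, by simp, ?_⟩
      rw [show fderiv ℝ (fun x => ∫ s in (0 : ℝ)..1, f (x, s)) = _ from
        funext fun x => (hder x).fderiv]
      exact ih _ _ hg
  exact contDiff_infty.2 fun n => key n G f hf

/-- A smooth function near a point of an open set agrees near that point with a globally smooth
function. -/
theorem exists_contDiff_eqOn_ball {E G : Type*} [NormedAddCommGroup E] [NormedSpace ℝ E]
    [FiniteDimensional ℝ E] [NormedAddCommGroup G] [NormedSpace ℝ G]
    {f : E → G} {W : Set E} (hW : IsOpen W) (hf : ContDiffOn ℝ ∞ f W) {x : E} (hx : x ∈ W) :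
    ∃ g : E → G, ∃ r > 0, ContDiff ℝ ∞ g ∧ Metric.ball x r ⊆ W ∧ EqOn g f (Metric.ball x r) := by
  obtain ⟨R, hR, hRW⟩ := Metric.isOpen_iff.1 hW x hx
  -- The bump is `1` on the ball of radius `R / 4` and vanishes beyond `R / 2 < R`, so multiplying
  -- by it removes the lack of control of `f` off `W`.
  let χ : ContDiffBump x := ⟨R / 4, R / 2, by positivity, by linarith⟩
  refine ⟨fun y => χ y • f y, R / 4, by positivity, ?_,
    (Metric.ball_subset_ball (by linarith)).trans hRW, ?_⟩
  · rw [contDiff_iff_contDiffAt]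
    intro y
    by_cases hy : y ∈ Metric.ball x R
    · exact χ.contDiff.contDiffAt.smul (hf.contDiffAt (hW.mem_nhds (hRW hy)))
    · have : (fun y => χ y • f y) =ᶠ[𝓝 y] fun _ => 0 := by
        have h2 : (Metric.closedBall x (R / 2))ᶜ ∈ 𝓝 y := by
          refine Metric.isClosed_closedBall.isOpen_compl.mem_nhds ?_
          simp only [mem_compl_iff, Metric.mem_closedBall, not_le, Metric.mem_ball, not_lt] at hy ⊢
          linarith
        filter_upwards [h2] with z hz
        rw [χ.zero_of_le_dist, zero_smul]
        simp only [mem_compl_iff, Metric.mem_closedBall, not_le] at hz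
        exact hz.le
      exact contDiffAt_const.congr_of_eventuallyEq this
  · intro y hy
    simp only
    rw [χ.one_of_mem_closedBall (Metric.ball_subset_closedBall hy), one_smul]

/-- Derivative of the inverse of a family of operators. -/
theorem fderiv_inverse_apply {E P : Type*} [NormedAddCommGroup E] [NormedSpace ℝ E]
    [NormedAddCommGroup P] [NormedSpace ℝ P] [CompleteSpace P]
    {A : E → (P →L[ℝ] P)} {W : Set E} (hW : IsOpen W) (hA : ContDiffOn ℝ ∞ A W)
    (hinv : ∀ w ∈ W, (A w).IsInvertible) {w : E} (hw : w ∈ W) (h : E) (k : P) :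
    fderiv ℝ (fun w => (A w).inverse) w h k =
      - (A w).inverse (fderiv ℝ A w h ((A w).inverse k)) := by
  have hAw : ContDiffAt ℝ ∞ A w := hA.contDiffAt (hW.mem_nhds hw)
  have hB : ContDiffAt ℝ ∞ (fun w => (A w).inverse) w :=
    (hinv w hw).contDiffAt_map_inverse.comp w hAw
  have hA' : HasFDerivAt A (fderiv ℝ A w) w := (hAw.differentiableAt (by simp)).hasFDerivAt
  have hB' := (hB.differentiableAt (by simp)).hasFDerivAt
  -- The formula comes from differentiating `A A⁻¹ = id` and applying `A⁻¹` on the left.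
  have hid : (fun w => (A w).comp ((A w).inverse)) =ᶠ[𝓝 w] fun _ => ContinuousLinearMap.id ℝ P := by
    filter_upwards [hW.mem_nhds hw] with y hy using (hinv y hy).self_comp_inverse
  have h1 := (hA'.clm_comp hB').congr_of_eventuallyEq hid.symm
  have h2 := h1.unique (hasFDerivAt_const _ _)
  have h3 := congrArg (fun T => (A w).inverse (T h k)) h2
  simp only [_root_.add_apply, ContinuousLinearMap.comp_apply,
    ContinuousLinearMap.compL_apply, ContinuousLinearMap.flip_apply, map_add,
    _root_.zero_apply, map_zero] at h3
  have h4 : ∀ y, (A w).inverse (A w y) = y := fun y => by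
    rw [← ContinuousLinearMap.comp_apply, (hinv w hw).inverse_comp_self]; rfl
  rw [h4] at h3
  exact eq_neg_of_add_eq_zero_left h3

/-- Simultaneous rectification of commuting independent fields `(A e_i, 0)`: there are functions
`τ` whose derivatives along these fields are constant. -/
theorem exists_rectifying_functions {P Z : Type} [NormedAddCommGroup P] [NormedSpace ℝ P]
    [FiniteDimensional ℝ P] [NormedAddCommGroup Z] [NormedSpace ℝ Z] [FiniteDimensional ℝ Z]
    {A : P × Z → (P →L[ℝ] P)} {W : Set (P × Z)} (hW : IsOpen W) (hA : ContDiffOn ℝ ∞ A W)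
    (hinv : ∀ w ∈ W, (A w).IsInvertible)
    (hsymm : ∀ w ∈ W, ∀ v v', fderiv ℝ A w (A w v, 0) v' = fderiv ℝ A w (A w v', 0) v)
    {w₀ : P × Z} (hw₀ : w₀ ∈ W) :
    ∃ τ : P × Z → P, ∃ W' ⊆ W, IsOpen W' ∧ w₀ ∈ W' ∧ ContDiff ℝ ∞ τ ∧ τ w₀ = 0 ∧
      ∀ w ∈ W', ∀ v, fderiv ℝ τ w (A w v, 0) = v := by
  have hβ : ContDiffOn ℝ ∞ (fun w => (A w).inverse) W := fun w hw =>
    ((hinv w hw).contDiffAt_map_inverse.comp w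
      (hA.contDiffAt (hW.mem_nhds hw))).contDiffWithinAt
  obtain ⟨β, r, hr, hβs, hrW, hβe⟩ := exists_contDiff_eqOn_ball hW hβ hw₀
  -- On each slice with fixed `z`, `A⁻¹` is a `P`-valued one-form on `P`, and `τ` is its integral
  -- along the segment from `w₀.1`. If the form is closed, `τ` is a primitive, so its derivative in
  -- the `P`-direction inverts `A`. The global extension `β` makes `τ` smooth everywhere, also in
  -- `z`.
  let τ : P × Z → P := fun w => ∫ s in (0 : ℝ)..1, β (w₀.1 + s • (w.1 - w₀.1), w.2) (w.1 - w₀.1)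
  have hτ : ContDiff ℝ ∞ τ := by
    refine contDiff_intervalIntegral_param
      (f := fun ws : (P × Z) × ℝ =>
        β (w₀.1 + ws.2 • (ws.1.1 - w₀.1), ws.1.2) (ws.1.1 - w₀.1)) ?_
    refine ContDiff.clm_apply (hβs.comp ?_) ?_ <;> fun_prop
  refine ⟨τ, Metric.ball w₀ r, hrW, Metric.isOpen_ball, Metric.mem_ball_self hr, hτ,
    by simp [τ], ?_⟩
  intro w hw v
  have hprod : ∀ u ∈ Metric.ball w₀.1 r, (u, w.2) ∈ Metric.ball w₀ r := by
    intro u hu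
    rw [← ball_prod_same] at hw ⊢
    exact ⟨hu, hw.2⟩
  have hw1 : w.1 ∈ Metric.ball w₀.1 r := by
    rw [← ball_prod_same] at hw
    exact hw.1
  have hseg : HasFDerivWithinAt
      (fun b => curveIntegral (fun u => β (u, w.2)) (Path.segment w₀.1 b))
      (β (w.1, w.2)) (Metric.ball w₀.1 r) w.1 :=
    (convex_ball w₀.1 r).hasFDerivWithinAt_curveIntegral_segment_of_hasFDerivWithinAt_symmetric
    (dω := fun u => (fderiv ℝ β (u, w.2)).comp (ContinuousLinearMap.inl ℝ P Z))
    (fun u hu => by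
      have h1 : HasFDerivAt β (fderiv ℝ β (u, w.2)) (u, w.2) :=
        (hβs.differentiable (by simp)).differentiableAt.hasFDerivAt
      exact (h1.comp u (hasFDerivAt_prodMk_left u w.2)).hasFDerivWithinAt)
    -- Closedness of the form: its derivative is `-A⁻¹ (dA x) A⁻¹ y`, and on writing `x = A v`, `y =
    -- A v'` the symmetry in `x, y` becomes the commutation condition `hsymm`.
    (fun u hu x _ y _ => by
      have hu' := hprod u hu
      have hE : β =ᶠ[𝓝 (u, w.2)] fun w => (A w).inverse :=
        hβe.eventuallyEq_of_mem (Metric.isOpen_ball.mem_nhds hu')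
      have hI := hinv _ (hrW hu')
      have h5 : ∀ y, A (u, w.2) ((A (u, w.2)).inverse y) = y := fun y => by
        rw [← ContinuousLinearMap.comp_apply, hI.self_comp_inverse]; rfl
      simp only [ContinuousLinearMap.comp_apply, ContinuousLinearMap.inl_apply]
      rw [hE.fderiv_eq, fderiv_inverse_apply hW hA hinv (hrW hu'),
        fderiv_inverse_apply hW hA hinv (hrW hu')]
      have := hsymm _ (hrW hu') ((A (u, w.2)).inverse x) ((A (u, w.2)).inverse y)
      rw [h5, h5] at this
      rw [this])
    (Metric.mem_ball_self hr) hw1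
  have hder : HasFDerivAt (fun u => τ (u, w.2)) (β w) w.1 := by
    refine (hseg.hasFDerivAt (Metric.isOpen_ball.mem_nhds hw1)).congr_of_eventuallyEq
      (Eventually.of_forall fun u => ?_)
    simp only [curveIntegral_segment, τ, AffineMap.lineMap_apply_module', add_comm]
  have hder' : HasFDerivAt (fun u => τ (u, w.2))
      ((fderiv ℝ τ w).comp (ContinuousLinearMap.inl ℝ P Z)) w.1 := by
    have h1 : HasFDerivAt τ (fderiv ℝ τ w) (w.1, w.2) :=
      (hτ.differentiable (by simp)).differentiableAt.hasFDerivAt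
    exact HasFDerivAt.comp (g := τ) (f := fun u => (u, w.2)) w.1 h1
      (hasFDerivAt_prodMk_left w.1 w.2)
  have h6 := DFunLike.congr_fun (hder'.unique hder) (A w v)
  simp only [ContinuousLinearMap.comp_apply, ContinuousLinearMap.inl_apply] at h6
  rw [h6, hβe hw]
  simp only
  rw [← ContinuousLinearMap.comp_apply, (hinv w (hrW hw)).inverse_comp_self]; rfl

end Euclid

/-! ### The inverse function theorem as partial diffeomorphisms -/

section InverseFunction
open Filter Topology

/-- The inverse function theorem in a vector space. -/
theorem exists_partialDiffeomorph_of_bijective_fderiv {E F : Type*} [NormedAddCommGroup E]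
    [NormedSpace ℝ E] [FiniteDimensional ℝ E] [NormedAddCommGroup F] [NormedSpace ℝ F]
    [FiniteDimensional ℝ F] {g : E → F} {W : Set E} (hW : IsOpen W) (hg : ContDiffOn ℝ ∞ g W)
    {x : E} (hx : x ∈ W) (hb : Function.Bijective (fderiv ℝ g x)) :
    ∃ G : PartialDiffeomorph 𝓘(ℝ, E) 𝓘(ℝ, F) E F ∞, x ∈ G.source ∧ G.source ⊆ W ∧
      ∀ y, G y = g y := by
  have : CompleteSpace E := FiniteDimensional.complete ℝ E
  have hgx : ContDiffAt ℝ ∞ g x := hg.contDiffAt (hW.mem_nhds hx)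
  let e : E ≃L[ℝ] F := (LinearEquiv.ofBijective (fderiv ℝ g x : E →ₗ[ℝ] F) hb).toContinuousLinearEquiv
  have he : (e : E →L[ℝ] F) = fderiv ℝ g x := by ext v; rfl
  have hd : HasFDerivAt g (e : E →L[ℝ] F) x := by
    rw [he]; exact (hgx.differentiableAt (by simp)).hasFDerivAt
  let G₀ := hgx.toOpenPartialHomeomorph g hd (by simp)
  have hcont : ContinuousOn (fderiv ℝ g) W := hg.continuousOn_fderiv_of_isOpen hW (by simp)
  -- The source is cut down to points with invertible derivative, so that the local inverse is
  -- smooth on its whole domain and not only at `g x`.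
  let W' : Set E := W ∩ fderiv ℝ g ⁻¹' (range ((↑) : (E ≃L[ℝ] F) → (E →L[ℝ] F)))
  have hW' : IsOpen W' := hcont.isOpen_inter_preimage hW ContinuousLinearEquiv.isOpen
  have hxW' : x ∈ W' := ⟨hx, e, he⟩
  let G₁ := G₀.restrOpen W' hW'
  have hsymm : ∀ y ∈ G₁.target, ContDiffAt ℝ ∞ G₁.symm y := by
    intro y hy
    obtain ⟨hs, hyW, e', he'⟩ := G₁.map_target hy
    refine G₁.contDiffAt_symm (f₀' := e') hy ?_ ?_
    · rw [he']
      exact ((hg.contDiffAt (hW.mem_nhds hyW)).differentiableAt (by simp)).hasFDerivAt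
    · exact hg.contDiffAt (hW.mem_nhds hyW)
  refine ⟨{ toPartialEquiv := G₁.toPartialEquiv
            open_source := G₁.open_source
            open_target := G₁.open_target
            contMDiffOn_toFun := contMDiffOn_iff_contDiffOn.2 (hg.mono fun y hy => hy.2.1)
            contMDiffOn_invFun := contMDiffOn_iff_contDiffOn.2
              fun y hy => (hsymm y hy).contDiffWithinAt }, ?_, ?_, ?_⟩
  · exact ⟨hgx.mem_toOpenPartialHomeomorph_source hd (by simp), hxW'⟩
  · exact fun y hy => hy.2.1
  · exact fun y => rfl

section
variable {E F : Type*} [NormedAddCommGroup E]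
    [NormedSpace ℝ E] [NormedAddCommGroup F] [NormedSpace ℝ F]
    {M N : Type*} [TopologicalSpace M] [ChartedSpace E M]
    [IsManifold 𝓘(ℝ, E) ∞ M] [TopologicalSpace N] [ChartedSpace F N] [IsManifold 𝓘(ℝ, F) ∞ N]

/-- Charts as partial diffeomorphisms. -/
theorem exists_partialDiffeomorph_chartAt (x : M) :
    ∃ φ : PartialDiffeomorph 𝓘(ℝ, E) 𝓘(ℝ, E) M E ∞,
      φ.toPartialEquiv = (chartAt E x).toPartialEquiv :=
  ⟨{ toPartialEquiv := (chartAt E x).toPartialEquiv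
     open_source := (chartAt E x).open_source
     open_target := (chartAt E x).open_target
     contMDiffOn_toFun := contMDiffOn_chart
     contMDiffOn_invFun := contMDiffOn_chart_symm }, rfl⟩

/-- The inverse function theorem on manifolds. -/
theorem exists_partialDiffeomorph_of_bijective_mfderiv [FiniteDimensional ℝ E]
    [FiniteDimensional ℝ F] {f : M → N} {W : Set M} (hW : IsOpen W)
    (hf : ContMDiffOn 𝓘(ℝ, E) 𝓘(ℝ, F) ∞ f W) {x : M} (hx : x ∈ W)
    (hb : Function.Bijective (mfderiv 𝓘(ℝ, E) 𝓘(ℝ, F) f x)) :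
    ∃ Φ : PartialDiffeomorph 𝓘(ℝ, E) 𝓘(ℝ, F) M N ∞, x ∈ Φ.source ∧ Φ.source ⊆ W ∧
      ∀ y ∈ Φ.source, Φ y = f y := by
  obtain ⟨φ, hφ⟩ := exists_partialDiffeomorph_chartAt (E := E) x
  obtain ⟨φ', hφ'⟩ := exists_partialDiffeomorph_chartAt (E := F) (f x)
  have hφf : ∀ y, φ y = chartAt E x y := fun y => congrFun (congrArg PartialEquiv.toFun hφ) y
  have hφs : φ.source = (chartAt E x).source := congrArg PartialEquiv.source hφ
  have hφt : φ.target = (chartAt E x).target := congrArg PartialEquiv.target hφ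
  have hφi : ∀ y, φ.symm y = (chartAt E x).symm y :=
    fun y => congrFun (congrArg PartialEquiv.invFun hφ) y
  have hφf' : ∀ y, φ' y = chartAt F (f x) y := fun y => congrFun (congrArg PartialEquiv.toFun hφ') y
  have hφs' : φ'.source = (chartAt F (f x)).source := congrArg PartialEquiv.source hφ'
  have hφt' : φ'.target = (chartAt F (f x)).target := congrArg PartialEquiv.target hφ'
  have hφi' : ∀ y, φ'.symm y = (chartAt F (f x)).symm y :=
    fun y => congrFun (congrArg PartialEquiv.invFun hφ') y
  let g : E → F := fun v => φ' (f (φ.symm v))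
  let W₁ : Set M := W ∩ f ⁻¹' φ'.source
  have hW₁ : IsOpen W₁ := hf.continuousOn.isOpen_inter_preimage hW φ'.open_source
  let Ω : Set E := φ.target ∩ φ.symm ⁻¹' W₁
  have hΩ : IsOpen Ω :=
    φ.symm.contMDiffOn.continuousOn.isOpen_inter_preimage φ.open_target hW₁
  have hgΩ : ContDiffOn ℝ ∞ g Ω := by
    rw [← contMDiffOn_iff_contDiffOn]
    exact φ'.contMDiffOn.comp ((hf.comp (φ.symm.contMDiffOn.mono inter_subset_left)
      fun v hv => hv.2.1)) fun v hv => hv.2.2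
  have hxs : x ∈ φ.source := by rw [hφs]; exact mem_chart_source E x
  have hxi : φ.symm (φ x) = x := φ.left_inv hxs
  have hfx : f x ∈ φ'.source := by rw [hφs']; exact mem_chart_source F (f x)
  have hxΩ : φ x ∈ Ω := by
    refine ⟨φ.map_source hxs, ?_⟩
    rw [mem_preimage, hxi]
    exact ⟨hx, hfx⟩
  have hbg : Function.Bijective (fderiv ℝ g (φ x)) := by
    have hmd : MDifferentiableAt 𝓘(ℝ, E) 𝓘(ℝ, F) f x :=
      (hf.contMDiffAt (hW.mem_nhds hx)).mdifferentiableAt (by simp)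
    rw [hmd.mfderiv] at hb
    have h1 : writtenInExtChartAt 𝓘(ℝ, E) 𝓘(ℝ, F) x f = g := by
      funext v
      simp only [writtenInExtChartAt, g, hφf', mfld_simps]
      exact congrArg (fun u => chartAt F (f x) (f u)) (hφi v).symm
    have h2 : extChartAt 𝓘(ℝ, E) x x = φ x := by simp [hφf]
    rw [h1, h2] at hb
    simpa using! hb
  obtain ⟨G, hG, hGΩ, hGg⟩ := exists_partialDiffeomorph_of_bijective_fderiv hΩ hgΩ hxΩ hbg
  let Φ := (φ.trans G).trans φ'.symm
  have key : ∀ y, y ∈ φ.source → φ y ∈ G.source → y ∈ W ∧ f y ∈ φ'.source ∧ G (φ y) = φ' (f y) := by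
    intro y hy hy'
    have h3 := hGΩ hy'
    have h4 : φ.symm (φ y) = y := φ.left_inv hy
    have h5 := h3.2
    rw [mem_preimage, h4] at h5
    refine ⟨h5.1, h5.2, ?_⟩
    rw [hGg]
    simp only [g, h4]
  have hmem : ∀ y, y ∈ Φ.source ↔ (y ∈ φ.source ∧ φ y ∈ G.source) ∧ G (φ y) ∈ φ'.target :=
    fun y => Iff.rfl
  refine ⟨Φ, ?_, ?_, ?_⟩
  · rw [hmem]
    refine ⟨⟨hxs, hG⟩, ?_⟩
    rw [(key x hxs hG).2.2]
    exact φ'.map_source hfx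
  · intro y hy
    rw [hmem] at hy
    exact (key y hy.1.1 hy.1.2).1
  · intro y hy
    rw [hmem] at hy
    obtain ⟨-, h7, h8⟩ := key y hy.1.1 hy.1.2
    change φ'.symm (G (φ y)) = f y
    rw [h8]
    exact φ'.left_inv h7

end
end InverseFunction

/-! ### Derivatives as operators between model spaces -/

section Derivative
open Filter Topology

variable {E F E' : Type*} [NormedAddCommGroup E] [NormedSpace ℝ E]
  [NormedAddCommGroup F] [NormedSpace ℝ F] [NormedAddCommGroup E'] [NormedSpace ℝ E']
  {M N M' : Type*} [TopologicalSpace M] [ChartedSpace E M]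
  [TopologicalSpace N] [ChartedSpace F N] [TopologicalSpace M'] [ChartedSpace E' M']

/-- The derivative of a map between manifolds modelled on vector spaces, as an operator between
the model spaces. -/
noncomputable def dmap (E F : Type*) [NormedAddCommGroup E] [NormedSpace ℝ E]
    [NormedAddCommGroup F] [NormedSpace ℝ F] {M N : Type*} [TopologicalSpace M] [ChartedSpace E M]
    [TopologicalSpace N] [ChartedSpace F N] (f : M → N) (x : M) : E →L[ℝ] F :=
  mfderiv 𝓘(ℝ, E) 𝓘(ℝ, F) f x

theorem dmap_comp {g : N → M'} {f : M → N} {x : M}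
    (hg : MDifferentiableAt 𝓘(ℝ, F) 𝓘(ℝ, E') g (f x))
    (hf : MDifferentiableAt 𝓘(ℝ, E) 𝓘(ℝ, F) f x) :
    dmap E E' (fun y => g (f y)) x = (dmap F E' g (f x)).comp (dmap E F f x) :=
  mfderiv_comp x hg hf

theorem dmap_congr {f g : M → N} {x : M} (h : f =ᶠ[𝓝 x] g) : dmap E F f x = dmap E F g x :=
  h.mfderiv_eq

theorem dmap_eq_fderiv (f : E → F) (x : E) : dmap E F f x = fderiv ℝ f x := mfderiv_eq_fderiv

theorem dmap_id (x : M) : dmap E E (fun y : M => y) x = ContinuousLinearMap.id ℝ E :=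
  mfderiv_id

/-- Derivatives of smooth vector-valued functions along smooth vector fields are smooth. -/
theorem contMDiffOn_dmap_apply [IsManifold 𝓘(ℝ, E) ∞ M] {f : M → F} {U : Set M} (hU : IsOpen U)
    (hf : ContMDiffOn 𝓘(ℝ, E) 𝓘(ℝ, F) ∞ f U)
    {Y : (x : M) → TangentSpace 𝓘(ℝ, E) x}
    (hY : ContMDiffOn 𝓘(ℝ, E) 𝓘(ℝ, E).tangent ∞
      (fun x => (⟨x, Y x⟩ : TangentBundle 𝓘(ℝ, E) M)) U) :
    ContMDiffOn 𝓘(ℝ, E) 𝓘(ℝ, F) ∞ (fun y => dmap E F f y (Y y)) U := by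
  have h1 := (hf.contMDiffOn_tangentMapWithin (m := ∞) (by simp) hU.uniqueMDiffOn).comp hY
    (fun x hx => hx)
  have h2 := (contMDiff_snd_tangentBundle_modelSpace F 𝓘(ℝ, F) (n := ∞)).comp_contMDiffOn h1
  refine h2.congr fun y hy => ?_
  simp only [Function.comp, tangentMapWithin, mfderivWithin_of_isOpen hU hy]
  rfl

/-- The chain rule for functions on covers: if `f ∘ Φ = g` near `w`. -/
theorem dmap_apply_of_comp_eq {Φ : M → N} {f : N → M'} {g : M → M'} {w : M}
    (hΦ : MDifferentiableAt 𝓘(ℝ, E) 𝓘(ℝ, F) Φ w)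
    (hf : MDifferentiableAt 𝓘(ℝ, F) 𝓘(ℝ, E') f (Φ w))
    (h : ∀ᶠ y in 𝓝 w, f (Φ y) = g y) (v : E) :
    dmap F E' f (Φ w) (dmap E F Φ w v) = dmap E E' g w v := by
  have h1 : (fun y => f (Φ y)) =ᶠ[𝓝 w] g := h
  rw [← dmap_congr h1, dmap_comp hf hΦ]
  rfl

namespace PartialDiffeomorph

variable (Φ : PartialDiffeomorph 𝓘(ℝ, E) 𝓘(ℝ, F) M N ∞)

theorem apply_mem_target {x : M} (hx : x ∈ Φ.source) : Φ x ∈ Φ.target := Φ.map_source hx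

theorem symm_apply_mem_source {y : N} (hy : y ∈ Φ.target) : Φ.symm y ∈ Φ.source :=
  Φ.map_target hy

theorem symm_apply_apply {x : M} (hx : x ∈ Φ.source) : Φ.symm (Φ x) = x := Φ.left_inv hx

theorem apply_symm_apply {y : N} (hy : y ∈ Φ.target) : Φ (Φ.symm y) = y := Φ.right_inv hy

theorem contMDiffAt {x : M} (hx : x ∈ Φ.source) : ContMDiffAt 𝓘(ℝ, E) 𝓘(ℝ, F) ∞ Φ x :=
  Φ.contMDiffOn.contMDiffAt (Φ.open_source.mem_nhds hx)

theorem contMDiffAt_symm {y : N} (hy : y ∈ Φ.target) :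
    ContMDiffAt 𝓘(ℝ, F) 𝓘(ℝ, E) ∞ Φ.symm y :=
  Φ.symm.contMDiffAt hy

theorem mdiffAt {x : M} (hx : x ∈ Φ.source) : MDifferentiableAt 𝓘(ℝ, E) 𝓘(ℝ, F) Φ x :=
  (Φ.contMDiffAt hx).mdifferentiableAt (by simp)

theorem mdiffAt_symm {y : N} (hy : y ∈ Φ.target) :
    MDifferentiableAt 𝓘(ℝ, F) 𝓘(ℝ, E) Φ.symm y :=
  (Φ.contMDiffAt_symm hy).mdifferentiableAt (by simp)

theorem dmap_symm_comp_dmap {x : M} (hx : x ∈ Φ.source) :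
    (dmap F E Φ.symm (Φ x)).comp (dmap E F Φ x) = ContinuousLinearMap.id ℝ E := by
  rw [← dmap_comp (Φ.mdiffAt_symm (Φ.apply_mem_target hx)) (Φ.mdiffAt hx), ← dmap_id x]
  refine dmap_congr ?_
  filter_upwards [Φ.open_source.mem_nhds hx] with y hy using Φ.symm_apply_apply hy

theorem dmap_comp_dmap_symm {x : M} (hx : x ∈ Φ.source) :
    (dmap E F Φ x).comp (dmap F E Φ.symm (Φ x)) = ContinuousLinearMap.id ℝ F := by
  have hy := Φ.apply_mem_target hx
  have h1 : dmap F F (fun z => Φ (Φ.symm z)) (Φ x) = ContinuousLinearMap.id ℝ F := by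
    rw [← dmap_id (Φ x)]
    refine dmap_congr ?_
    filter_upwards [Φ.open_target.mem_nhds hy] with z hz using Φ.apply_symm_apply hz
  rw [dmap_comp (x := Φ x) (g := Φ) (f := Φ.symm) (Φ.mdiffAt (Φ.symm_apply_mem_source hy))
    (Φ.mdiffAt_symm hy), Φ.symm_apply_apply hx] at h1
  exact h1

theorem isInvertible_dmap {x : M} (hx : x ∈ Φ.source) : (dmap E F Φ x).IsInvertible :=
  ⟨ContinuousLinearEquiv.equivOfInverse (dmap E F Φ x) (dmap F E Φ.symm (Φ x))
    (fun v => DFunLike.congr_fun (Φ.dmap_symm_comp_dmap hx) v)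
    (fun v => DFunLike.congr_fun (Φ.dmap_comp_dmap_symm hx) v), rfl⟩

theorem inverse_dmap {x : M} (hx : x ∈ Φ.source) :
    (dmap E F Φ x).inverse = dmap F E Φ.symm (Φ x) :=
  ContinuousLinearMap.inverse_eq (Φ.dmap_comp_dmap_symm hx) (Φ.dmap_symm_comp_dmap hx)

theorem inverse_dmap_symm {x : M} (hx : x ∈ Φ.source) :
    (dmap F E Φ.symm (Φ x)).inverse = dmap E F Φ x :=
  ContinuousLinearMap.inverse_eq (Φ.dmap_symm_comp_dmap hx) (Φ.dmap_comp_dmap_symm hx)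

end PartialDiffeomorph

end Derivative

namespace LiouvilleSystem

/-! ### Coordinates adapted to the integrals -/

section Boxes
open Filter Topology

/-- Independent covectors are jointly surjective. -/
theorem surjective_pi_of_linearIndependent {V : Type*} [AddCommGroup V] [Module ℝ V] {q : ℕ}
    {φ : Fin q → V →ₗ[ℝ] ℝ} (h : LinearIndependent ℝ φ) :
    Function.Surjective (LinearMap.pi φ) := by
  rw [← LinearMap.range_eq_top]
  by_contra hne
  obtain ⟨g, hg, hle⟩ := Submodule.exists_le_ker_of_lt_top _ (lt_top_iff_ne_top.2 hne)
  refine hg ?_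
  -- A functional `g` that vanishes on the range is a linear relation between the `φ j`, with
  -- coefficients the values of `g` on the unit vectors.
  have h1 : ∑ j, g (Pi.single j 1) • φ j = 0 := by
    ext v
    rw [LinearMap.zero_apply]
    have h2 : g (LinearMap.pi φ v) = 0 := hle (LinearMap.mem_range_self _ v)
    rw [← h2]
    conv_rhs => rw [← Finset.univ_sum_single (LinearMap.pi φ v), map_sum]
    simp only [LinearMap.sum_apply, LinearMap.smul_apply, smul_eq_mul, LinearMap.pi_apply]
    refine Finset.sum_congr rfl fun j _ => ?_
    rw [show (Pi.single j (φ j v) : Fin q → ℝ) = φ j v • Pi.single j 1 by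
      rw [← Pi.single_smul, smul_eq_mul, mul_one], map_smul, smul_eq_mul, mul_comm]
  have h3 := Fintype.linearIndependent_iff.1 h _ h1
  refine LinearMap.pi_ext' fun j => ?_
  ext
  simpa using h3 j

variable {p q : ℕ}

/-- The covering space `ℝ^p × ℝ^q` of local models. -/
abbrev Model (p q : ℕ) : Type := (Fin p → ℝ) × E q

/-- The map `(F_1, …, F_q)` with values in the Euclidean space. -/
def integralMap {M : Type*} (F : Fin q → M → ℝ) (x : M) : E q := WithLp.toLp 2 (fun j => F j x)

theorem integralMap_eq_iff {M : Type*} {F : Fin q → M → ℝ} {x y : M} :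
    integralMap F x = integralMap F y ↔ ∀ j, F j x = F j y := by
  refine ⟨fun h j => ?_, fun h => ?_⟩
  · exact congrFun (congrArg WithLp.ofLp h) j
  · ext j
    exact h j

variable {M : Type*} [TopologicalSpace M] [ChartedSpace (E (p + q)) M]

/-- The value of a vector field as a vector of the model space. -/
def fieldVec {n : ℕ} {M : Type*} [TopologicalSpace M] [ChartedSpace (E n) M]
    (X : (x : M) → TangentSpace (𝓡 n) x) (x : M) : E n := X x

theorem contMDiff_integralMap {F : Fin q → M → ℝ}
    (hF : ∀ j, IsSmoothFunction (n := p + q) (F j)) :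
    ContMDiff (𝓡 (p + q)) 𝓘(ℝ, E q) ∞ (integralMap F) := by
  have h1 : ContMDiff (𝓡 (p + q)) 𝓘(ℝ, Fin q → ℝ) ∞ (fun x j => F j x) :=
    contMDiff_pi_space.2 hF
  exact (PiLp.continuousLinearEquiv 2 ℝ (fun _ : Fin q => ℝ)).symm.contDiff.contMDiff.comp h1

theorem dmap_integralMap_apply {F : Fin q → M → ℝ}
    (hF : ∀ j, IsSmoothFunction (n := p + q) (F j)) (x : M) (v : E (p + q)) (j : Fin q) :
    dmap (E (p + q)) (E q) (integralMap F) x v j = dmap (E (p + q)) ℝ (F j) x v := by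
  have h1 : MDifferentiableAt (𝓡 (p + q)) 𝓘(ℝ, E q) (integralMap F) x :=
    (contMDiff_integralMap hF).mdifferentiable (by simp) x
  let π : E q →L[ℝ] ℝ := EuclideanSpace.proj j
  have h2 := dmap_apply_of_comp_eq (E' := ℝ) (f := π) (g := F j) h1
    π.differentiableAt.mdifferentiableAt (Eventually.of_forall fun y => rfl) v
  rw [dmap_eq_fderiv, π.fderiv] at h2
  exact h2

/-- A chart in which the fields `X_i` are the first coordinate fields and the last coordinates are
the integrals. -/
structure IsBox [IsManifold (𝓡 (p + q)) ∞ M]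
    (X : Fin p → (x : M) → TangentSpace (𝓡 (p + q)) x) (F : Fin q → M → ℝ)
    (e : PartialDiffeomorph (𝓡 (p + q)) 𝓘(ℝ, Model p q) M (Model p q) ∞) : Prop where
  snd : ∀ y ∈ e.source, (e y).2 = integralMap F y
  dmap_field : ∀ y ∈ e.source, ∀ i,
    dmap (E (p + q)) (Model p q) e y (fieldVec (X i) y) = (Pi.single i 1, 0)

variable [IsManifold (𝓡 (p + q)) ∞ M]
    {X : Fin p → (x : M) → TangentSpace (𝓡 (p + q)) x} {F : Fin q → M → ℝ}

theorem IsIntegrableSystem.dmap_integralMap_field (h : IsIntegrableSystem X F) (i : Fin p) (x : M) :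
    dmap (E (p + q)) (E q) (integralMap F) x (fieldVec (X i) x) = 0 := by
  ext j
  rw [dmap_integralMap_apply h.smooth_integrals]
  exact h.first_integrals i j x

theorem IsRegularAt.surjective_dmap_integralMap (h : IsIntegrableSystem X F) {x : M}
    (hx : IsRegularAt X F x) : Function.Surjective (dmap (E (p + q)) (E q) (integralMap F) x) := by
  have h1 : LinearIndependent ℝ (fun j => (dmap (E (p + q)) ℝ (F j) x : E (p + q) →ₗ[ℝ] ℝ)) := by
    have h2 : LinearIndependent ℝ (fun j => (dmap (E (p + q)) ℝ (F j) x : E (p + q) →L[ℝ] ℝ)) := hx.2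
    exact h2.map' (ContinuousLinearMap.coeLM ℝ) (LinearMap.ker_eq_bot.2
      ContinuousLinearMap.coe_injective)
  intro z
  obtain ⟨v, hv⟩ := surjective_pi_of_linearIndependent h1 (fun j => z j)
  refine ⟨v, ?_⟩
  ext j
  rw [dmap_integralMap_apply h.smooth_integrals]
  exact congrFun hv j

/-- Coordinates near a regular point whose last components are the integrals and whose derivative
at the point takes the fields to the coordinate fields. -/
theorem exists_partialDiffeomorph_integralMap (h : IsIntegrableSystem X F) {x : M}
    (hx : IsRegularAt X F x) :
    ∃ κ : PartialDiffeomorph (𝓡 (p + q)) 𝓘(ℝ, Model p q) M (Model p q) ∞, x ∈ κ.source ∧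
      (∀ y ∈ κ.source, (κ y).2 = integralMap F y) ∧
      ∀ i, dmap (E (p + q)) (Model p q) κ x (fieldVec (X i) x) = (Pi.single i 1, 0) := by
  obtain ⟨φ, hφ⟩ := exists_partialDiffeomorph_chartAt (E := E (p + q)) x
  have hxφ : x ∈ φ.source := by
    rw [hφ]; exact mem_chart_source _ x
  have hXi : LinearIndependent ℝ (fun i => fieldVec (X i) x) := hx.1
  have hT := Fintype.linearIndependent_iff.1 hXi
  let T : E (p + q) →L[ℝ] E (p + q) := dmap (E (p + q)) (E (p + q)) φ x
  have hTinj : Function.Injective T := fun a b hab => by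
    have h1 := DFunLike.congr_fun (φ.dmap_symm_comp_dmap hxφ) a
    have h2 := DFunLike.congr_fun (φ.dmap_symm_comp_dmap hxφ) b
    simp only [ContinuousLinearMap.comp_apply, ContinuousLinearMap.id_apply] at h1 h2
    rw [← h1, ← h2]
    exact congrArg _ hab
  let ℓ : (Fin p → ℝ) →ₗ[ℝ] E (p + q) :=
    Fintype.linearCombination ℝ (fun i => T (fieldVec (X i) x))
  have hℓ : LinearMap.ker ℓ = ⊥ := by
    rw [LinearMap.ker_eq_bot']
    intro c hc
    have : T (∑ i, c i • fieldVec (X i) x) = 0 := by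
      rw [map_sum, ← hc]
      simp only [map_smul, ℓ, Fintype.linearCombination_apply]
    have h3 := hT c (hTinj (by rw [this, map_zero]))
    exact funext h3
  -- A left inverse of `c ↦ ∑ c_i T X_i` supplies the first `p` coordinates: it sends the vectors `T
  -- X_i(x)` to the unit vectors.
  obtain ⟨g, hg⟩ := LinearMap.exists_leftInverse_of_injective ℓ hℓ
  let L : E (p + q) →L[ℝ] (Fin p → ℝ) := LinearMap.toContinuousLinearMap g
  have hL : ∀ i, L (T (fieldVec (X i) x)) = Pi.single i 1 := by
    intro i
    have h1 := DFunLike.congr_fun hg (Pi.single i 1)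
    simpa [ℓ] using! h1
  let κ : M → Model p q := fun y => (L (φ y), integralMap F y)
  have hF := contMDiff_integralMap h.smooth_integrals
  have hφ1 : ContMDiffOn (𝓡 (p + q)) 𝓘(ℝ, Fin p → ℝ) ∞ (fun y => L (φ y)) φ.source :=
    L.contDiff.contMDiff.comp_contMDiffOn φ.contMDiffOn
  have hκ : ContMDiffOn (𝓡 (p + q)) 𝓘(ℝ, Model p q) ∞ κ φ.source := by
    exact hφ1.prodMk_space hF.contMDiffOn
  have hκx : MDifferentiableAt (𝓡 (p + q)) 𝓘(ℝ, Model p q) κ x :=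
    (hκ.contMDiffAt (φ.open_source.mem_nhds hxφ)).mdifferentiableAt (by simp)
  have hd1 : ∀ v, (dmap (E (p + q)) (Model p q) κ x v).1 = L (T v) := by
    intro v
    have h1 := dmap_apply_of_comp_eq (E' := Fin p → ℝ) (f := Prod.fst)
      (g := fun y => L (φ y)) hκx differentiableAt_fst.mdifferentiableAt
      (Eventually.of_forall fun y => rfl) v
    rw [dmap_eq_fderiv, fderiv_fst] at h1
    refine h1.trans ?_
    rw [dmap_comp (g := L) L.differentiableAt.mdifferentiableAt (φ.mdiffAt hxφ), dmap_eq_fderiv,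
      L.fderiv]
    rfl
  have hd2 : ∀ v, (dmap (E (p + q)) (Model p q) κ x v).2 =
      dmap (E (p + q)) (E q) (integralMap F) x v := by
    intro v
    have h1 := dmap_apply_of_comp_eq (E' := E q) (f := Prod.snd)
      (g := integralMap F) hκx differentiableAt_snd.mdifferentiableAt
      (Eventually.of_forall fun y => rfl) v
    rw [dmap_eq_fderiv, fderiv_snd] at h1
    exact h1
  have hsurj : Function.Surjective (dmap (E (p + q)) (Model p q) κ x) := by
    rintro ⟨c, z⟩
    obtain ⟨v, hv⟩ := IsRegularAt.surjective_dmap_integralMap h hx z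
    -- First solve for the differentials of the integrals, then correct the first component by a
    -- combination of the `X_i`, which those differentials kill.
    refine ⟨v + ∑ i, (c - L (T v)) i • fieldVec (X i) x, Prod.ext ?_ ?_⟩
    · rw [hd1]
      simp only [map_add, map_sum, map_smul, hL]
      rw [pi_eq_sum_univ' (c - L (T v)) |>.symm]
      simp
    · rw [hd2]
      simp only [map_add, map_sum, map_smul, h.dmap_integralMap_field, smul_zero,
        Finset.sum_const_zero, add_zero, hv]
  have hdim : Module.finrank ℝ (E (p + q)) = Module.finrank ℝ (Model p q) := by
    simp [Model]
  have hbij : Function.Bijective (mfderiv (𝓡 (p + q)) 𝓘(ℝ, Model p q) κ x) :=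
    ⟨(LinearMap.injective_iff_surjective_of_finrank_eq_finrank
      (f := (dmap (E (p + q)) (Model p q) κ x : E (p + q) →ₗ[ℝ] Model p q)) hdim).2 hsurj, hsurj⟩
  obtain ⟨Φ, hΦx, hΦs, hΦe⟩ := exists_partialDiffeomorph_of_bijective_mfderiv
    φ.open_source hκ hxφ hbij
  refine ⟨Φ, hΦx, fun y hy => by rw [hΦe y hy], fun i => ?_⟩
  have h1 : dmap (E (p + q)) (Model p q) Φ x = dmap (E (p + q)) (Model p q) κ x :=
    dmap_congr (by filter_upwards [Φ.open_source.mem_nhds hΦx] with y hy using hΦe y hy)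
  rw [h1]
  refine Prod.ext ?_ ?_
  · rw [hd1, hL]
  · rw [hd2, h.dmap_integralMap_field]

end Boxes
end LiouvilleSystem

namespace LiouvilleSystem

/-! ### Lie brackets in a parametrization -/

section Pullback
open Filter Topology

variable {E' : Type*} [NormedAddCommGroup E'] [NormedSpace ℝ E'] [CompleteSpace E']
  {n : ℕ} {M : Type*} [TopologicalSpace M] [ChartedSpace (E n) M] [IsManifold (𝓡 n) ∞ M]

/-- The Lie bracket read through a map `Φ` from a vector space with invertible differential:
if `Φ` takes the fields `V`, `W` to `X`, `Y`, then it takes `[V, W]` to `[X, Y]`. -/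
theorem dmap_lieBracket_eq {Φ : E' → M} {w : E'}
    (hΦ : ContMDiffAt 𝓘(ℝ, E') (𝓡 n) ∞ Φ w)
    (hinv : ∀ᶠ y in 𝓝 w, (dmap E' (E n) Φ y).IsInvertible)
    {X Y : (x : M) → TangentSpace (𝓡 n) x} (hX : IsSmoothVectorField X)
    (hY : IsSmoothVectorField Y) {V W : E' → E'}
    (hV : ∀ᶠ y in 𝓝 w, dmap E' (E n) Φ y (V y) = fieldVec X (Φ y))
    (hW : ∀ᶠ y in 𝓝 w, dmap E' (E n) Φ y (W y) = fieldVec Y (Φ y)) :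
    dmap E' (E n) Φ w (fderiv ℝ W w (V w) - fderiv ℝ V w (W w)) =
      fieldVec (mlieBracket (𝓡 n) X Y) (Φ w) := by
  have h2le : (2 : WithTop ℕ∞) ≤ ∞ := WithTop.coe_le_coe.2 (le_top : (2 : ℕ∞) ≤ ⊤)
  have : IsManifold (𝓡 n) (minSmoothness ℝ 2) M :=
    IsManifold.of_le (n := ∞) (by rw [minSmoothness_of_isRCLikeNormedField]; exact h2le)
  have h1 := mpullback_mlieBracket (I := 𝓘(ℝ, E')) (I' := 𝓡 n) (f := Φ) (x₀ := w) (V := X) (W := Y)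
    (n := ∞) ((hX (Φ w)).mdifferentiableAt (by simp)) ((hY (Φ w)).mdifferentiableAt (by simp))
    hΦ (by rw [minSmoothness_of_isRCLikeNormedField]; exact h2le)
  have hcancel : ∀ y, (dmap E' (E n) Φ y).IsInvertible → ∀ v,
      (dmap E' (E n) Φ y).inverse (dmap E' (E n) Φ y v) = v := fun y hy v => by
    rw [← ContinuousLinearMap.comp_apply, hy.inverse_comp_self]; rfl
  have h2 : ∀ (Z : (x : M) → TangentSpace (𝓡 n) x) (V : E' → E'),
      (∀ᶠ y in 𝓝 w, dmap E' (E n) Φ y (V y) = fieldVec Z (Φ y)) →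
      mpullback 𝓘(ℝ, E') (𝓡 n) Φ Z =ᶠ[𝓝 w] V := by
    intro Z V hZ
    filter_upwards [hZ, hinv] with y hy hy'
    change (dmap E' (E n) Φ y).inverse (fieldVec Z (Φ y)) = V y
    rw [← hy, hcancel y hy']
  rw [(h2 X V hV).mlieBracket_vectorField_eq (h2 Y W hW)] at h1
  have h4 := congrFun (mlieBracketWithin_eq_lieBracketWithin (𝕜 := ℝ) (V := V) (W := W)
    (s := univ)) w
  rw [lieBracketWithin_univ] at h4
  have h3 : (dmap E' (E n) Φ w).inverse (fieldVec (mlieBracket (𝓡 n) X Y) (Φ w)) =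
    fderiv ℝ W w (V w) - fderiv ℝ V w (W w) := h1.trans h4
  rw [← h3, ← ContinuousLinearMap.comp_apply, hinv.self_of_nhds.self_comp_inverse]
  rfl

end Pullback

/-! ### Simultaneous rectification at regular points -/

section Boxes
open Filter Topology

variable {p q : ℕ} {M : Type*} [TopologicalSpace M] [ChartedSpace (E (p + q)) M]
  [IsManifold (𝓡 (p + q)) ∞ M]
  {X : Fin p → (x : M) → TangentSpace (𝓡 (p + q)) x} {F : Fin q → M → ℝ}

/-- Simultaneous rectification of an integrable system near a regular point. -/
theorem exists_isBox (h : IsIntegrableSystem X F) {x : M} (hx : IsRegularAt X F x) :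
    ∃ e : PartialDiffeomorph (𝓡 (p + q)) 𝓘(ℝ, Model p q) M (Model p q) ∞,
      IsBox X F e ∧ x ∈ e.source ∧ (e x).1 = 0 := by
  obtain ⟨κ, hxκ, hκ2, hκX⟩ := exists_partialDiffeomorph_integralMap h hx
  let a : Fin p → Model p q → Model p q :=
    fun j w => dmap (E (p + q)) (Model p q) κ (κ.symm w) (fieldVec (X j) (κ.symm w))
  have ha : ∀ j, ContDiffOn ℝ ∞ (a j) κ.target := by
    intro j
    rw [← contMDiffOn_iff_contDiffOn]
    exact (contMDiffOn_dmap_apply κ.open_source κ.contMDiffOn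
      (h.smooth_fields j).contMDiffOn).comp κ.symm.contMDiffOn
        (fun w hw => κ.symm_apply_mem_source hw)
  have ha2 : ∀ j, ∀ w ∈ κ.target, (a j w).2 = 0 := by
    intro j w hw
    have hs := κ.symm_apply_mem_source hw
    have h1 := dmap_apply_of_comp_eq (E' := E q) (f := Prod.snd) (g := integralMap F)
      (κ.mdiffAt hs) differentiableAt_snd.mdifferentiableAt
      (by filter_upwards [κ.open_source.mem_nhds hs] with y hy using hκ2 y hy)
      (fieldVec (X j) (κ.symm w))
    rw [dmap_eq_fderiv, fderiv_snd, h.dmap_integralMap_field] at h1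
    exact h1
  have hbr : ∀ j k, ∀ w ∈ κ.target, fderiv ℝ (a k) w (a j w) = fderiv ℝ (a j) w (a k w) := by
    intro j k w hw
    have hmem := κ.open_target.mem_nhds hw
    have hfield : ∀ j, ∀ᶠ y in 𝓝 w,
        dmap (Model p q) (E (p + q)) κ.symm y (a j y) = fieldVec (X j) (κ.symm y) := by
      intro j
      filter_upwards [hmem] with y hy
      have h3 := DFunLike.congr_fun (κ.symm.dmap_comp_dmap_symm hy) (fieldVec (X j) (κ.symm y))
      exact h3
    have h1 := dmap_lieBracket_eq (κ.contMDiffAt_symm hw)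
      (by filter_upwards [hmem] with y hy using κ.symm.isInvertible_dmap hy)
      (h.smooth_fields j) (h.smooth_fields k) (hfield j) (hfield k)
    have h2 : fieldVec (mlieBracket (𝓡 (p + q)) (X j) (X k)) (κ.symm w) = 0 :=
      h.commute j k (κ.symm w)
    rw [h2] at h1
    have h4 := DFunLike.congr_fun (κ.symm.dmap_symm_comp_dmap hw)
      (fderiv ℝ (a k) w (a j w) - fderiv ℝ (a j) w (a k w))
    rw [ContinuousLinearMap.comp_apply, h1, map_zero] at h4
    exact (sub_eq_zero.1 h4.symm)
  -- The fields have no component along the integrals, so in the chart they are `(A e_j, 0)`. The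
  -- vanishing of their brackets then becomes the symmetry hypothesis of
  -- `exists_rectifying_functions`.
  let A : Model p q → ((Fin p → ℝ) →L[ℝ] (Fin p → ℝ)) := fun w =>
    ∑ j, (ContinuousLinearMap.proj (R := ℝ) (φ := fun _ : Fin p => ℝ) j).smulRight (a j w).1
  have hAapp : ∀ w c, A w c = ∑ j, c j • (a j w).1 := by
    intro w c
    simp [A]
  have hA : ContDiffOn ℝ ∞ A κ.target := by
    refine ContDiffOn.sum fun j _ => ?_
    exact contDiffOn_const.smulRight (ha j).fst
  let W : Set (Model p q) := κ.target ∩ A ⁻¹' range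
    ((↑) : ((Fin p → ℝ) ≃L[ℝ] (Fin p → ℝ)) → ((Fin p → ℝ) →L[ℝ] (Fin p → ℝ)))
  have hW : IsOpen W :=
    hA.continuousOn.isOpen_inter_preimage κ.open_target ContinuousLinearEquiv.isOpen
  have hx0 : κ x ∈ κ.target := κ.apply_mem_target hxκ
  have hax : ∀ j, a j (κ x) = (Pi.single j 1, 0) := by
    intro j
    have h1 := hκX j
    simp only [a]
    rw [κ.symm_apply_apply hxκ]
    exact h1
  have hAx : A (κ x) = ContinuousLinearMap.id ℝ _ := by
    ext1 c
    rw [hAapp]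
    simp only [hax]
    exact (pi_eq_sum_univ' c).symm
  have hxW : κ x ∈ W := ⟨hx0, ContinuousLinearEquiv.refl ℝ _, by rw [hAx]; rfl⟩
  have hAinv : ∀ w ∈ W, (A w).IsInvertible := fun w hw => hw.2
  have hApair : ∀ w ∈ κ.target, ∀ c, ((A w c, 0) : Model p q) = ∑ j, c j • a j w := by
    intro w hw c
    rw [hAapp]
    refine Prod.ext ?_ ?_
    · rw [Prod.fst_sum]; rfl
    · rw [Prod.snd_sum]
      simp only [Prod.smul_snd, ha2 _ w hw, smul_zero, Finset.sum_const_zero]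
  have hdA : ∀ w ∈ κ.target, ∀ u c, fderiv ℝ A w u c = ∑ k, c k • (fderiv ℝ (a k) w u).1 := by
    intro w hw u c
    have h1 : ∀ k, HasFDerivAt (a k) (fderiv ℝ (a k) w) w := fun k =>
      (((ha k).contDiffAt (κ.open_target.mem_nhds hw)).differentiableAt (by simp)).hasFDerivAt
    have h2 : HasFDerivAt (fun w => A w c)
        (∑ k, c k • (ContinuousLinearMap.fst ℝ _ _).comp (fderiv ℝ (a k) w)) w := by
      simp only [hAapp]
      exact HasFDerivAt.fun_sum fun k _ => ((h1 k).fst).const_smul (c k)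
    have h3 : HasFDerivAt A (fderiv ℝ A w) w :=
      ((hA.contDiffAt (κ.open_target.mem_nhds hw)).differentiableAt (by simp)).hasFDerivAt
    have h4 := (h3.clm_apply (hasFDerivAt_const c w)).unique h2
    have h5 := DFunLike.congr_fun h4 u
    simpa [_root_.sum_apply] using! h5
  have hsymm : ∀ w ∈ W, ∀ v v', fderiv ℝ A w (A w v, 0) v' = fderiv ℝ A w (A w v', 0) v := by
    intro w hw v v'
    rw [hdA w hw.1, hdA w hw.1, hApair w hw.1, hApair w hw.1]
    simp only [map_sum, map_smul, Prod.fst_sum, Prod.smul_fst, Finset.smul_sum]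
    rw [Finset.sum_comm]
    refine Finset.sum_congr rfl fun j _ => Finset.sum_congr rfl fun k _ => ?_
    rw [hbr j k w hw.1, smul_comm]
  obtain ⟨τ, W', hW'W, hW', hxW', hτ, hτ0, hτA⟩ :=
    exists_rectifying_functions hW (hA.mono inter_subset_left) hAinv hsymm hxW
  have hτd : ∀ w, HasFDerivAt (fun w : Model p q => (τ w, w.2))
      ((fderiv ℝ τ w).prod (ContinuousLinearMap.snd ℝ _ _)) w := fun w =>
    (hτ.differentiable (by simp)).differentiableAt.hasFDerivAt.prodMk hasFDerivAt_snd
  -- The derivative of `(τ, snd)` is block triangular, with the identity on the second factor and `A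
  -- (κ x)⁻¹ = id` on the first.
  have hinj : Function.Injective
      (((fderiv ℝ τ (κ x)).prod (ContinuousLinearMap.snd ℝ (Fin p → ℝ) (E q)) :
        Model p q →L[ℝ] Model p q) : Model p q →ₗ[ℝ] Model p q) := by
    rw [← LinearMap.ker_eq_bot, LinearMap.ker_eq_bot']
    rintro ⟨u, z⟩ huz
    have h1 : fderiv ℝ τ (κ x) (u, z) = 0 := congrArg Prod.fst huz
    have h2 : z = 0 := congrArg Prod.snd huz
    subst h2
    have h3 := hτA (κ x) hxW' u
    rw [hAx] at h3
    rw [← h3]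
    exact Prod.ext h1 rfl
  obtain ⟨T, hxT, hTW, hTe⟩ := exists_partialDiffeomorph_of_bijective_fderiv
    (g := fun w : Model p q => (τ w, w.2)) hW' (by fun_prop) hxW' (by
      rw [(hτd (κ x)).fderiv]
      exact ⟨hinj, LinearMap.injective_iff_surjective.1 hinj⟩)
  let e := κ.trans T
  have hes : ∀ y ∈ e.source, y ∈ κ.source ∧ κ y ∈ T.source := fun y hy => hy
  have hee : ∀ y, e y = (τ (κ y), (κ y).2) := fun y => hTe (κ y)
  refine ⟨e, ⟨fun y hy => ?_, fun y hy i => ?_⟩, ⟨hxκ, hxT⟩, ?_⟩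
  · rw [hee, hκ2 y (hes y hy).1]
  · obtain ⟨hy1, hy2⟩ := hes y hy
    have h1 : dmap (E (p + q)) (Model p q) e y =
        (dmap (Model p q) (Model p q) (fun w : Model p q => (τ w, w.2)) (κ y)).comp
          (dmap (E (p + q)) (Model p q) κ y) := by
      rw [← dmap_comp (hτd (κ y)).differentiableAt.mdifferentiableAt (κ.mdiffAt hy1)]
      exact dmap_congr (Eventually.of_forall hee)
    have h2 : dmap (E (p + q)) (Model p q) κ y (fieldVec (X i) y) = a i (κ y) := by
      simp only [a]
      rw [κ.symm_apply_apply hy1]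
    have h3 : a i (κ y) = (A (κ y) (Pi.single i 1), 0) := by
      rw [hApair _ (κ.apply_mem_target hy1)]
      simp [Pi.single_apply]
    rw [h1, ContinuousLinearMap.comp_apply, h2, dmap_eq_fderiv, (hτd (κ y)).fderiv, h3]
    refine Prod.ext ?_ rfl
    exact hτA (κ y) (hTW hy2) _
  · rw [hee, hτ0]

end Boxes
end LiouvilleSystem

namespace LiouvilleSystem

/-! ### Extending local homomorphisms -/

section LocalHom

/-- A local homomorphism from a ball of a normed space to a monoid extends to a homomorphism. -/
theorem exists_hom_of_local_hom {V G : Type*} [NormedAddCommGroup V] [NormedSpace ℝ V] [Monoid G]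
    {f : V → G} {ε : ℝ} (hε : 0 < ε) (h0 : f 0 = 1)
    (hadd : ∀ s t, ‖s‖ + ‖t‖ < ε → f (s + t) = f s * f t) :
    ∃ g : V → G, g 0 = 1 ∧ (∀ s t, g (s + t) = g s * g t) ∧ ∀ t, ‖t‖ < ε → g t = f t := by
  have hpow : ∀ (k : ℕ) (s : V), k * ‖s‖ < ε → f ((k : ℝ) • s) = f s ^ k := by
    intro k s
    induction k with
    | zero => intro _; simp [h0]
    | succ k ih =>
      intro hk
      push_cast at hk ⊢
      rw [add_smul, one_smul, hadd, ih, pow_succ]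
      · nlinarith [norm_nonneg s]
      · rw [norm_smul, Real.norm_natCast]
        linarith
  -- Any extension must take the value `f (t / n) ^ n` once `‖t‖ < n * ε`. Two admissible values of
  -- `n` agree because both agree with their product.
  let a : ℕ → V → G := fun n t => f ((n : ℝ)⁻¹ • t) ^ n
  have hnorm : ∀ (n : ℕ) (t : V), 0 < n → ‖t‖ < n * ε → ‖(n : ℝ)⁻¹ • t‖ < ε := by
    intro n t hn ht
    have hn' : (0 : ℝ) < n := by exact_mod_cast hn
    rw [norm_smul, norm_inv, Real.norm_natCast, inv_mul_lt_iff₀ hn']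
    exact ht
  have hrefine : ∀ (n m : ℕ) (t : V), 0 < n → 0 < m → ‖t‖ < n * ε → a n t = a (m * n) t := by
    intro n m t hn hm ht
    have hm' : (0 : ℝ) < m := by exact_mod_cast hm
    have h2 := hnorm n t hn ht
    have h3 : (m : ℝ) * ‖((m * n : ℕ) : ℝ)⁻¹ • t‖ = ‖(n : ℝ)⁻¹ • t‖ := by
      rw [norm_smul, norm_smul, norm_inv, norm_inv, Real.norm_natCast, Real.norm_natCast]
      push_cast
      field_simp
    have h4 : (n : ℝ)⁻¹ • t = (m : ℝ) • ((m * n : ℕ) : ℝ)⁻¹ • t := by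
      rw [smul_smul]
      congr 1
      push_cast
      field_simp
    simp only [a]
    rw [pow_mul, ← hpow m _ (by rw [h3]; exact h2), ← h4]
  have hind : ∀ (n m : ℕ) (t : V), 0 < n → 0 < m → ‖t‖ < n * ε → ‖t‖ < m * ε → a n t = a m t := by
    intro n m t hn hm h1 h2
    rw [hrefine n m t hn hm h1, hrefine m n t hm hn h2, mul_comm]
  have hex : ∀ t : V, ∃ n : ℕ, 0 < n ∧ ‖t‖ < n * ε := by
    intro t
    obtain ⟨n, hn⟩ := exists_nat_gt (‖t‖ / ε)
    refine ⟨n, ?_, (div_lt_iff₀ hε).1 hn⟩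
    have h1 : (0 : ℝ) < n := lt_of_le_of_lt (by positivity) hn
    exact_mod_cast h1
  choose N hN hNε using hex
  have hval : ∀ (n : ℕ) (t : V), 0 < n → ‖t‖ < n * ε → a (N t) t = a n t := fun n t hn ht =>
    hind _ _ t (hN t) hn (hNε t) ht
  have hone : ∀ t, ‖t‖ < ε → a (N t) t = f t := fun t ht => by
    rw [hval 1 t one_pos (by simpa using ht)]
    simp [a]
  refine ⟨fun t => a (N t) t, (hone 0 (by simpa using hε)).trans h0, fun s t => ?_, hone⟩
  obtain ⟨n, hn, hlt⟩ : ∃ n : ℕ, 0 < n ∧ ‖s‖ + ‖t‖ < n * ε := by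
    obtain ⟨n, hn⟩ := exists_nat_gt ((‖s‖ + ‖t‖) / ε)
    refine ⟨n, ?_, (div_lt_iff₀ hε).1 hn⟩
    have h1 : (0 : ℝ) < n := lt_of_le_of_lt (by positivity) hn
    exact_mod_cast h1
  have hn' : (0 : ℝ) < n := by exact_mod_cast hn
  simp only
  rw [hval n _ hn ((norm_add_le s t).trans_lt hlt),
    hval n s hn (by linarith [norm_nonneg t]), hval n t hn (by linarith [norm_nonneg s])]
  have hsum : ‖(n : ℝ)⁻¹ • s‖ + ‖(n : ℝ)⁻¹ • t‖ < ε := by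
    rw [norm_smul, norm_smul, norm_inv, Real.norm_natCast, ← mul_add, inv_mul_lt_iff₀ hn']
    exact hlt
  -- `G` need not be commutative, but small values commute because addition in `V` does; this lets
  -- the `n`-th power be distributed.
  have hcomm : Commute (f ((n : ℝ)⁻¹ • s)) (f ((n : ℝ)⁻¹ • t)) := by
    rw [commute_iff_eq, ← hadd _ _ hsum, add_comm, hadd _ _ (by rwa [add_comm])]
  simp only [a]
  rw [smul_add, hadd _ _ hsum, hcomm.mul_pow]

end LocalHom

/-! ### Local flows in boxes -/

section LocalFlow
open Filter Topology

variable {p q : ℕ} {M : Type*} [TopologicalSpace M] [ChartedSpace (E (p + q)) M]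
  {X : Fin p → (x : M) → TangentSpace (𝓡 (p + q)) x} {F : Fin q → M → ℝ}

/-- The linear combination `∑ t_i X_i`. -/
noncomputable def sumField (X : Fin p → (x : M) → TangentSpace (𝓡 (p + q)) x) (t : Fin p → ℝ) (x : M) :
    TangentSpace (𝓡 (p + q)) x := ∑ i, t i • X i x

theorem fieldVec_sumField (t : Fin p → ℝ) (x : M) :
    fieldVec (sumField X t) x = ∑ i, t i • fieldVec (X i) x := rfl

variable [IsManifold (𝓡 (p + q)) ∞ M]

theorem IsIntegrableSystem.smooth_sumField (h : IsIntegrableSystem X F) (t : Fin p → ℝ) :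
    IsSmoothVectorField (sumField X t) :=
  ContMDiff.sum_section (V := fun x : M => TangentSpace (𝓡 (p + q)) x)
    (t := fun i x => t i • X i x) fun i _ => (h.smooth_fields i).const_smul_section (a := t i)

theorem IsBox.dmap_symm {e : PartialDiffeomorph (𝓡 (p + q)) 𝓘(ℝ, Model p q) M (Model p q) ∞}
    (he : IsBox X F e) {w : Model p q} (hw : w ∈ e.target) (t : Fin p → ℝ) :
    dmap (Model p q) (E (p + q)) e.symm w (t, 0) = fieldVec (sumField X t) (e.symm w) := by
  have hs := e.symm_apply_mem_source hw
  have h1 : dmap (E (p + q)) (Model p q) e (e.symm w) (fieldVec (sumField X t) (e.symm w)) =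
      (t, 0) := by
    rw [fieldVec_sumField, map_sum]
    simp only [map_smul, he.dmap_field _ hs]
    refine Prod.ext ?_ ?_
    · rw [Prod.fst_sum]
      exact (pi_eq_sum_univ' t).symm
    · rw [Prod.snd_sum]
      simp
  rw [← h1]
  have h2 := DFunLike.congr_fun (e.dmap_symm_comp_dmap hs) (fieldVec (sumField X t) (e.symm w))
  rw [e.apply_symm_apply hw] at h2
  exact h2

/-- Straight segments in a box are integral curves. -/
theorem IsBox.isMIntegralCurveOn {e : PartialDiffeomorph (𝓡 (p + q)) 𝓘(ℝ, Model p q) M (Model p q) ∞}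
    (he : IsBox X F e) (w : Model p q) (t : Fin p → ℝ) {I : Set ℝ}
    (hI : ∀ s ∈ I, (w.1 + s • t, w.2) ∈ e.target) :
    IsMIntegralCurveOn (fun s : ℝ => e.symm (w.1 + s • t, w.2)) (sumField X t) I := by
  intro s hs
  have h1 : HasFDerivAt (fun s : ℝ => ((w.1 + s • t, w.2) : Model p q))
      ((1 : ℝ →L[ℝ] ℝ).smulRight ((t, 0) : Model p q)) s := by
    have h2 : HasFDerivAt (fun s : ℝ => w.1 + s • t) ((1 : ℝ →L[ℝ] ℝ).smulRight t) s :=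
      ((hasFDerivAt_id s).smul_const t).const_add w.1
    have h3 := h2.prodMk (hasFDerivAt_const w.2 s)
    refine h3.congr_fderiv ?_
    ext1
    refine Prod.ext ?_ ?_ <;> simp
  have h4 := (e.mdiffAt_symm (hI s hs)).hasMFDerivAt.comp s h1.hasMFDerivAt
  refine (h4.congr_mfderiv ?_).hasMFDerivWithinAt
  have h5 : (dmap (Model p q) (E (p + q)) e.symm (w.1 + s • t, w.2)).comp
      ((1 : ℝ →L[ℝ] ℝ).smulRight ((t, 0) : Model p q)) =
      (1 : ℝ →L[ℝ] ℝ).smulRight (fieldVec (sumField X t) (e.symm (w.1 + s • t, w.2))) := by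
    ext1
    rw [ContinuousLinearMap.comp_apply, ContinuousLinearMap.smulRight_apply, map_smul,
      he.dmap_symm (hI s hs)]
    rfl
  exact h5

/-- The local translation flow does not depend on the box. -/
theorem IsBox.symm_eq_symm [T2Space M] (h : IsIntegrableSystem X F)
    {e e' : PartialDiffeomorph (𝓡 (p + q)) 𝓘(ℝ, Model p q) M (Model p q) ∞}
    (he : IsBox X F e) (he' : IsBox X F e') {y : M} (hy : y ∈ e.source) (hy' : y ∈ e'.source)
    {r : ℝ} (hr : ∀ t, ‖t‖ < r → ((e y).1 + t, (e y).2) ∈ e.target)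
    (hr' : ∀ t, ‖t‖ < r → ((e' y).1 + t, (e' y).2) ∈ e'.target) {t : Fin p → ℝ} (ht : ‖t‖ < r) :
    e.symm ((e y).1 + t, (e y).2) = e'.symm ((e' y).1 + t, (e' y).2) := by
  -- Uniqueness of integral curves is applied on an open interval, which must contain the time `1`
  -- and on which both segments stay in their boxes.
  obtain ⟨c, hc1, hc⟩ : ∃ c : ℝ, 1 < c ∧ c * ‖t‖ < r := by
    have h1 : ∀ᶠ c : ℝ in 𝓝 1, c * ‖t‖ < r := by
      have h2 : ContinuousAt (fun c : ℝ => c * ‖t‖) 1 := by fun_prop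
      exact h2.eventually_lt continuousAt_const (by simpa using ht)
    have h3 : ∀ᶠ c : ℝ in 𝓝[>] 1, 1 < c ∧ c * ‖t‖ < r :=
      (eventually_mem_nhdsWithin).and (h1.filter_mono nhdsWithin_le_nhds)
    exact h3.exists
  have hmem : ∀ s ∈ Ioo (-c) c, ‖s • t‖ < r := by
    intro s hs
    rw [norm_smul]
    refine lt_of_le_of_lt ?_ hc
    exact mul_le_mul_of_nonneg_right (abs_le.2 ⟨hs.1.le, hs.2.le⟩) (norm_nonneg t)
  have h1 := he.isMIntegralCurveOn (e y) t (I := Ioo (-c) c) fun s hs => hr _ (hmem s hs)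
  have h2 := he'.isMIntegralCurveOn (e' y) t (I := Ioo (-c) c) fun s hs => hr' _ (hmem s hs)
  have h3 := isMIntegralCurveOn_Ioo_eqOn_of_contMDiff_boundaryless (t₀ := 0)
    ⟨by linarith, by linarith⟩ ((h.smooth_sumField t).of_le (by simp)) h1 h2 (by
      simp only [zero_smul, add_zero]
      exact (e.symm_apply_apply hy).trans (e'.symm_apply_apply hy').symm)
  have h4 := h3 (x := 1) ⟨by linarith, hc1⟩
  simpa only [one_smul] using h4

/-- Boxes of a uniform size around the points of a compact set of regular points. -/
theorem exists_uniform_box (h : IsIntegrableSystem X F) {K : Set M} (hK : IsCompact K)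
    (hreg : ∀ y ∈ K, IsRegularAt X F y) :
    ∃ ε > 0, ∀ y ∈ K, ∃ e : PartialDiffeomorph (𝓡 (p + q)) 𝓘(ℝ, Model p q) M (Model p q) ∞,
      IsBox X F e ∧ y ∈ e.source ∧ ∀ t, ‖t‖ < ε → ((e y).1 + t, (e y).2) ∈ e.target := by
  refine hK.induction_on (p := fun K => ∃ ε > 0, ∀ y ∈ K,
    ∃ e : PartialDiffeomorph (𝓡 (p + q)) 𝓘(ℝ, Model p q) M (Model p q) ∞,
      IsBox X F e ∧ y ∈ e.source ∧ ∀ t, ‖t‖ < ε → ((e y).1 + t, (e y).2) ∈ e.target)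
    ⟨1, one_pos, by simp⟩ ?_ ?_ ?_
  · rintro s t hst ⟨ε, hε, H⟩
    exact ⟨ε, hε, fun y hy => H y (hst hy)⟩
  · rintro s t ⟨ε, hε, H⟩ ⟨δ, hδ, H'⟩
    refine ⟨min ε δ, lt_min hε hδ, ?_⟩
    rintro y (hy | hy)
    · obtain ⟨e, h1, h2, h3⟩ := H y hy
      exact ⟨e, h1, h2, fun t ht => h3 t (ht.trans_le (min_le_left _ _))⟩
    · obtain ⟨e, h1, h2, h3⟩ := H' y hy
      exact ⟨e, h1, h2, fun t ht => h3 t (ht.trans_le (min_le_right _ _))⟩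
  · intro x hx
    obtain ⟨e, he, hxe, -⟩ := exists_isBox h (hreg x hx)
    obtain ⟨R, hR, hball⟩ := Metric.isOpen_iff.1 e.open_target _ (e.apply_mem_target hxe)
    -- Half of the radius is spent on the displacement of `y` from `x`, the other half on the
    -- translation.
    refine ⟨e.source ∩ e ⁻¹' Metric.ball (e x) (R / 2), mem_nhdsWithin_of_mem_nhds ?_, R / 2,
      by positivity, ?_⟩
    · exact (e.contMDiffOn.continuousOn.isOpen_inter_preimage e.open_source
        Metric.isOpen_ball).mem_nhds ⟨hxe, Metric.mem_ball_self (by positivity)⟩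
    · rintro y ⟨hy, hy'⟩
      refine ⟨e, he, hy, fun t ht => hball ?_⟩
      rw [mem_preimage, Metric.mem_ball, dist_eq_norm] at hy'
      rw [Metric.mem_ball, dist_eq_norm]
      have h1 : (((e y).1 + t, (e y).2) : Model p q) - e x = (e y - e x) + (t, 0) := by
        ext <;> simp [add_sub_right_comm]
      rw [h1]
      have h2 : ‖((t, 0) : Model p q)‖ = ‖t‖ := by simp [Prod.norm_def]
      calc _ ≤ ‖e y - e x‖ + ‖((t, 0) : Model p q)‖ := norm_add_le _ _
        _ < R / 2 + R / 2 := by rw [h2]; exact add_lt_add hy' ht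
        _ = R := by ring

end LocalFlow
end LiouvilleSystem

namespace LiouvilleSystem

/-! ### The action of `ℝ^p` along the leaves -/

section LeafAction
open Filter Topology

variable {p q : ℕ} {M : Type*} [TopologicalSpace M] [ChartedSpace (E (p + q)) M]
  [IsManifold (𝓡 (p + q)) ∞ M]
  {X : Fin p → (x : M) → TangentSpace (𝓡 (p + q)) x} {F : Fin q → M → ℝ}

/-- An action `Ψ` of `ℝ^p` that on the open set `O` is generated by the fields `X_i`: in each box,
small elements act as translations. -/
structure IsLeafAction (X : Fin p → (x : M) → TangentSpace (𝓡 (p + q)) x) (F : Fin q → M → ℝ)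
    (O : Set M) (ε : ℝ) (Ψ : (Fin p → ℝ) → M → M) : Prop where
  isOpen : IsOpen O
  pos : 0 < ε
  zero : ∀ y, Ψ 0 y = y
  add : ∀ s t y, Ψ (s + t) y = Ψ s (Ψ t y)
  mapsTo : ∀ t, ∀ y ∈ O, Ψ t y ∈ O
  exists_box : ∀ y ∈ O, ∃ e : PartialDiffeomorph (𝓡 (p + q)) 𝓘(ℝ, Model p q) M (Model p q) ∞,
    IsBox X F e ∧ y ∈ e.source ∧ ∀ t, ‖t‖ < ε → ((e y).1 + t, (e y).2) ∈ e.target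
  box : ∀ e : PartialDiffeomorph (𝓡 (p + q)) 𝓘(ℝ, Model p q) M (Model p q) ∞, IsBox X F e →
    ∀ y ∈ O, y ∈ e.source → ∀ r ≤ ε, (∀ t, ‖t‖ < r → ((e y).1 + t, (e y).2) ∈ e.target) →
    ∀ t, ‖t‖ < r → Ψ t y = e.symm ((e y).1 + t, (e y).2)

/-- The fields of an integrable system generate an action of `ℝ^p` on each relatively compact open
set of regular points that contains the connected subsets of level sets that meet it. -/
theorem exists_isLeafAction [T2Space M] (h : IsIntegrableSystem X F) {K O : Set M}
    (hK : IsCompact K) (hreg : ∀ y ∈ K, IsRegularAt X F y) (hO : IsOpen O) (hOK : O ⊆ K)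
    (hinv : ∀ y ∈ O, ∀ C, IsPreconnected C → y ∈ C → C ⊆ levelSet F y → C ⊆ O) :
    ∃ ε Ψ, IsLeafAction X F O ε Ψ := by
  classical
  obtain ⟨ε, hε, hbox⟩ := exists_uniform_box h hK hreg
  rcases K.eq_empty_or_nonempty with rfl | ⟨y₀, hy₀⟩
  · have hO' : ∀ y, y ∉ O := fun y hy => hOK hy
    exact ⟨1, fun _ y => y, hO, one_pos, fun y => rfl, fun s t y => rfl, fun t y hy => hy,
      fun y hy => (hO' y hy).elim, fun e _ y hy => (hO' y hy).elim⟩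
  have : Nonempty (PartialDiffeomorph (𝓡 (p + q)) 𝓘(ℝ, Model p q) M (Model p q) ∞) :=
    ⟨(hbox y₀ hy₀).choose⟩
  choose! e he hes het using hbox
  -- The default value `y` makes each `ψ t` a self-map of all of `M`, so that `ψ` is a local
  -- homomorphism into the monoid `Function.End M`.
  let ψ : (Fin p → ℝ) → M → M := fun t y =>
    if y ∈ O ∧ ‖t‖ < ε then (e y).symm ((e y y).1 + t, (e y y).2) else y
  have hψ : ∀ e' : PartialDiffeomorph (𝓡 (p + q)) 𝓘(ℝ, Model p q) M (Model p q) ∞, IsBox X F e' →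
    ∀ y ∈ O, y ∈ e'.source → ∀ r ≤ ε, (∀ t, ‖t‖ < r → ((e' y).1 + t, (e' y).2) ∈ e'.target) →
    ∀ t, ‖t‖ < r → ψ t y = e'.symm ((e' y).1 + t, (e' y).2) := by
    intro e' he' y hy hye' r hr hmem t ht
    simp only [ψ]
    rw [if_pos ⟨hy, ht.trans_le hr⟩]
    exact IsBox.symm_eq_symm h (he y (hOK hy)) he' (hes y (hOK hy)) hye'
      (fun s hs => het y (hOK hy) s (hs.trans_le hr)) hmem ht
  have hψO : ∀ t, ∀ y ∈ O, ψ t y ∈ O := by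
    intro t y hy
    by_cases ht : ‖t‖ < ε
    · have hyK := hOK hy
      -- All small translates of `y` form a connected subset of a level set, so `hinv` keeps them in
      -- `O`.
      let C : Set M := (fun s => (e y).symm ((e y y).1 + s, (e y y).2)) '' Metric.ball 0 ε
      have hmem : ∀ s ∈ Metric.ball (0 : Fin p → ℝ) ε, ((e y y).1 + s, (e y y).2) ∈ (e y).target :=
        fun s hs => het y hyK s (by simpa using hs)
      have hC : IsPreconnected C := by
        refine (convex_ball (0 : Fin p → ℝ) ε).isPreconnected.image _ ?_
        exact (e y).symm.contMDiffOn.continuousOn.comp (by fun_prop) hmem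
      have hCO : C ⊆ O := by
        refine hinv y hy C hC ⟨0, by simpa using hε, ?_⟩ ?_
        · simp only [add_zero]
          exact (e y).symm_apply_apply (hes y hyK)
        · rintro _ ⟨s, hs, rfl⟩
          refine integralMap_eq_iff.1 ?_
          have h1 := (he y hyK).snd _ ((e y).symm_apply_mem_source (hmem s hs))
          rw [(e y).apply_symm_apply (hmem s hs)] at h1
          rw [← h1]
          exact (he y hyK).snd y (hes y hyK)
      simp only [ψ]
      rw [if_pos ⟨hy, ht⟩]
      exact hCO ⟨t, by simpa using ht, rfl⟩
    · simp only [ψ]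
      rw [if_neg (fun h => ht h.2)]
      exact hy
  have hψout : ∀ t, ∀ y ∉ O, ψ t y = y := fun t y hy => if_neg fun h => hy h.1
  have hψ0 : ψ 0 = id := by
    funext y
    by_cases hy : y ∈ O
    · rw [hψ (e y) (he y (hOK hy)) y hy (hes y (hOK hy)) ε le_rfl (het y (hOK hy)) 0
        (by simpa using hε), add_zero]
      exact (e y).symm_apply_apply (hes y (hOK hy))
    · exact hψout 0 y hy
  have hψadd : ∀ s t, ‖s‖ + ‖t‖ < ε → ∀ y, ψ (s + t) y = ψ s (ψ t y) := by
    intro s t hst y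
    by_cases hy : y ∈ O
    · have hyK := hOK hy
      have hb := hψ (e y) (he y hyK) y hy (hes y hyK) ε le_rfl (het y hyK)
      have htε : ‖t‖ < ε := by linarith [norm_nonneg s]
      have hmem := het y hyK t htε
      have hy' := hψO t y hy
      rw [hb (s + t) ((norm_add_le s t).trans_lt hst)]
      have hy's : ψ t y ∈ (e y).source := by
        rw [hb t htε]
        exact (e y).symm_apply_mem_source hmem
      have hval : e y (ψ t y) = ((e y y).1 + t, (e y y).2) := by
        rw [hb t htε]
        exact (e y).apply_symm_apply hmem
      -- Seen from the translated point, the box of `y` is only known to contain translations of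
      -- size less than `ε - ‖t‖`. This is enough because `‖s‖ + ‖t‖ < ε`.
      rw [hψ (e y) (he y hyK) (ψ t y) hy' hy's (ε - ‖t‖) (by linarith [norm_nonneg t])
        (fun s' hs' => ?_) s (by linarith), hval]
      · simp only [add_assoc, add_comm s t]
      · rw [hval]
        simp only [add_assoc]
        exact het y hyK _ (lt_of_le_of_lt (norm_add_le t s') (by linarith))
    · rw [hψout t y hy, hψout s y hy, hψout (s + t) y hy]
  obtain ⟨Ψ, hΨ0, hΨadd, hΨ⟩ := exists_hom_of_local_hom (G := Function.End M) (f := ψ) hε hψ0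
    (fun s t hst => funext fun y => hψadd s t hst y)
  have hpow : ∀ t, ∀ n : ℕ, Ψ ((n : ℝ) • t) = Ψ t ^ n := by
    intro t n
    induction n with
    | zero => simpa using hΨ0
    | succ n ih =>
      push_cast
      rw [add_smul, one_smul, hΨadd, ih, pow_succ]
  refine ⟨ε, Ψ, hO, hε, fun y => congrFun hΨ0 y, fun s t y => congrFun (hΨadd s t) y, ?_, ?_, ?_⟩
  · intro t y hy
    obtain ⟨n, hn⟩ := exists_nat_gt (‖t‖ / ε)
    have hn0 : (0 : ℝ) < n := lt_of_le_of_lt (by positivity) hn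
    have h1 : ‖(n : ℝ)⁻¹ • t‖ < ε := by
      rw [norm_smul, norm_inv, Real.norm_natCast, inv_mul_lt_iff₀ hn0]
      exact (div_lt_iff₀ hε).1 hn
    have h2 : Ψ t = (Ψ ((n : ℝ)⁻¹ • t)) ^ n := by
      rw [← hpow, smul_smul, mul_inv_cancel₀ hn0.ne', one_smul]
    have h3 : ∀ m : ℕ, (Ψ ((n : ℝ)⁻¹ • t) ^ m) y ∈ O := by
      intro m
      induction m with
      | zero => exact hy
      | succ m ih =>
        rw [pow_succ', hΨ _ h1]
        rw [hΨ _ h1] at ih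
        exact hψO _ _ ih
    rw [h2]
    exact h3 n
  · exact fun y hy => ⟨e y, he y (hOK hy), hes y (hOK hy), het y (hOK hy)⟩
  · intro e' he' y hy hye' r hr hmem t ht
    rw [hΨ t (ht.trans_le hr)]
    exact hψ e' he' y hy hye' r hr hmem t ht

namespace IsLeafAction

variable {O : Set M} {ε : ℝ} {Ψ : (Fin p → ℝ) → M → M}

theorem neg_apply (H : IsLeafAction X F O ε Ψ) (t : Fin p → ℝ) (y : M) : Ψ (-t) (Ψ t y) = y := by
  rw [← H.add, neg_add_cancel, H.zero]

theorem comm (H : IsLeafAction X F O ε Ψ) (s t : Fin p → ℝ) (y : M) :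
    Ψ s (Ψ t y) = Ψ t (Ψ s y) := by
  rw [← H.add, ← H.add, add_comm]

/-- A property of the elements of `ℝ^p` that holds near zero and passes from `t / 2` to `t` holds
everywhere. -/
theorem induction_halving (H : IsLeafAction X F O ε Ψ) {P : (Fin p → ℝ) → Prop}
    (h0 : ∀ t, ‖t‖ < ε → P t) (h2 : ∀ t, P ((1 / 2 : ℝ) • t) → P t) (t : Fin p → ℝ) : P t := by
  have key : ∀ n : ℕ, ∀ t : Fin p → ℝ, ‖t‖ < 2 ^ n * ε → P t := by
    intro n
    induction n with
    | zero => intro t ht; exact h0 t (by simpa using ht)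
    | succ n ih =>
      intro t ht
      refine h2 t (ih _ ?_)
      rw [norm_smul]
      norm_num
      rw [pow_succ] at ht
      linarith
  obtain ⟨n, hn⟩ := pow_unbounded_of_one_lt (‖t‖ / ε) one_lt_two
  exact key n t ((div_lt_iff₀ H.pos).1 hn)

theorem half_half (H : IsLeafAction X F O ε Ψ) (t : Fin p → ℝ) (y : M) :
    Ψ ((1 / 2 : ℝ) • t) (Ψ ((1 / 2 : ℝ) • t) y) = Ψ t y := by
  rw [← H.add, ← add_smul]
  norm_num

theorem integralMap_apply (H : IsLeafAction X F O ε Ψ) (t : Fin p → ℝ) {y : M} (hy : y ∈ O) :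
    integralMap F (Ψ t y) = integralMap F y := by
  refine H.induction_halving (P := fun t => ∀ y ∈ O, integralMap F (Ψ t y) = integralMap F y)
    ?_ ?_ t y hy
  · intro t ht y hy
    obtain ⟨e, he, hye, hmem⟩ := H.exists_box y hy
    rw [H.box e he y hy hye ε le_rfl hmem t ht,
      ← he.snd _ (e.symm_apply_mem_source (hmem t ht)), e.apply_symm_apply (hmem t ht)]
    exact he.snd y hye
  · intro t ht y hy
    rw [← H.half_half, ht _ (H.mapsTo _ _ hy), ht y hy]

/-- In a box around `y`, small elements act as translations, uniformly near `y`. -/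
theorem eventually_box (H : IsLeafAction X F O ε Ψ) {y : M} (hy : y ∈ O) {r : ℝ} (hr : r < ε) :
    ∃ e : PartialDiffeomorph (𝓡 (p + q)) 𝓘(ℝ, Model p q) M (Model p q) ∞,
      IsBox X F e ∧ y ∈ e.source ∧ ∀ᶠ y' in 𝓝 y, y' ∈ O ∧ y' ∈ e.source ∧ ∀ t, ‖t‖ < r →
        ((e y').1 + t, (e y').2) ∈ e.target ∧ Ψ t y' = e.symm ((e y').1 + t, (e y').2) := by
  obtain ⟨e, he, hye, hmem⟩ := H.exists_box y hy
  refine ⟨e, he, hye, ?_⟩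
  -- The strict inequality `r < ε` leaves a compact ball of translations, so one neighbourhood of
  -- `y` serves all of them.
  have h1 : ∀ᶠ y' in 𝓝 y, ∀ t ∈ Metric.closedBall (0 : Fin p → ℝ) r,
      ((e y').1 + t, (e y').2) ∈ e.target := by
    refine (isCompact_closedBall (0 : Fin p → ℝ) r).eventually_forall_of_forall_eventually
      fun t ht => ?_
    have h2 : ContinuousAt (fun z : M × (Fin p → ℝ) => ((e z.1).1 + z.2, (e z.1).2)) (y, t) := by
      have h3 : ContinuousAt (fun z : M × (Fin p → ℝ) => e z.1) (y, t) :=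
        ContinuousAt.comp (f := Prod.fst) (x := (y, t)) (e.contMDiffAt hye).continuousAt
          continuousAt_fst
      exact (h3.fst.add continuousAt_snd).prodMk h3.snd
    refine h2.eventually_mem (e.open_target.mem_nhds (hmem t ?_))
    exact lt_of_le_of_lt (by simpa using ht) hr
  filter_upwards [h1, H.isOpen.mem_nhds hy, e.open_source.mem_nhds hye] with y' h1 h2 h3
  refine ⟨h2, h3, fun t ht => ⟨h1 t (by simpa using ht.le), ?_⟩⟩
  exact H.box e he y' h2 h3 r hr.le (fun t ht => h1 t (by simpa using ht.le)) t ht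

/-- For small `t` the action is a translation in a box, hence jointly smooth. Large `t` are reached
by composing two actions of `t / 2`. -/
theorem contMDiffAt (H : IsLeafAction X F O ε Ψ) (t : Fin p → ℝ) {y : M} (hy : y ∈ O) :
    ContMDiffAt (𝓘(ℝ, Fin p → ℝ).prod (𝓡 (p + q))) (𝓡 (p + q)) ∞
      (fun w : (Fin p → ℝ) × M => Ψ w.1 w.2) (t, y) := by
  refine H.induction_halving (P := fun t => ∀ y ∈ O,
    ContMDiffAt (𝓘(ℝ, Fin p → ℝ).prod (𝓡 (p + q))) (𝓡 (p + q)) ∞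
      (fun w : (Fin p → ℝ) × M => Ψ w.1 w.2) (t, y)) ?_ ?_ t y hy
  · intro t ht y hy
    obtain ⟨r, htr, hr⟩ := exists_between ht
    obtain ⟨e, he, hye, hev⟩ := H.eventually_box hy hr
    have h1 : ∀ᶠ w : (Fin p → ℝ) × M in 𝓝 (t, y),
        Ψ w.1 w.2 = e.symm ((e w.2).1 + w.1, (e w.2).2) := by
      have h2 : ∀ᶠ s : Fin p → ℝ in 𝓝 t, ‖s‖ < r :=
        continuous_norm.continuousAt.eventually_lt continuousAt_const htr
      rw [nhds_prod_eq]
      filter_upwards [h2.prod_mk hev] with w hw using (hw.2.2.2 w.1 hw.1).2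
    refine ContMDiffAt.congr_of_eventuallyEq ?_ h1
    have h3 : ContMDiffAt (𝓘(ℝ, Fin p → ℝ).prod (𝓡 (p + q))) 𝓘(ℝ, Model p q) ∞
        (fun w : (Fin p → ℝ) × M => e w.2) (t, y) :=
      ContMDiffAt.comp (t, y) (e.contMDiffAt hye) contMDiffAt_snd
    have h5 : ContMDiffAt (𝓘(ℝ, Fin p → ℝ).prod (𝓡 (p + q))) 𝓘(ℝ, Model p q) ∞
        (fun w : (Fin p → ℝ) × M => (((e w.2).1 + w.1, (e w.2).2) : Model p q)) (t, y) := by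
      have h6 : ContMDiffAt (𝓘(ℝ, Fin p → ℝ).prod (𝓡 (p + q))) 𝓘(ℝ, Fin p → ℝ) ∞
          (fun w : (Fin p → ℝ) × M => (e w.2).1) (t, y) :=
        (contDiff_fst.contMDiff (n := ∞)).contMDiffAt.comp (t, y) h3
      have h7 : ContMDiffAt (𝓘(ℝ, Fin p → ℝ).prod (𝓡 (p + q))) 𝓘(ℝ, E q) ∞
          (fun w : (Fin p → ℝ) × M => (e w.2).2) (t, y) :=
        (contDiff_snd.contMDiff (n := ∞)).contMDiffAt.comp (t, y) h3
      exact (h6.add contMDiffAt_fst).prodMk_space h7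
    have h8 : ((e y).1 + t, (e y).2) ∈ e.target := (hev.self_of_nhds.2.2 t htr).1
    exact ContMDiffAt.comp (t, y) (e.contMDiffAt_symm h8) h5
  · intro t ht y hy
    have h1 : (fun w : (Fin p → ℝ) × M => Ψ w.1 w.2) =
        fun w => Ψ ((1 / 2 : ℝ) • w.1) (Ψ ((1 / 2 : ℝ) • w.1) w.2) := by
      funext w
      rw [H.half_half]
    have h2 : ContMDiffAt (𝓘(ℝ, Fin p → ℝ).prod (𝓡 (p + q))) 𝓘(ℝ, Fin p → ℝ) ∞
        (fun w : (Fin p → ℝ) × M => (1 / 2 : ℝ) • w.1) (t, y) :=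
      (((1 / 2 : ℝ) • ContinuousLinearMap.id ℝ (Fin p → ℝ)).contDiff.contMDiff
        (n := ∞)).contMDiffAt.comp (t, y) contMDiffAt_fst
    have h3 : ContMDiffAt (𝓘(ℝ, Fin p → ℝ).prod (𝓡 (p + q))) (𝓡 (p + q)) ∞
        (fun w : (Fin p → ℝ) × M => Ψ ((1 / 2 : ℝ) • w.1) w.2) (t, y) :=
      ContMDiffAt.comp (t, y) (g := fun w : (Fin p → ℝ) × M => Ψ w.1 w.2)
        (f := fun w : (Fin p → ℝ) × M => ((1 / 2 : ℝ) • w.1, w.2)) (ht y hy)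
        (h2.prodMk contMDiffAt_snd)
    rw [h1]
    exact ContMDiffAt.comp (t, y) (g := fun w : (Fin p → ℝ) × M => Ψ w.1 w.2)
        (f := fun w : (Fin p → ℝ) × M => ((1 / 2 : ℝ) • w.1, Ψ ((1 / 2 : ℝ) • w.1) w.2))
        (ht _ (H.mapsTo _ _ hy)) (h2.prodMk h3)

theorem contMDiffAt_orbit (H : IsLeafAction X F O ε Ψ) (t : Fin p → ℝ) {y : M} (hy : y ∈ O) :
    ContMDiffAt 𝓘(ℝ, Fin p → ℝ) (𝓡 (p + q)) ∞ (fun t => Ψ t y) t :=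
  ContMDiffAt.comp t (g := fun w : (Fin p → ℝ) × M => Ψ w.1 w.2) (f := fun t => (t, y))
    (H.contMDiffAt t hy) (contMDiffAt_id.prodMk contMDiffAt_const)

theorem contMDiffAt_apply (H : IsLeafAction X F O ε Ψ) (t : Fin p → ℝ) {y : M} (hy : y ∈ O) :
    ContMDiffAt (𝓡 (p + q)) (𝓡 (p + q)) ∞ (Ψ t) y :=
  ContMDiffAt.comp y (g := fun w : (Fin p → ℝ) × M => Ψ w.1 w.2) (f := fun y => (t, y))
    (H.contMDiffAt t hy) (contMDiffAt_const.prodMk contMDiffAt_id)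

/-- This recovers the fields from the action: differentiating a commutation relation with `Ψ` at
time zero yields a relation for the `X_i`. -/
theorem dmap_orbit_zero (H : IsLeafAction X F O ε Ψ) {y : M} (hy : y ∈ O) (c : Fin p → ℝ) :
    dmap (Fin p → ℝ) (E (p + q)) (fun t => Ψ t y) 0 c = fieldVec (sumField X c) y := by
  obtain ⟨e, he, hye, hmem⟩ := H.exists_box y hy
  have h1 : (fun t => Ψ t y) =ᶠ[𝓝 0] fun t => e.symm ((e y).1 + t, (e y).2) := by
    have h2 : ∀ᶠ s : Fin p → ℝ in 𝓝 0, ‖s‖ < ε :=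
      continuous_norm.continuousAt.eventually_lt continuousAt_const (by simpa using H.pos)
    filter_upwards [h2] with t ht using H.box e he y hy hye ε le_rfl hmem t ht
  have h2 : HasFDerivAt (fun t : Fin p → ℝ => (((e y).1 + t, (e y).2) : Model p q))
      (ContinuousLinearMap.inl ℝ (Fin p → ℝ) (E q)) 0 :=
    ((hasFDerivAt_id (𝕜 := ℝ) (0 : Fin p → ℝ)).const_add (e y).1).prodMk (hasFDerivAt_const _ _)
  have h3 : (((e y).1 + (0 : Fin p → ℝ), (e y).2) : Model p q) = e y := by simp
  have h4 := e.mdiffAt_symm (e.apply_mem_target hye)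
  rw [dmap_congr h1, dmap_comp (g := e.symm) (f := fun t => (((e y).1 + t, (e y).2) : Model p q))
    (by rw [h3]; exact h4) h2.differentiableAt.mdifferentiableAt, dmap_eq_fderiv, h2.fderiv, h3]
  have h5 := he.dmap_symm (e.apply_mem_target hye) c
  rw [e.symm_apply_apply hye] at h5
  exact h5

/-- The action is locally free, with a uniform bound, because nonzero translations have no fixed
point in a box. -/
theorem eq_zero_of_apply_eq (H : IsLeafAction X F O ε Ψ) {y : M} (hy : y ∈ O) {t : Fin p → ℝ}
    (ht : ‖t‖ < ε) (h : Ψ t y = y) : t = 0 := by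
  obtain ⟨e, he, hye, hmem⟩ := H.exists_box y hy
  rw [H.box e he y hy hye ε le_rfl hmem t ht] at h
  have h1 := congrArg e h
  rw [e.apply_symm_apply (hmem t ht)] at h1
  have h2 := congrArg Prod.fst h1
  simpa using h2

end IsLeafAction
end LeafAction
end LiouvilleSystem

namespace LiouvilleSystem

/-! ### The covering of the torus -/

section Torus

variable {p : ℕ}

theorem toTorus_add (s t : Fin p → ℝ) :
    toTorus (s + t) = toTorus s + toTorus t := rfl

theorem toTorus_sub (s t : Fin p → ℝ) :
    toTorus (s - t) = toTorus s - toTorus t := rfl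

theorem toTorus_zero : toTorus (0 : Fin p → ℝ) = 0 := rfl

theorem toTorus_surjective : Function.Surjective (toTorus (p := p)) := by
  intro g
  choose t ht using fun i => QuotientAddGroup.mk_surjective (g i)
  exact ⟨t, funext ht⟩

theorem toTorus_eq_zero_iff {t : Fin p → ℝ} :
    toTorus t = 0 ↔ ∃ m : Fin p → ℤ, t = fun i => (m i : ℝ) := by
  constructor
  · intro h
    have h1 : ∀ i, ∃ n : ℤ, n • (1 : ℝ) = t i := fun i =>
      (AddCircle.coe_eq_zero_iff (1 : ℝ)).1 (congrFun h i)
    choose m hm using h1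
    exact ⟨m, funext fun i => by rw [← hm i]; simp⟩
  · rintro ⟨m, rfl⟩
    funext i
    exact (AddCircle.coe_eq_zero_iff (1 : ℝ)).2 ⟨m i, by simp⟩

end Torus

/-! ### The compact leaf and its lattice of periods -/

section CompactLeaf
open Filter Topology

variable {p q : ℕ} {M : Type*} [TopologicalSpace M] [ChartedSpace (E (p + q)) M]
  [IsManifold (𝓡 (p + q)) ∞ M]
  {X : Fin p → (x : M) → TangentSpace (𝓡 (p + q)) x} {F : Fin q → M → ℝ}

/-- All points of a box are regular. -/
theorem IsBox.isRegularAt (h : IsIntegrableSystem X F)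
    {e : PartialDiffeomorph (𝓡 (p + q)) 𝓘(ℝ, Model p q) M (Model p q) ∞}
    (he : IsBox X F e) {y : M} (hy : y ∈ e.source) : IsRegularAt X F y := by
  let D : E (p + q) →L[ℝ] Model p q := dmap (E (p + q)) (Model p q) e y
  have hD : ∀ v, (D v).2 = dmap (E (p + q)) (E q) (integralMap F) y v := fun v => by
    have h1 := dmap_apply_of_comp_eq (E' := E q) (f := Prod.snd) (g := integralMap F)
      (e.mdiffAt hy) differentiableAt_snd.mdifferentiableAt
      (by filter_upwards [e.open_source.mem_nhds hy] with y hy using he.snd y hy) v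
    rw [dmap_eq_fderiv, fderiv_snd] at h1
    exact h1
  constructor
  · have h1 : LinearIndependent ℝ (fun i => fieldVec (X i) y) := by
      rw [Fintype.linearIndependent_iff]
      intro c hc i
      have h2 := congrArg D hc
      rw [map_sum, map_zero] at h2
      simp only [map_smul, D, he.dmap_field y hy] at h2
      have h3 := congrFun (congrArg Prod.fst h2) i
      rw [Prod.fst_sum, Finset.sum_apply] at h3
      simpa [Pi.single_apply] using h3
    exact h1
  · have h1 : LinearIndependent ℝ
        (fun j => (dmap (E (p + q)) ℝ (F j) y : E (p + q) →L[ℝ] ℝ)) := by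
      rw [Fintype.linearIndependent_iff]
      intro c hc j
      let v : E (p + q) := dmap (Model p q) (E (p + q)) e.symm (e y) (0, EuclideanSpace.single j 1)
      have hv : D v = (0, EuclideanSpace.single j 1) :=
        DFunLike.congr_fun (e.dmap_comp_dmap_symm hy) _
      have h2 := DFunLike.congr_fun hc v
      rw [_root_.sum_apply] at h2
      simp only [_root_.smul_apply, ← dmap_integralMap_apply h.smooth_integrals] at h2
      rw [← hD, hv] at h2
      simpa using h2
    exact h1

/-- Around a compact full level set of regular points, the fields generate an action. -/
theorem exists_isLeafAction_of_isCompact [T2Space M] (h : IsIntegrableSystem X F) {N : Set M}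
    {x₀ : M} (hN : N = levelSet F x₀) (hc : IsCompact N) (hreg : ∀ y ∈ N, IsRegularAt X F y) :
    ∃ O ε Ψ, IsLeafAction X F O ε Ψ ∧ N ⊆ O ∧ ∀ y ∈ O, IsRegularAt X F y := by
  have hloc : LocallyCompactSpace M := Manifold.locallyCompact_of_finiteDimensional (𝓡 (p + q))
  have hF := (contMDiff_integralMap h.smooth_integrals).continuous
  obtain ⟨R, hR, hNR, hRreg⟩ : ∃ R : Set M, IsOpen R ∧ N ⊆ R ∧ ∀ y ∈ R, IsRegularAt X F y := by
    refine ⟨{y | ∃ e : PartialDiffeomorph (𝓡 (p + q)) 𝓘(ℝ, Model p q) M (Model p q) ∞,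
      IsBox X F e ∧ y ∈ e.source}, ?_, ?_, ?_⟩
    · rw [isOpen_iff_mem_nhds]
      rintro y ⟨e, he, hy⟩
      filter_upwards [e.open_source.mem_nhds hy] with y' hy' using ⟨e, he, hy'⟩
    · intro y hy
      obtain ⟨e, he, hye, -⟩ := exists_isBox h (hreg y hy)
      exact ⟨e, he, hye⟩
    · rintro y ⟨e, he, hy⟩
      exact he.isRegularAt h hy
  obtain ⟨K, hK, hNK, hKR⟩ := exists_compact_between hc hR hNR
  -- The levels that meet the boundary part of `K` are discarded, so a connected piece of a
  -- remaining level that starts in the interior of `K` cannot leave it. The level of `N` survives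
  -- because `N` is the full level set and lies in the interior.
  let B : Set (E q) := integralMap F '' (K \ interior K)
  have hB : IsClosed B := ((hK.diff isOpen_interior).image hF).isClosed
  let O : Set M := interior K ∩ integralMap F ⁻¹' Bᶜ
  have hOK : O ⊆ K := fun y hy => interior_subset hy.1
  have hO : IsOpen O := isOpen_interior.inter (hB.isOpen_compl.preimage hF)
  obtain ⟨ε, Ψ, H⟩ := exists_isLeafAction h (O := O) hK (fun y hy => hRreg y (hKR hy)) hO hOK (by
    intro y hy C hC hyC hCl
    have h1 : ∀ y' ∈ C, integralMap F y' = integralMap F y := fun y' hy' =>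
      integralMap_eq_iff.2 (hCl hy')
    have h2 : C ⊆ interior K := by
      refine hC.subset_left_of_subset_union isOpen_interior hK.isClosed.isOpen_compl
        (disjoint_compl_right.mono_left interior_subset) (fun y' hy' => ?_) ⟨y, hyC, hy.1⟩
      by_cases h3 : y' ∈ K
      · by_cases h4 : y' ∈ interior K
        · exact Or.inl h4
        · exact (hy.2 ⟨y', ⟨h3, h4⟩, h1 y' hy'⟩).elim
      · exact Or.inr h3
    exact fun y' hy' => ⟨h2 hy', by
      rw [mem_preimage, h1 y' hy']
      exact hy.2⟩)
  refine ⟨O, ε, Ψ, H, fun y hy => ⟨hNK hy, ?_⟩, fun y hy => hRreg y (hKR (hOK hy))⟩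
  rintro ⟨y', ⟨h1, h2⟩, h3⟩
  refine h2 (hNK ?_)
  rw [hN] at hy ⊢
  exact fun j => (integralMap_eq_iff.1 h3 j).trans (hy j)

namespace IsLeafAction

variable {O : Set M} {ε : ℝ} {Ψ : (Fin p → ℝ) → M → M}

/-- The leaf action is locally transitive on the level sets. -/
theorem eventually_exists_apply_eq (H : IsLeafAction X F O ε Ψ) {y : M} (hy : y ∈ O) :
    ∀ᶠ y' in 𝓝 y, integralMap F y' = integralMap F y → ∃ t, ‖t‖ < ε ∧ Ψ t y = y' := by
  obtain ⟨e, he, hye, hmem⟩ := H.exists_box y hy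
  have h1 : ∀ᶠ y' in 𝓝 y, ‖(e y').1 - (e y).1‖ < ε := by
    have h2 : ContinuousAt (fun y' => ‖(e y').1 - (e y).1‖) y :=
      ((e.contMDiffAt hye).continuousAt.fst.sub continuousAt_const).norm
    refine h2.eventually_lt continuousAt_const ?_
    simpa using H.pos
  filter_upwards [h1, e.open_source.mem_nhds hye] with y' h1 h2 h3
  refine ⟨_, h1, ?_⟩
  rw [H.box e he y hy hye ε le_rfl hmem _ h1, add_sub_cancel, he.snd y hye, ← h3, ← he.snd y' h2]
  exact e.symm_apply_apply h2

/-- A connected level set is an orbit. -/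
theorem exists_apply_eq (H : IsLeafAction X F O ε Ψ) {N : Set M} {x₀ : M} (hN : N = levelSet F x₀)
    (hNO : N ⊆ O) (hc : IsPreconnected N) {x y : M} (hx : x ∈ N) (hy : y ∈ N) :
    ∃ t, Ψ t x = y := by
  refine hc.induction₂ (fun x y => ∃ t, Ψ t x = y) ?_ ?_ ?_ hx hy
  · intro x hx
    filter_upwards [mem_nhdsWithin_of_mem_nhds (H.eventually_exists_apply_eq (hNO hx)),
      self_mem_nhdsWithin] with y h1 hy
    obtain ⟨t, -, ht⟩ := h1 (integralMap_eq_iff.2 fun j => by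
      rw [hN] at hx hy
      rw [hx j, hy j])
    exact ⟨t, ht⟩
  · rintro x y z - - - ⟨t, rfl⟩ ⟨s, rfl⟩
    exact ⟨s + t, H.add s t x⟩
  · rintro x y - - ⟨t, rfl⟩
    exact ⟨-t, H.neg_apply t x⟩

/-- The stabilizer of a point under the leaf action. -/
def stabilizer (H : IsLeafAction X F O ε Ψ) (x : M) : AddSubgroup (Fin p → ℝ) where
  carrier := {t | Ψ t x = x}
  zero_mem' := H.zero x
  add_mem' := fun {s t} hs ht => by
    rw [mem_ofPred_eq] at hs ht ⊢
    rw [H.add, ht, hs]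
  neg_mem' := fun {t} ht => by
    rw [mem_ofPred_eq] at ht ⊢
    conv_lhs => rw [← ht]
    exact H.neg_apply t x

theorem mem_stabilizer (H : IsLeafAction X F O ε Ψ) {x : M} {t : Fin p → ℝ} :
    t ∈ H.stabilizer x ↔ Ψ t x = x := Iff.rfl

/-- Local freeness isolates `0` among the periods, and in a topological group this suffices for
discreteness. -/
theorem discreteTopology_stabilizer (H : IsLeafAction X F O ε Ψ) {x : M} (hx : x ∈ O) :
    DiscreteTopology (H.stabilizer x) := by
  refine discreteTopology_of_isOpen_singleton_zero ?_
  have h1 : ({0} : Set (H.stabilizer x)) = Subtype.val ⁻¹' Metric.ball (0 : Fin p → ℝ) ε := by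
    ext ⟨t, ht⟩
    simp only [mem_singleton_iff, mem_preimage, mem_ball_zero_iff]
    refine ⟨fun h => ?_, fun h => Subtype.ext (H.eq_zero_of_apply_eq hx h ht)⟩
    have h0 : t = 0 := congrArg Subtype.val h
    rw [h0, norm_zero]
    exact H.pos
  rw [h1]
  exact Metric.isOpen_ball.preimage continuous_subtype_val

/-- The stabilizer of a point with compact orbit spans. -/
theorem span_stabilizer (H : IsLeafAction X F O ε Ψ) {N : Set M} {x₀ : M} (hN : N = levelSet F x₀)
    (hNO : N ⊆ O) (hc : IsPreconnected N) (hcomp : IsCompact N) :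
    Submodule.span ℝ (H.stabilizer x₀ : Set (Fin p → ℝ)) = ⊤ := by
  have hx₀ : x₀ ∈ N := by rw [hN]; exact fun j => rfl
  -- By local transitivity and compactness, a bounded set of times already sweeps out the whole
  -- orbit.
  obtain ⟨R, hR⟩ : ∃ R : ℝ, ∀ y ∈ N, ∃ t, ‖t‖ ≤ R ∧ Ψ t x₀ = y := by
    refine hcomp.induction_on (p := fun K => ∃ R : ℝ, ∀ y ∈ K, ∃ t, ‖t‖ ≤ R ∧ Ψ t x₀ = y)
      ⟨0, by simp⟩ ?_ ?_ ?_
    · rintro s t hst ⟨R, hR⟩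
      exact ⟨R, fun y hy => hR y (hst hy)⟩
    · rintro s t ⟨R, hR⟩ ⟨R', hR'⟩
      refine ⟨max R R', ?_⟩
      rintro y (hy | hy)
      · obtain ⟨t, h1, h2⟩ := hR y hy
        exact ⟨t, h1.trans (le_max_left _ _), h2⟩
      · obtain ⟨t, h1, h2⟩ := hR' y hy
        exact ⟨t, h1.trans (le_max_right _ _), h2⟩
    · intro y hy
      obtain ⟨s, rfl⟩ := H.exists_apply_eq hN hNO hc hx₀ hy
      refine ⟨_, inter_mem_nhdsWithin _ (H.eventually_exists_apply_eq (hNO hy)), ε + ‖s‖, ?_⟩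
      rintro y' ⟨hy'N, hy'⟩
      obtain ⟨t, ht, rfl⟩ := hy' (integralMap_eq_iff.2 fun j => by
        rw [hN] at hy hy'N
        rw [hy j, hy'N j])
      exact ⟨t + s, (norm_add_le t s).trans (by linarith), H.add t s x₀⟩
  by_contra hne
  obtain ⟨g, hg, hle⟩ := Submodule.exists_le_ker_of_lt_top _ (lt_top_iff_ne_top.2 hne)
  -- If a functional `g` kills the periods, then `g s` depends only on the point `Ψ s x₀`, which is
  -- also reached at a bounded time. Thus `g` is bounded on `ℝ^p` and must vanish.
  have h1 : ∀ s, ∃ t, ‖t‖ ≤ R ∧ g s = g t := by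
    intro s
    obtain ⟨t, ht, hts⟩ := hR (Ψ s x₀) (by
      have h2 := integralMap_eq_iff.1 (H.integralMap_apply s (hNO hx₀))
      rw [hN]
      exact h2)
    refine ⟨t, ht, ?_⟩
    have h3 : s - t ∈ H.stabilizer x₀ := by
      rw [mem_stabilizer, sub_eq_neg_add, H.add, ← hts, H.neg_apply]
    have h4 : g (s - t) = 0 := hle (Submodule.subset_span h3)
    rwa [map_sub, sub_eq_zero] at h4
  let g' : (Fin p → ℝ) →L[ℝ] ℝ := LinearMap.toContinuousLinearMap g
  have h2 : ∀ s, |g s| ≤ ‖g'‖ * R := by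
    intro s
    obtain ⟨t, ht, hst⟩ := h1 s
    rw [hst]
    exact (g'.le_opNorm t).trans (by gcongr)
  refine hg (LinearMap.ext fun s => ?_)
  rw [LinearMap.zero_apply]
  by_contra hs
  obtain ⟨n, hn⟩ := exists_nat_gt (‖g'‖ * R / |g s|)
  have h3 := h2 ((n : ℝ) • s)
  rw [map_smul, smul_eq_mul, abs_mul, Nat.abs_cast] at h3
  rw [div_lt_iff₀ (abs_pos.2 hs)] at hn
  linarith

/-- The stabilizer of a point with compact orbit is a lattice. -/
theorem exists_periods (H : IsLeafAction X F O ε Ψ) {N : Set M} {x₀ : M} (hN : N = levelSet F x₀)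
    (hNO : N ⊆ O) (hc : IsPreconnected N) (hcomp : IsCompact N) :
    ∃ L : (Fin p → ℝ) ≃L[ℝ] (Fin p → ℝ), ∀ t, Ψ (L t) x₀ = x₀ ↔ toTorus t = 0 := by
  have hx₀ : x₀ ∈ N := by rw [hN]; exact fun j => rfl
  let Λ : Submodule ℤ (Fin p → ℝ) := AddSubgroup.toIntSubmodule (H.stabilizer x₀)
  have : DiscreteTopology Λ := H.discreteTopology_stabilizer (hNO hx₀)
  have : IsZLattice ℝ Λ := ⟨H.span_stabilizer hN hNO hc hcomp⟩
  have hfree := ZLattice.module_free ℝ Λ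
  have hfin := ZLattice.module_finite ℝ Λ
  have hrank : Module.finrank ℤ Λ = p := by
    rw [ZLattice.rank ℝ Λ]
    simp
  -- A `ℤ`-basis of the lattice is an `ℝ`-basis of `ℝ^p`; the isomorphism it defines carries `ℤ^p`
  -- onto the periods.
  let b : Module.Basis (Fin p) ℤ Λ := Module.finBasisOfFinrankEq ℤ Λ hrank
  let B : Module.Basis (Fin p) ℝ (Fin p → ℝ) := b.ofZLatticeBasis ℝ Λ
  refine ⟨B.equivFun.symm.toContinuousLinearEquiv, fun t => ?_⟩
  have h1 : Ψ (B.equivFun.symm.toContinuousLinearEquiv t) x₀ = x₀ ↔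
      B.equivFun.symm t ∈ Λ := Iff.rfl
  rw [h1, toTorus_eq_zero_iff]
  have h2 : B.equivFun.symm t = ∑ i, t i • ((b i : Λ) : Fin p → ℝ) := by
    rw [Module.Basis.equivFun_symm_apply]
    simp [B]
  rw [h2]
  constructor
  · intro h3
    obtain ⟨m, hm⟩ : ∃ m : Fin p → ℤ, ∑ i, t i • ((b i : Λ) : Fin p → ℝ) =
        ((∑ i, m i • b i : Λ) : Fin p → ℝ) :=
      ⟨b.equivFun ⟨_, h3⟩, (congrArg Subtype.val (b.sum_equivFun ⟨_, h3⟩)).symm⟩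
    refine ⟨m, B.equivFun.symm.injective ?_⟩
    rw [h2, hm, Module.Basis.equivFun_symm_apply, Submodule.coe_sum]
    refine Finset.sum_congr rfl fun i _ => ?_
    rw [Int.cast_smul_eq_zsmul, Module.Basis.ofZLatticeBasis_apply]
    rfl
  · rintro ⟨m, rfl⟩
    refine Submodule.sum_mem _ fun i _ => ?_
    rw [Int.cast_smul_eq_zsmul]
    exact Λ.smul_mem (m i) (b i).2

end IsLeafAction
end CompactLeaf
end LiouvilleSystem

namespace LiouvilleSystem

/-! ### Periods on the neighbouring levels -/

section TorusAction
open Filter Topology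

variable {p q : ℕ} {M : Type*} [TopologicalSpace M] [ChartedSpace (E (p + q)) M]
  [IsManifold (𝓡 (p + q)) ∞ M]
  {X : Fin p → (x : M) → TangentSpace (𝓡 (p + q)) x} {F : Fin q → M → ℝ}

namespace IsLeafAction

variable {O : Set M} {ε : ℝ} {Ψ : (Fin p → ℝ) → M → M}

/-- A local section of `(F_1, …, F_q)` through a point, together with the elements of `ℝ^p` that
move the section to the nearby points. -/
theorem exists_section (H : IsLeafAction X F O ε Ψ) {x₀ : M} (hx₀ : x₀ ∈ O) :
    ∃ (s : E q → M) (τ : M → Fin p → ℝ), s (integralMap F x₀) = x₀ ∧ τ x₀ = 0 ∧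
      (∀ᶠ z in 𝓝 (integralMap F x₀), ContMDiffAt 𝓘(ℝ, E q) (𝓡 (p + q)) ∞ s z ∧
        integralMap F (s z) = z) ∧
      ∀ᶠ y in 𝓝 x₀, ContMDiffAt (𝓡 (p + q)) 𝓘(ℝ, Fin p → ℝ) ∞ τ y ∧
        Ψ (τ y) (s (integralMap F y)) = y := by
  obtain ⟨e, he, hye, hev⟩ := H.eventually_box hx₀ (half_lt_self H.pos)
  have hx : e x₀ = ((e x₀).1, integralMap F x₀) := by rw [← he.snd x₀ hye]
  -- The section is a slice of a box with fixed first coordinates, and `τ` will be the difference of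
  -- first coordinates.
  let s : E q → M := fun z => e.symm ((e x₀).1, z)
  have hs0 : s (integralMap F x₀) = x₀ := by
    simp only [s]
    rw [← hx]
    exact e.symm_apply_apply hye
  have hpair : Continuous (fun z : E q => (((e x₀).1, z) : Model p q)) := by fun_prop
  have htar : ∀ᶠ z in 𝓝 (integralMap F x₀), (((e x₀).1, z) : Model p q) ∈ e.target :=
    hpair.continuousAt.eventually_mem (e.open_target.mem_nhds (by
      rw [← hx]
      exact e.apply_mem_target hye))
  have hs : ∀ᶠ z in 𝓝 (integralMap F x₀), ContMDiffAt 𝓘(ℝ, E q) (𝓡 (p + q)) ∞ s z ∧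
      integralMap F (s z) = z := by
    filter_upwards [htar] with z hz
    refine ⟨ContMDiffAt.comp z (e.contMDiffAt_symm hz)
      ((contDiff_const.prodMk contDiff_id).contMDiff.contMDiffAt), ?_⟩
    rw [← he.snd _ (e.symm_apply_mem_source hz), e.apply_symm_apply hz]
  refine ⟨s, fun y => (e y).1 - (e x₀).1, hs0, sub_self _, hs, ?_⟩
  have hF : ContinuousAt (integralMap F) x₀ := by
    have h1 : ContinuousAt (fun y => (e y).2) x₀ := (e.contMDiffAt hye).continuousAt.snd
    refine h1.congr ?_
    filter_upwards [e.open_source.mem_nhds hye] with y hy using he.snd y hy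
  have hsc : ContinuousAt (fun y => s (integralMap F y)) x₀ :=
    ContinuousAt.comp (f := integralMap F) hs.self_of_nhds.1.continuousAt hF
  rw [ContinuousAt, hs0] at hsc
  have hev' := hsc.eventually hev
  have hsmall : ∀ᶠ y in 𝓝 x₀, ‖(e y).1 - (e x₀).1‖ < ε / 2 := by
    have h2 : ContinuousAt (fun y' => ‖(e y').1 - (e x₀).1‖) x₀ :=
      ((e.contMDiffAt hye).continuousAt.fst.sub continuousAt_const).norm
    refine h2.eventually_lt continuousAt_const ?_
    simpa using H.pos
  filter_upwards [hev', hsmall, e.open_source.mem_nhds hye, hF.eventually htar]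
    with y h1 h2 h3 h4
  constructor
  · have h5 : ContMDiffAt (𝓡 (p + q)) 𝓘(ℝ, Fin p → ℝ) ∞ (fun y => (e y).1) y :=
      (contDiff_fst.contMDiff (n := ∞)).contMDiffAt.comp y (e.contMDiffAt h3)
    exact h5.sub contMDiffAt_const
  · rw [(h1.2.2 _ h2).2]
    simp only [s]
    rw [e.apply_symm_apply h4]
    simp only [add_sub_cancel]
    rw [← he.snd y h3]
    exact e.symm_apply_apply h3

/-- The periods of a compact orbit extend smoothly to the nearby orbits. -/
theorem exists_smooth_periods (H : IsLeafAction X F O ε Ψ) {x₀ : M} (hx₀ : x₀ ∈ O)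
    {s : E q → M} {τ : M → Fin p → ℝ} (hs0 : s (integralMap F x₀) = x₀) (hτ0 : τ x₀ = 0)
    (hs : ∀ᶠ z in 𝓝 (integralMap F x₀), ContMDiffAt 𝓘(ℝ, E q) (𝓡 (p + q)) ∞ s z ∧
        integralMap F (s z) = z)
    (hτ : ∀ᶠ y in 𝓝 x₀, ContMDiffAt (𝓡 (p + q)) 𝓘(ℝ, Fin p → ℝ) ∞ τ y ∧
        Ψ (τ y) (s (integralMap F y)) = y)
    (L : (Fin p → ℝ) →L[ℝ] (Fin p → ℝ)) (hL : ∀ t, toTorus t = 0 → Ψ (L t) x₀ = x₀) :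
    ∃ P : E q → (Fin p → ℝ) →L[ℝ] (Fin p → ℝ), P (integralMap F x₀) = L ∧
      ∀ᶠ z in 𝓝 (integralMap F x₀), ContDiffAt ℝ ∞ P z ∧
        ∀ t, toTorus t = 0 → Ψ (P z t) (s z) = s z := by
  let l : Fin p → Fin p → ℝ := fun a => L (Pi.single a 1)
  -- The period `l a` fixes `x₀`, hence moves `s z` to a point near `x₀` on the same level, which `μ
  -- a z` also reaches from `s z`. So `l a - μ a z` is a period of `s z`; it is smooth in `z` and
  -- equals `l a` at the centre.
  let μ : Fin p → E q → Fin p → ℝ := fun a z => τ (Ψ (l a) (s z))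
  let π : Fin p → (Fin p → ℝ) →L[ℝ] ℝ := fun a => ContinuousLinearMap.proj a
  have hl : ∀ a, Ψ (l a) x₀ = x₀ := fun a => hL _ (toTorus_eq_zero_iff.2
    ⟨Pi.single a 1, by
      funext i
      by_cases hi : i = a
      · subst hi; simp
      · simp [hi]⟩)
  refine ⟨fun z => ∑ a, (π a).smulRight (l a - μ a z), ?_, ?_⟩
  · ext t : 1
    have h1 : ∀ a, μ a (integralMap F x₀) = 0 := fun a => by
      simp only [μ]
      rw [hs0, hl, hτ0]
    simp only [h1, sub_zero, _root_.sum_apply, ContinuousLinearMap.smulRight_apply, π,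
      ContinuousLinearMap.proj_apply, l]
    conv_rhs => rw [pi_eq_sum_univ' t, map_sum]
    simp only [map_smul]
  · have hsO : ∀ᶠ z in 𝓝 (integralMap F x₀), s z ∈ O :=
      hs.self_of_nhds.1.continuousAt.eventually_mem (by
        rw [hs0]
        exact H.isOpen.mem_nhds hx₀)
    have hτ' : ∀ᶠ z in 𝓝 (integralMap F x₀), ∀ a,
        ContMDiffAt (𝓡 (p + q)) 𝓘(ℝ, Fin p → ℝ) ∞ τ (Ψ (l a) (s z)) ∧
        Ψ (τ (Ψ (l a) (s z))) (s (integralMap F (Ψ (l a) (s z)))) = Ψ (l a) (s z) := by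
      rw [eventually_all]
      intro a
      have h1 : ContinuousAt (fun z => Ψ (l a) (s z)) (integralMap F x₀) :=
        ContinuousAt.comp (f := s) (g := Ψ (l a)) (by
          rw [hs0]
          exact (H.contMDiffAt_apply _ hx₀).continuousAt) hs.self_of_nhds.1.continuousAt
      rw [ContinuousAt, hs0, hl] at h1
      exact h1.eventually hτ
    filter_upwards [hs, hsO, hτ'] with z h1 h2 h3
    constructor
    · refine ContDiffAt.sum fun a _ => ?_
      have h4 : ContMDiffAt 𝓘(ℝ, E q) (𝓡 (p + q)) ∞ (fun z => Ψ (l a) (s z)) z :=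
        ContMDiffAt.comp z (H.contMDiffAt_apply _ h2) h1.1
      have h5 : ContMDiffAt 𝓘(ℝ, E q) 𝓘(ℝ, Fin p → ℝ) ∞ (μ a) z :=
        ContMDiffAt.comp z (h3 a).1 h4
      exact contDiffAt_const.smulRight (contDiffAt_const.sub h5.contDiffAt)
    · have h4 : ∀ a, l a - μ a z ∈ H.stabilizer (s z) := by
        intro a
        have h5 := (h3 a).2
        rw [H.integralMap_apply _ h2, h1.2] at h5
        rw [mem_stabilizer, sub_eq_neg_add, H.add, ← h5]
        exact H.neg_apply _ _
      intro t ht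
      obtain ⟨m, rfl⟩ := toTorus_eq_zero_iff.1 ht
      refine H.mem_stabilizer.1 ?_
      rw [_root_.sum_apply]
      refine AddSubgroup.sum_mem _ fun a _ => ?_
      simp only [ContinuousLinearMap.smulRight_apply, π, ContinuousLinearMap.proj_apply]
      rw [Int.cast_smul_eq_zsmul]
      exact AddSubgroup.zsmul_mem _ (h4 a) (m a)

/-- Near a compact orbit, the only periods are the integral combinations of the given ones. -/
theorem eventually_toTorus_eq_zero [T2Space M] (H : IsLeafAction X F O ε Ψ) {x₀ : M} (hx₀ : x₀ ∈ O)
    {s : E q → M} {z₀ : E q} (hs0 : s z₀ = x₀) (hs : ContinuousAt s z₀)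
    {P : E q → (Fin p → ℝ) →L[ℝ] (Fin p → ℝ)} (hP : ContinuousAt P z₀)
    (hPs : ∀ᶠ z in 𝓝 z₀, ∀ t, toTorus t = 0 → Ψ (P z t) (s z) = s z)
    (hinj : ∀ᶠ z in 𝓝 z₀, Function.Injective (P z))
    (hL : ∀ t, Ψ (P z₀ t) x₀ = x₀ → toTorus t = 0) :
    ∀ᶠ z in 𝓝 z₀, ∀ t, Ψ (P z t) (s z) = s z → toTorus t = 0 := by
  -- By rounding coordinates, every vector lies in this compact cube modulo `ℤ^p`, and the only
  -- integral vector in the cube is `0`. It therefore suffices to exclude nonzero periods with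
  -- coordinates in `Q`.
  let Q : Set (Fin p → ℝ) := Metric.closedBall 0 (1 / 2)
  have hsO : ∀ᶠ z in 𝓝 z₀, s z ∈ O := hs.eventually_mem (by
    rw [hs0]
    exact H.isOpen.mem_nhds hx₀)
  have h1 : ∀ᶠ z in 𝓝 z₀, ∀ t ∈ Q, Ψ (P z t) (s z) = s z → t = 0 := by
    refine (isCompact_closedBall (0 : Fin p → ℝ) (1 / 2)).eventually_forall_of_forall_eventually
      fun t ht => ?_
    have hPt : ContinuousAt (fun w : E q × (Fin p → ℝ) => P w.1 w.2) (z₀, t) :=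
      ContinuousAt.clm_apply (ContinuousAt.comp (f := Prod.fst) hP continuousAt_fst)
        continuousAt_snd
    have hst : ContinuousAt (fun w : E q × (Fin p → ℝ) => s w.1) (z₀, t) :=
      ContinuousAt.comp (f := Prod.fst) hs continuousAt_fst
    -- Near `t = 0` local freeness excludes further periods. Near any other `t` in the cube the
    -- point `x₀` is moved, and in a Hausdorff space this persists for nearby levels and times.
    by_cases ht0 : t = 0
    · subst ht0
      have h2 : ∀ᶠ w : E q × (Fin p → ℝ) in 𝓝 (z₀, 0), ‖P w.1 w.2‖ < ε :=
        hPt.norm.eventually_lt continuousAt_const (by simpa using H.pos)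
      have h3 : ∀ᶠ w : E q × (Fin p → ℝ) in 𝓝 (z₀, 0), s w.1 ∈ O ∧ Function.Injective (P w.1) :=
        (continuousAt_fst (p := (z₀, (0 : Fin p → ℝ)))).eventually (hsO.and hinj)
      filter_upwards [h2, h3] with w h2 h3 h4
      have h5 := H.eq_zero_of_apply_eq h3.1 h2 h4
      exact h3.2 (by rw [h5, map_zero])
    · have h2 : Ψ (P z₀ t) (s z₀) ≠ s z₀ := by
        rw [hs0]
        intro h3
        obtain ⟨m, rfl⟩ := toTorus_eq_zero_iff.1 (hL t h3)
        refine ht0 (funext fun i => ?_)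
        have h4 : ‖((m i : ℤ) : ℝ)‖ ≤ 1 / 2 :=
          (norm_le_pi_norm (fun i => ((m i : ℤ) : ℝ)) i).trans (by simpa using ht)
        rw [Real.norm_eq_abs, ← Int.cast_abs] at h4
        have h5 : |m i| < 1 := by
          have : ((|m i| : ℤ) : ℝ) < (1 : ℤ) := lt_of_le_of_lt h4 (by norm_num)
          exact_mod_cast this
        have h6 : m i = 0 := Int.abs_lt_one_iff.1 h5
        simp [h6]
      have h3 : ContinuousAt (fun w : E q × (Fin p → ℝ) => Ψ (P w.1 w.2) (s w.1)) (z₀, t) :=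
        ContinuousAt.comp (g := fun w : (Fin p → ℝ) × M => Ψ w.1 w.2)
          (f := fun w : E q × (Fin p → ℝ) => (P w.1 w.2, s w.1)) (x := (z₀, t))
          (H.contMDiffAt _ (by
            simp only
            rw [hs0]
            exact hx₀)).continuousAt (hPt.prodMk hst)
      have h4 : ∀ᶠ w in 𝓝 (z₀, t), Ψ (P w.1 w.2) (s w.1) ≠ s w.1 := (h3.ne_iff_eventually_ne hst).1 h2
      filter_upwards [h4] with w hw h5 using (hw h5).elim
  filter_upwards [h1, hPs, hsO] with z h1 h2 h3 t ht
  let m : Fin p → ℝ := fun i => (round (t i) : ℝ)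
  have hm : toTorus m = 0 := toTorus_eq_zero_iff.2 ⟨fun i => round (t i), rfl⟩
  have h4 : t - m = 0 := by
    refine h1 (t - m) ?_ ?_
    · rw [mem_closedBall_zero_iff, pi_norm_le_iff_of_nonneg (by norm_num)]
      intro i
      exact abs_sub_round (t i)
    · have h5 : P z t ∈ H.stabilizer (s z) := ht
      have h6 : P z m ∈ H.stabilizer (s z) := h2 m hm
      rw [map_sub]
      exact AddSubgroup.sub_mem _ h5 h6
  rw [sub_eq_zero.1 h4, hm]

end IsLeafAction

end TorusAction
end LiouvilleSystem

namespace LiouvilleSystem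

/-! ### Construction of the Liouville torus action -/

section TorusAction
open Filter Topology

variable {p q : ℕ} {M : Type*} [TopologicalSpace M] [ChartedSpace (E (p + q)) M]
  [IsManifold (𝓡 (p + q)) ∞ M]
  {X : Fin p → (x : M) → TangentSpace (𝓡 (p + q)) x} {F : Fin q → M → ℝ}

theorem fieldVec_sumField_single (i : Fin p) (x : M) :
    fieldVec (sumField X (Pi.single i 1)) x = fieldVec (X i) x := by
  rw [fieldVec_sumField, Finset.sum_eq_single i]
  · simp
  · intro j _ hj
    simp [hj]
  · simp

/-- A compact connected full level set of regular points has a neighbourhood with a Liouville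
torus action. -/
theorem exists_isLiouvilleTorusAction [T2Space M] (h : IsIntegrableSystem X F) {N : Set M}
    {x₀ : M} (hN : N = levelSet F x₀) (hcomp : IsCompact N) (hc : IsPreconnected N)
    (hreg : ∀ y ∈ N, IsRegularAt X F y) :
    ∃ U ρ, IsLiouvilleTorusAction X F N U ρ := by
  have hx₀N : x₀ ∈ N := by rw [hN]; exact fun j => rfl
  obtain ⟨O, ε, Ψ, H, hNO, hOreg⟩ := exists_isLeafAction_of_isCompact h hN hcomp hreg
  have hx₀ := hNO hx₀N
  have hF := contMDiff_integralMap h.smooth_integrals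
  obtain ⟨L, hL⟩ := H.exists_periods hN hNO hc hcomp
  obtain ⟨s, τ, hs0, hτ0, hs, hτ⟩ := H.exists_section hx₀
  obtain ⟨P, hP0, hP⟩ := H.exists_smooth_periods hx₀ hs0 hτ0 hs hτ L fun t ht => (hL t).2 ht
  have hsc := hs.self_of_nhds.1.continuousAt
  have hsO : ∀ᶠ z in 𝓝 (integralMap F x₀), s z ∈ O := hsc.eventually_mem (by
    rw [hs0]
    exact H.isOpen.mem_nhds hx₀)
  have hPc : ContinuousAt P (integralMap F x₀) := hP.self_of_nhds.1.continuousAt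
  have hPbij : ∀ᶠ z in 𝓝 (integralMap F x₀), ∃ A : (Fin p → ℝ) ≃L[ℝ] (Fin p → ℝ), A = P z := by
    refine hPc.eventually_mem (s := range ((↑) : ((Fin p → ℝ) ≃L[ℝ] (Fin p → ℝ)) → _)) ?_
    rw [hP0]
    exact L.nhds
  have hfree := H.eventually_toTorus_eq_zero hx₀ hs0 hsc hPc (hP.mono fun z hz => hz.2)
    (hPbij.mono fun z ⟨A, hA⟩ => by
      rw [← hA]
      exact A.injective)
    (fun t ht => (hL t).1 (by rwa [hP0] at ht))
  have hτs : ∀ᶠ z in 𝓝 (integralMap F x₀), ∀ᶠ y in 𝓝 (s z), Ψ (τ y) (s (integralMap F y)) = y := by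
    rw [← hs0] at hτ
    exact hsc.eventually (hτ.mono fun y hy => hy.2).eventually_nhds
  obtain ⟨W, hWev, hW, hx₀W⟩ := eventually_nhds_iff.1
    ((((hs.and hP).and hsO).and hPbij).and (hfree.and hτs))
  -- Only the orbits that meet the section are kept. This makes each level set in `U` a single
  -- orbit, even if nearby levels have other pieces.
  let U : Set M := {y | integralMap F y ∈ W ∧ ∃ u, Ψ u (s (integralMap F y)) = y}
  have hUO : U ⊆ O := by
    rintro y ⟨hyW, u, hu⟩
    rw [← hu]
    exact H.mapsTo u _ (hWev _ hyW).1.1.2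
  have hΨF : ∀ t, ∀ y ∈ U, integralMap F (Ψ t y) = integralMap F y := fun t y hy =>
    H.integralMap_apply t (hUO hy)
  have hΨU : ∀ t, ∀ y ∈ U, Ψ t y ∈ U := by
    rintro t y hy
    refine ⟨by rw [hΨF t y hy]; exact hy.1, ?_⟩
    obtain ⟨u, hu⟩ := hy.2
    refine ⟨t + u, ?_⟩
    rw [hΨF t y hy, H.add, hu]
  have hUopen : IsOpen U := by
    rw [isOpen_iff_mem_nhds]
    intro y hy
    obtain ⟨u, hu⟩ := hy.2
    -- For openness, a point near `y` is carried by `Ψ (-u)` to a point near the section, where `τ`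
    -- connects it to the section.
    have h1 : Tendsto (Ψ (-u)) (𝓝 y) (𝓝 (s (integralMap F y))) := by
      have h2 := (H.contMDiffAt_apply (-u) (hUO hy)).continuousAt
      have h3 : Ψ (-u) y = s (integralMap F y) := by
        conv_lhs => rw [← hu]
        exact H.neg_apply _ _
      rwa [ContinuousAt, h3] at h2
    filter_upwards [h1.eventually (hWev _ hy.1).2.2, H.isOpen.mem_nhds (hUO hy),
      hF.continuous.continuousAt.eventually_mem (hW.mem_nhds hy.1)] with y' h2 h3 h4
    refine ⟨h4, u + τ (Ψ (-u) y'), ?_⟩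
    rw [H.integralMap_apply _ h3] at h2
    rw [H.add, h2, ← H.add, add_neg_cancel, H.zero]
  have hper : ∀ y ∈ U, ∀ t, Ψ (P (integralMap F y) t) y = y ↔ toTorus t = 0 := by
    rintro y hy t
    obtain ⟨u, hu⟩ := hy.2
    constructor
    · intro h1
      refine (hWev _ hy.1).2.1 t ?_
      have h2 : Ψ (-u) y = s (integralMap F y) := by
        conv_lhs => rw [← hu]
        exact H.neg_apply _ _
      rw [← h2, H.comm, h1]
    · intro h1
      have h2 := (hWev _ hy.1).1.1.1.2.2 t h1
      have h3 : Ψ (P (integralMap F y) t) (Ψ u (s (integralMap F y))) =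
          Ψ u (s (integralMap F y)) := by rw [H.comm, h2]
      rwa [hu] at h3
  -- The lift is arbitrary and not continuous, but by `hper` any other lift gives the same map on
  -- `U`. Smoothness is checked with the smooth parameter `t` instead.
  let r : Torus p → Fin p → ℝ := fun g => (toTorus_surjective g).choose
  have hr : ∀ g, toTorus (r g) = g := fun g => (toTorus_surjective g).choose_spec
  let ρ : Torus p → M → M := fun g y => Ψ (P (integralMap F y) (r g)) y
  have hρ : ∀ t, ∀ y ∈ U, ρ (toTorus t) y = Ψ (P (integralMap F y) t) y := by
    intro t y hy
    have h1 : toTorus (r (toTorus t) - t) = 0 := by rw [toTorus_sub, hr, sub_self]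
    have h2 := (hper y hy _).2 h1
    have h3 : r (toTorus t) = t + (r (toTorus t) - t) := by abel
    simp only [ρ]
    rw [h3, map_add, H.add, h2]
  have hρΨ : ∀ g t, ∀ y ∈ U, ρ g (Ψ t y) = Ψ t (ρ g y) := by
    intro g t y hy
    simp only [ρ]
    rw [hΨF t y hy, H.comm]
  have hsmooth : ContMDiffOn (𝓘(ℝ, Fin p → ℝ).prod (𝓡 (p + q))) (𝓡 (p + q)) ∞
      (fun w : (Fin p → ℝ) × M => ρ (toTorus w.1) w.2) (univ ×ˢ U) := by
    rintro ⟨t, y⟩ ⟨-, hy⟩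
    have h1 : (fun w : (Fin p → ℝ) × M => ρ (toTorus w.1) w.2) =ᶠ[𝓝 (t, y)]
        fun w => Ψ (P (integralMap F w.2) w.1) w.2 := by
      filter_upwards [(continuous_snd.isOpen_preimage _ hUopen).mem_nhds hy] with w hw
        using hρ w.1 w.2 hw
    refine ContMDiffAt.contMDiffWithinAt (ContMDiffAt.congr_of_eventuallyEq ?_ h1)
    have h2 : ContMDiffAt (𝓘(ℝ, Fin p → ℝ).prod (𝓡 (p + q)))
        𝓘(ℝ, (Fin p → ℝ) →L[ℝ] (Fin p → ℝ)) ∞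
        (fun w : (Fin p → ℝ) × M => P (integralMap F w.2)) (t, y) := by
      have h3 : ContMDiffAt (𝓘(ℝ, Fin p → ℝ).prod (𝓡 (p + q))) 𝓘(ℝ, E q) ∞
          (fun w : (Fin p → ℝ) × M => integralMap F w.2) (t, y) :=
        ContMDiffAt.comp (t, y) (g := integralMap F) (f := Prod.snd) hF.contMDiffAt contMDiffAt_snd
      exact ContMDiffAt.comp (t, y) (hWev _ hy.1).1.1.1.2.1.contMDiffAt h3
    exact ContMDiffAt.comp (t, y) (g := fun w : (Fin p → ℝ) × M => Ψ w.1 w.2)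
      (f := fun w : (Fin p → ℝ) × M => (P (integralMap F w.2) w.1, w.2))
      (H.contMDiffAt _ (hUO hy)) ((h2.clm_apply contMDiffAt_fst).prodMk contMDiffAt_snd)
  have hρsmooth : ∀ g, ∀ y ∈ U, ContMDiffAt (𝓡 (p + q)) (𝓡 (p + q)) ∞ (ρ g) y := by
    intro g y hy
    have h1 := hsmooth.contMDiffAt ((isOpen_univ.prod hUopen).mem_nhds
      (⟨mem_univ (r g), hy⟩ : (r g, y) ∈ univ ×ˢ U))
    have h2 := ContMDiffAt.comp y (g := fun w : (Fin p → ℝ) × M => ρ (toTorus w.1) w.2)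
      (f := fun y => (r g, y)) h1 (contMDiffAt_const.prodMk contMDiffAt_id)
    rw [show ρ g = (fun w : (Fin p → ℝ) × M => ρ (toTorus w.1) w.2) ∘ fun y => (r g, y) by
      funext y
      simp only [Function.comp_apply, hr]]
    exact h2
  refine ⟨U, ρ, hUopen, ?_, fun g y hy => hΨU _ y hy, ?_, ?_, hsmooth, ?_, ?_, ?_, ?_,
    fun y hy => hOreg y (hUO hy)⟩
  · intro y hy
    have h1 : integralMap F y = integralMap F x₀ := integralMap_eq_iff.2 (by
      rw [hN] at hy
      exact hy)
    refine ⟨by rwa [h1], ?_⟩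
    rw [h1, hs0]
    exact H.exists_apply_eq hN hNO hc hx₀N hy
  · intro y hy
    rw [← toTorus_zero, hρ 0 y hy, map_zero, H.zero]
  · intro g g' y hy
    have h1 : ρ g' y ∈ U := hΨU _ y hy
    have h2 : integralMap F (ρ g' y) = integralMap F y := hΨF _ y hy
    conv_lhs => rw [← hr g, ← hr g', ← toTorus_add, hρ _ y hy, map_add, H.add]
    conv_rhs => rw [← hr g, hρ _ _ h1, h2]
  · intro y hy g hg
    rw [← hr g]
    exact (hper y hy _).1 hg
  · intro g y hy i
    have hρy : ρ g y ∈ U := hΨU _ y hy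
    -- The torus action commutes with the leaf action, since the periods are constant on orbits. Its
    -- derivative at time zero is the preservation of `X_i`.
    have h1 : (fun t => ρ g (Ψ t y)) = fun t => Ψ t (ρ g y) := funext fun t => hρΨ g t y hy
    have h2 := congrArg (fun f => dmap (Fin p → ℝ) (E (p + q)) f 0 (Pi.single i 1)) h1
    rw [H.dmap_orbit_zero (hUO hρy), fieldVec_sumField_single,
      dmap_comp (g := ρ g) (f := fun t => Ψ t y)
        (by rw [H.zero]; exact (hρsmooth g y hy).mdifferentiableAt (by simp))
        ((H.contMDiffAt_orbit 0 (hUO hy)).mdifferentiableAt (by simp)),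
      ContinuousLinearMap.comp_apply, H.dmap_orbit_zero (hUO hy), fieldVec_sumField_single,
      H.zero] at h2
    exact h2
  · intro g y hy
    exact integralMap_eq_iff.1 (hΨF _ y hy)
  · intro x hx
    refine Subset.antisymm ?_ ?_
    · rintro _ ⟨g, rfl⟩
      exact ⟨integralMap_eq_iff.1 (hΨF _ x hx), hΨU _ x hx⟩
    · rintro y ⟨hy, hyU⟩
      have h1 : integralMap F y = integralMap F x := integralMap_eq_iff.2 hy
      obtain ⟨u, hu⟩ := hx.2
      obtain ⟨u', hu'⟩ := hyU.2
      obtain ⟨A, hA⟩ := (hWev _ hx.1).1.2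
      -- The time `u' - u` carries `x` to `y` through their common point of the section, and
      -- `A.symm` expresses it in units of the periods.
      refine ⟨toTorus (A.symm (u' - u)), ?_⟩
      simp only
      rw [hρ _ x hx, ← hA, ContinuousLinearEquiv.coe_coe, A.apply_symm_apply]
      conv_lhs => rw [← hu]
      rw [← H.add, sub_add_cancel, ← h1, hu']

end TorusAction
end LiouvilleSystem

namespace LiouvilleSystem

/-! ### Infinitesimal freeness and sections of the integrals -/

section ToricChart
open Filter Topology

variable {p q : ℕ} {M : Type*} [TopologicalSpace M] [ChartedSpace (E (p + q)) M]
  [IsManifold (𝓡 (p + q)) ∞ M]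
  {X : Fin p → (x : M) → TangentSpace (𝓡 (p + q)) x} {F : Fin q → M → ℝ}
  {N U : Set M} {ρ : Torus p → M → M}

/-- A map into a manifold with vanishing derivative is locally constant along lines. -/
theorem eventually_eq_of_dmap_eq_zero {γ : ℝ → M}
    (hγ : ∀ s, MDifferentiableAt 𝓘(ℝ, ℝ) (𝓡 (p + q)) γ s)
    (h0 : ∀ s, dmap ℝ (E (p + q)) γ s = 0) : ∀ᶠ s in 𝓝 0, γ s = γ 0 := by
  obtain ⟨φ, hφ⟩ := exists_partialDiffeomorph_chartAt (E := E (p + q)) (γ 0)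
  have hxφ : γ 0 ∈ φ.source := by
    rw [hφ]; exact mem_chart_source _ _
  obtain ⟨r, hr, hball⟩ := Metric.mem_nhds_iff.1
    ((hγ 0).continuousAt.preimage_mem_nhds (φ.open_source.mem_nhds hxφ))
  have hdiff : ∀ s ∈ Metric.ball (0 : ℝ) r, HasFDerivAt (fun s => φ (γ s)) (0 : ℝ →L[ℝ] _) s := by
    intro s hs
    have h1 : MDifferentiableAt 𝓘(ℝ, ℝ) 𝓘(ℝ, E (p + q)) (fun s => φ (γ s)) s :=
      MDifferentiableAt.comp s (φ.mdiffAt (hball hs)) (hγ s)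
    have h2 := dmap_comp (φ.mdiffAt (hball hs)) (hγ s)
    rw [h0, ContinuousLinearMap.comp_zero, dmap_eq_fderiv] at h2
    rw [← h2]
    exact h1.differentiableAt.hasFDerivAt
  filter_upwards [Metric.ball_mem_nhds (0 : ℝ) hr] with s hs
  have h1 := Metric.isOpen_ball.is_const_of_fderiv_eq_zero (𝕜 := ℝ)
    (convex_ball (0 : ℝ) r).isPreconnected
    (fun s hs => (hdiff s hs).differentiableAt.differentiableWithinAt)
    (fun s hs => (hdiff s hs).fderiv) hs (Metric.mem_ball_self hr)
  exact φ.toPartialEquiv.injOn (hball hs) hxφ h1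

/-- For small `s > 0` the integral vector `s • v` has norm less than `1`, so it vanishes. -/
theorem eq_zero_of_eventually_toTorus_eq_zero {v : Fin p → ℝ}
    (h : ∀ᶠ s : ℝ in 𝓝 0, toTorus (s • v) = 0) : v = 0 := by
  have h1 : ∀ᶠ s : ℝ in 𝓝 0, ‖s • v‖ < 1 := by
    have h2 : ContinuousAt (fun s : ℝ => ‖s • v‖) 0 := by fun_prop
    exact h2.eventually_lt continuousAt_const (by simp)
  obtain ⟨s, ⟨h2, h3⟩, hs⟩ := (((h.and h1).filter_mono nhdsWithin_le_nhds).and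
    (self_mem_nhdsWithin : ∀ᶠ s in 𝓝[>] (0 : ℝ), s ∈ Ioi (0 : ℝ))).exists
  obtain ⟨m, hm⟩ := toTorus_eq_zero_iff.1 h2
  have h4 : s • v = 0 := by
    rw [hm]
    funext i
    have h5 : ‖((m i : ℤ) : ℝ)‖ < 1 := by
      refine lt_of_le_of_lt ?_ h3
      rw [hm]
      exact norm_le_pi_norm (fun i => ((m i : ℤ) : ℝ)) i
    rw [Real.norm_eq_abs, ← Int.cast_abs] at h5
    have h6 : |m i| < 1 := by exact_mod_cast h5
    simp [Int.abs_lt_one_iff.1 h6]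
  exact (smul_eq_zero.1 h4).resolve_left (ne_of_gt hs)

namespace IsLiouvilleTorusAction

theorem contMDiffAt (H : IsLiouvilleTorusAction X F N U ρ) (t : Fin p → ℝ) {x : M} (hx : x ∈ U) :
    ContMDiffAt (𝓘(ℝ, Fin p → ℝ).prod (𝓡 (p + q))) (𝓡 (p + q)) ∞
      (fun w : (Fin p → ℝ) × M => ρ (toTorus w.1) w.2) (t, x) :=
  H.smooth.contMDiffAt ((isOpen_univ.prod H.isOpen).mem_nhds ⟨mem_univ t, hx⟩)

theorem contMDiffAt_apply (H : IsLiouvilleTorusAction X F N U ρ) (g : Torus p) {x : M}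
    (hx : x ∈ U) : ContMDiffAt (𝓡 (p + q)) (𝓡 (p + q)) ∞ (ρ g) x := by
  obtain ⟨t, rfl⟩ := toTorus_surjective g
  exact ContMDiffAt.comp x (g := fun w : (Fin p → ℝ) × M => ρ (toTorus w.1) w.2)
    (f := fun y => (t, y)) (H.contMDiffAt t hx) (contMDiffAt_const.prodMk contMDiffAt_id)

theorem mdiffAt_apply (H : IsLiouvilleTorusAction X F N U ρ) (g : Torus p) {x : M}
    (hx : x ∈ U) : MDifferentiableAt (𝓡 (p + q)) (𝓡 (p + q)) (ρ g) x :=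
  (H.contMDiffAt_apply g hx).mdifferentiableAt (by simp)

theorem mdiffAt_orbit (H : IsLiouvilleTorusAction X F N U ρ) (t : Fin p → ℝ) {x : M}
    (hx : x ∈ U) :
    MDifferentiableAt 𝓘(ℝ, Fin p → ℝ) (𝓡 (p + q)) (fun t => ρ (toTorus t) x) t :=
  (ContMDiffAt.comp t (g := fun w : (Fin p → ℝ) × M => ρ (toTorus w.1) w.2)
    (f := fun t => (t, x)) (H.contMDiffAt t hx)
    (contMDiffAt_id.prodMk contMDiffAt_const)).mdifferentiableAt (by simp)

theorem integralMap_apply (H : IsLiouvilleTorusAction X F N U ρ) (g : Torus p) {x : M}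
    (hx : x ∈ U) : integralMap F (ρ g x) = integralMap F x :=
  integralMap_eq_iff.2 (H.preserves_integrals g x hx)

theorem hasFDerivAt_sub_right (a t : Fin p → ℝ) :
    HasFDerivAt (fun s : Fin p → ℝ => s - a) (ContinuousLinearMap.id ℝ _) t :=
  (hasFDerivAt_id (𝕜 := ℝ) t).sub_const a

/-- Equivariance of the orbit map carries its derivative from one point of the orbit to any other.
-/
theorem dmap_orbit_add (H : IsLiouvilleTorusAction X F N U ρ) (t a : Fin p → ℝ) {x : M}
    (hx : x ∈ U) :
    dmap (Fin p → ℝ) (E (p + q)) (fun t => ρ (toTorus t) x) (a + t) =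
      (dmap (E (p + q)) (E (p + q)) (ρ (toTorus a)) (ρ (toTorus t) x)).comp
        (dmap (Fin p → ℝ) (E (p + q)) (fun t => ρ (toTorus t) x) t) := by
  have h1 : (fun t => ρ (toTorus t) x) =
      fun s => (fun t => ρ (toTorus a) (ρ (toTorus t) x)) (s - a) := by
    funext s
    simp only
    rw [← H.add _ _ x hx, ← toTorus_add, add_sub_cancel]
  have h2 : MDifferentiableAt 𝓘(ℝ, Fin p → ℝ) (𝓡 (p + q))
      (fun t => ρ (toTorus a) (ρ (toTorus t) x)) (a + t - a) := by
    rw [add_sub_cancel_left]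
    exact MDifferentiableAt.comp t (g := ρ (toTorus a)) (f := fun t => ρ (toTorus t) x)
      (H.mdiffAt_apply _ (H.mapsTo _ hx)) (H.mdiffAt_orbit t hx)
  conv_lhs => rw [h1]
  rw [dmap_comp (g := fun t => ρ (toTorus a) (ρ (toTorus t) x)) (f := fun s => s - a) h2
    (hasFDerivAt_sub_right a _).differentiableAt.mdifferentiableAt, dmap_eq_fderiv,
    (hasFDerivAt_sub_right a _).fderiv, ContinuousLinearMap.comp_id, add_sub_cancel_left,
    dmap_comp (g := ρ (toTorus a)) (f := fun t => ρ (toTorus t) x)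
      (H.mdiffAt_apply _ (H.mapsTo _ hx)) (H.mdiffAt_orbit t hx)]

/-- A free torus action is infinitesimally free. -/
theorem eq_zero_of_dmap_orbit_eq_zero (H : IsLiouvilleTorusAction X F N U ρ) {t v : Fin p → ℝ}
    {x : M} (hx : x ∈ U)
    (hv : dmap (Fin p → ℝ) (E (p + q)) (fun t => ρ (toTorus t) x) t v = 0) : v = 0 := by
  -- A direction killed at one point of the orbit is killed along all of it, so the curve `s ↦ ρ (s
  -- v) x` is locally constant. Freeness then forces `s • v` to be integral for all small `s`.
  have hall : ∀ s, dmap (Fin p → ℝ) (E (p + q)) (fun t => ρ (toTorus t) x) s v = 0 := by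
    intro s
    have h1 := H.dmap_orbit_add t (s - t) hx
    rw [sub_add_cancel] at h1
    rw [h1, ContinuousLinearMap.comp_apply, hv, map_zero]
  have hd : ∀ s : ℝ, HasFDerivAt (fun s : ℝ => s • v) ((1 : ℝ →L[ℝ] ℝ).smulRight v) s :=
    fun s => (hasFDerivAt_id (𝕜 := ℝ) s).smul_const v
  have h1 := eventually_eq_of_dmap_eq_zero (γ := fun s : ℝ => ρ (toTorus (s • v)) x)
    (fun s => MDifferentiableAt.comp s (g := fun t => ρ (toTorus t) x) (H.mdiffAt_orbit _ hx)
      (hd s).differentiableAt.mdifferentiableAt) (fun s => by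
      rw [dmap_comp (g := fun t => ρ (toTorus t) x) (f := fun s : ℝ => s • v)
        (H.mdiffAt_orbit _ hx) (hd s).differentiableAt.mdifferentiableAt, dmap_eq_fderiv,
        (hd s).fderiv]
      ext
      simp [hall])
  refine eq_zero_of_eventually_toTorus_eq_zero (h1.mono fun s hs => ?_)
  simp only [zero_smul] at hs
  rw [toTorus_zero, H.zero x hx] at hs
  exact H.free x hx _ hs

end IsLiouvilleTorusAction

/-- A section `s` of the integrals over a small ball around `c`, parametrized by the unit ball. -/
structure IsToricSection (p : ℕ) {q : ℕ} {M : Type*} [TopologicalSpace M]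
    [ChartedSpace (E (p + q)) M] (F : Fin q → M → ℝ) (U : Set M) (c : E q) (r : ℝ)
    (s : E q → M) : Prop where
  pos : 0 < r
  smooth : ∀ z ∈ Metric.ball (0 : E q) 1, ContMDiffAt 𝓘(ℝ, E q) (𝓡 (p + q)) ∞ s z
  mem : ∀ z ∈ Metric.ball (0 : E q) 1, s z ∈ U
  integralMap_apply : ∀ z ∈ Metric.ball (0 : E q) 1, integralMap F (s z) = c + r • z

/-- The domain `ℝ^p × B^q`. -/
def toricDomain (p q : ℕ) : Set (Model p q) := univ ×ˢ Metric.ball (0 : E q) 1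

theorem isOpen_toricDomain : IsOpen (toricDomain p q) := isOpen_univ.prod Metric.isOpen_ball

/-- The map `(θ, z) ↦ ρ_θ (s z)`. -/
def toricMap (ρ : Torus p → M → M) (s : E q → M) (w : Model p q) : M := ρ (toTorus w.1) (s w.2)

/-- Sections with image of the toric map in a given neighbourhood exist. -/
theorem IsLiouvilleTorusAction.exists_isToricSection (h : IsIntegrableSystem X F)
    (H : IsLiouvilleTorusAction X F N U ρ) {x₀ : M} (hx₀ : x₀ ∈ N) {W : Set M} (hW : IsOpen W)
    (hNW : levelSet F x₀ ⊆ W) :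
    ∃ r s, IsToricSection p F U (integralMap F x₀) r s ∧
      ∀ w ∈ toricDomain p q, toricMap ρ s w ∈ W := by
  have hx₀U := H.subset hx₀
  obtain ⟨e, he, hxe, hex⟩ := exists_isBox h (H.regular x₀ hx₀U)
  have hx : e x₀ = (0, integralMap F x₀) := by rw [← he.snd x₀ hxe, ← hex]
  let s₀ : E q → M := fun z => e.symm (0, z)
  have hs0 : s₀ (integralMap F x₀) = x₀ := by
    simp only [s₀]
    rw [← hx]
    exact e.symm_apply_apply hxe
  have hpair : Continuous (fun z : E q => ((0, z) : Model p q)) := by fun_prop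
  have htar : ∀ᶠ z in 𝓝 (integralMap F x₀), ((0, z) : Model p q) ∈ e.target :=
    hpair.continuousAt.eventually_mem (e.open_target.mem_nhds (by
      rw [← hx]
      exact e.apply_mem_target hxe))
  have hs : ∀ᶠ z in 𝓝 (integralMap F x₀), ContMDiffAt 𝓘(ℝ, E q) (𝓡 (p + q)) ∞ s₀ z ∧
      integralMap F (s₀ z) = z := by
    filter_upwards [htar] with z hz
    refine ⟨ContMDiffAt.comp z (e.contMDiffAt_symm hz)
      ((contDiff_const.prodMk contDiff_id).contMDiff.contMDiffAt), ?_⟩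
    rw [← he.snd _ (e.symm_apply_mem_source hz), e.apply_symm_apply hz]
  have hsc := hs.self_of_nhds.1.continuousAt
  have hsU : ∀ᶠ z in 𝓝 (integralMap F x₀), s₀ z ∈ U := hsc.eventually_mem (by
    rw [hs0]
    exact H.isOpen.mem_nhds hx₀U)
  -- The cube covers the torus and is compact. The orbit over the central level lies in `W`, hence
  -- so do the orbits over nearby levels.
  have hsW : ∀ᶠ z in 𝓝 (integralMap F x₀), ∀ t ∈ Metric.closedBall (0 : Fin p → ℝ) (1 / 2),
      ρ (toTorus t) (s₀ z) ∈ W := by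
    refine (isCompact_closedBall (0 : Fin p → ℝ) (1 / 2)).eventually_forall_of_forall_eventually
      fun t ht => ?_
    have h0 : ContinuousAt (fun w : E q × (Fin p → ℝ) => s₀ w.1) (integralMap F x₀, t) :=
      ContinuousAt.comp (f := Prod.fst) (g := s₀) hsc continuousAt_fst
    have h1 : ContinuousAt (fun w : E q × (Fin p → ℝ) => ρ (toTorus w.2) (s₀ w.1))
        (integralMap F x₀, t) :=
      ContinuousAt.comp (g := fun w : (Fin p → ℝ) × M => ρ (toTorus w.1) w.2)
        (f := fun w : E q × (Fin p → ℝ) => (w.2, s₀ w.1)) (x := (integralMap F x₀, t))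
        (H.contMDiffAt _ (by
          simp only
          rw [hs0]
          exact hx₀U)).continuousAt
        (continuousAt_snd.prodMk h0)
    refine h1.eventually_mem (hW.mem_nhds (hNW ?_))
    simp only
    rw [hs0]
    exact H.preserves_integrals _ _ hx₀U
  obtain ⟨r, hr, hball⟩ := Metric.eventually_nhds_iff_ball.1 ((hs.and hsU).and hsW)
  have hmem : ∀ z ∈ Metric.ball (0 : E q) 1,
      integralMap F x₀ + r • z ∈ Metric.ball (integralMap F x₀) r := by
    intro z hz
    rw [mem_ball_zero_iff] at hz
    rw [mem_ball_iff_norm, add_sub_cancel_left, norm_smul, Real.norm_of_nonneg hr.le]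
    exact mul_lt_of_lt_one_right hr hz
  refine ⟨r, fun z => s₀ (integralMap F x₀ + r • z), ⟨hr, ?_, ?_, ?_⟩, ?_⟩
  · intro z hz
    have h1 : ContDiff ℝ ∞ (fun z : E q => integralMap F x₀ + r • z) :=
      contDiff_const.add (contDiff_id.const_smul r)
    exact ContMDiffAt.comp z (g := s₀) (hball _ (hmem z hz)).1.1.1 h1.contMDiff.contMDiffAt
  · exact fun z hz => (hball _ (hmem z hz)).1.2
  · exact fun z hz => (hball _ (hmem z hz)).1.1.2
  · rintro ⟨t, z⟩ ⟨-, hz⟩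
    let m : Fin p → ℝ := fun i => (round (t i) : ℝ)
    have hm : toTorus m = 0 := toTorus_eq_zero_iff.2 ⟨fun i => round (t i), rfl⟩
    have h1 : toTorus (t - m) = toTorus t := by rw [toTorus_sub, hm, sub_zero]
    have h2 := (hball _ (hmem z hz)).2 (t - m) (by
      rw [mem_closedBall_zero_iff, pi_norm_le_iff_of_nonneg (by norm_num)]
      intro i
      exact abs_sub_round (t i))
    rwa [h1] at h2

end ToricChart
end LiouvilleSystem

namespace LiouvilleSystem

/-! ### Angle coordinates and frequencies -/

section ToricMap
open Filter Topology

variable {p q : ℕ} {M : Type*} [TopologicalSpace M] [ChartedSpace (E (p + q)) M]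
  [IsManifold (𝓡 (p + q)) ∞ M]
  {X : Fin p → (x : M) → TangentSpace (𝓡 (p + q)) x} {F : Fin q → M → ℝ}
  {N U : Set M} {ρ : Torus p → M → M} {c : E q} {r : ℝ} {s : E q → M}

namespace IsToricSection

theorem toricMap_mem (S : IsToricSection p F U c r s) (H : IsLiouvilleTorusAction X F N U ρ)
    {w : Model p q} (hw : w ∈ toricDomain p q) : toricMap ρ s w ∈ U :=
  H.mapsTo _ (S.mem _ hw.2)

theorem integralMap_toricMap (S : IsToricSection p F U c r s)
    (H : IsLiouvilleTorusAction X F N U ρ) {w : Model p q} (hw : w ∈ toricDomain p q) :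
    integralMap F (toricMap ρ s w) = c + r • w.2 := by
  rw [← S.integralMap_apply _ hw.2]
  exact H.integralMap_apply _ (S.mem _ hw.2)

theorem contMDiffAt (S : IsToricSection p F U c r s) (H : IsLiouvilleTorusAction X F N U ρ)
    {w : Model p q} (hw : w ∈ toricDomain p q) :
    ContMDiffAt 𝓘(ℝ, Model p q) (𝓡 (p + q)) ∞ (toricMap ρ s) w := by
  have h1 : ContMDiffAt 𝓘(ℝ, Model p q) (𝓡 (p + q)) ∞ (fun w : Model p q => s w.2) w :=
    ContMDiffAt.comp w (g := s) (S.smooth _ hw.2) contDiff_snd.contMDiff.contMDiffAt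
  have h2 : ContMDiffAt 𝓘(ℝ, Model p q) 𝓘(ℝ, Fin p → ℝ) ∞ (fun w : Model p q => w.1) w :=
    contDiff_fst.contMDiff.contMDiffAt
  exact ContMDiffAt.comp w (g := fun w : (Fin p → ℝ) × M => ρ (toTorus w.1) w.2)
    (f := fun w : Model p q => (w.1, s w.2)) (H.contMDiffAt _ (S.mem _ hw.2)) (h2.prodMk h1)

theorem mdiffAt (S : IsToricSection p F U c r s) (H : IsLiouvilleTorusAction X F N U ρ)
    {w : Model p q} (hw : w ∈ toricDomain p q) :
    MDifferentiableAt 𝓘(ℝ, Model p q) (𝓡 (p + q)) (toricMap ρ s) w :=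
  (S.contMDiffAt H hw).mdifferentiableAt (by simp)

/-- The integrals determine `z`, and freeness of the action determines the angle on the orbit. -/
theorem toricMap_eq_iff (S : IsToricSection p F U c r s) (H : IsLiouvilleTorusAction X F N U ρ)
    {w w' : Model p q} (hw : w ∈ toricDomain p q) (hw' : w' ∈ toricDomain p q) :
    toricMap ρ s w = toricMap ρ s w' ↔ toTorus w.1 = toTorus w'.1 ∧ w.2 = w'.2 := by
  constructor
  · intro h
    have h1 := congrArg (integralMap F) h
    rw [S.integralMap_toricMap H hw, S.integralMap_toricMap H hw', add_right_inj] at h1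
    have h2 : w.2 = w'.2 := smul_right_injective _ S.pos.ne' h1
    refine ⟨?_, h2⟩
    have h3 : ρ (toTorus w.1) (s w.2) = ρ (toTorus w'.1) (s w.2) := by
      rw [toricMap, toricMap, ← h2] at h
      exact h
    have h4 := congrArg (ρ (-toTorus w'.1)) h3
    rw [← H.add _ _ _ (S.mem _ hw.2), ← H.add _ _ _ (S.mem _ hw.2), neg_add_cancel,
      H.zero _ (S.mem _ hw.2)] at h4
    have h5 := H.free _ (S.mem _ hw.2) _ h4
    exact (neg_add_eq_zero.1 h5).symm
  · rintro ⟨h1, h2⟩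
    rw [toricMap, toricMap, h1, h2]

theorem toricMap_add (S : IsToricSection p F U c r s) (H : IsLiouvilleTorusAction X F N U ρ)
    {w : Model p q} (hw : w ∈ toricDomain p q) (t : Fin p → ℝ) :
    toricMap ρ s (t + w.1, w.2) = ρ (toTorus t) (toricMap ρ s w) := by
  rw [toricMap, toricMap, toTorus_add, H.add _ _ _ (S.mem _ hw.2)]

theorem dmap_toricMap_fst (S : IsToricSection p F U c r s) (H : IsLiouvilleTorusAction X F N U ρ)
    {w : Model p q} (hw : w ∈ toricDomain p q) (v : Fin p → ℝ) :
    dmap (Model p q) (E (p + q)) (toricMap ρ s) w (v, 0) =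
      dmap (Fin p → ℝ) (E (p + q)) (fun t => ρ (toTorus t) (s w.2)) w.1 v := by
  have h1 : HasFDerivAt (fun t : Fin p → ℝ => ((t, w.2) : Model p q))
      (ContinuousLinearMap.inl ℝ (Fin p → ℝ) (E q)) w.1 :=
    (hasFDerivAt_id (𝕜 := ℝ) w.1).prodMk (hasFDerivAt_const _ _)
  have h2 := dmap_comp (g := toricMap ρ s) (f := fun t : Fin p → ℝ => ((t, w.2) : Model p q))
    (x := w.1) (S.mdiffAt H hw) h1.differentiableAt.mdifferentiableAt
  rw [dmap_eq_fderiv (fun t : Fin p → ℝ => ((t, w.2) : Model p q)), h1.fderiv] at h2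
  exact (DFunLike.congr_fun h2 v).symm

theorem dmap_integralMap_toricMap (S : IsToricSection p F U c r s) (h : IsIntegrableSystem X F)
    (H : IsLiouvilleTorusAction X F N U ρ) {w : Model p q} (hw : w ∈ toricDomain p q)
    (v : Model p q) :
    dmap (E (p + q)) (E q) (integralMap F) (toricMap ρ s w)
      (dmap (Model p q) (E (p + q)) (toricMap ρ s) w v) = r • v.2 := by
  have h1 := dmap_apply_of_comp_eq (f := integralMap F) (g := fun w : Model p q => c + r • w.2)
    (S.mdiffAt H hw) ((contMDiff_integralMap h.smooth_integrals).mdifferentiable (by simp) _)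
    (by
      filter_upwards [isOpen_toricDomain.mem_nhds hw] with w hw using S.integralMap_toricMap H hw) v
  rw [h1, dmap_eq_fderiv]
  have h2 : HasFDerivAt (fun w : Model p q => c + r • w.2)
      (r • ContinuousLinearMap.snd ℝ (Fin p → ℝ) (E q)) w :=
    (hasFDerivAt_snd.const_smul r).const_add c
  rw [h2.fderiv]
  rfl

/-- The differential of the integrals detects the `z`-component of a vector in the kernel, and
infinitesimal freeness the angular one. Equality of dimensions gives surjectivity. -/
theorem bijective_dmap (S : IsToricSection p F U c r s) (h : IsIntegrableSystem X F)
    (H : IsLiouvilleTorusAction X F N U ρ) {w : Model p q} (hw : w ∈ toricDomain p q) :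
    Function.Bijective (dmap (Model p q) (E (p + q)) (toricMap ρ s) w) := by
  have hinj : Function.Injective (dmap (Model p q) (E (p + q)) (toricMap ρ s) w) := by
    rw [injective_iff_map_eq_zero]
    rintro ⟨v, ζ⟩ hv
    have h1 := S.dmap_integralMap_toricMap h H hw (v, ζ)
    rw [hv, map_zero] at h1
    have h2 : ζ = 0 := (smul_eq_zero.1 h1.symm).resolve_left S.pos.ne'
    subst h2
    rw [S.dmap_toricMap_fst H hw] at hv
    rw [H.eq_zero_of_dmap_orbit_eq_zero (S.mem _ hw.2) hv]
    rfl
  refine ⟨hinj, ?_⟩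
  have hdim : Module.finrank ℝ (Model p q) = Module.finrank ℝ (E (p + q)) := by
    simp [Model]
  exact (LinearMap.injective_iff_surjective_of_finrank_eq_finrank
    (f := (dmap (Model p q) (E (p + q)) (toricMap ρ s) w : Model p q →ₗ[ℝ] E (p + q))) hdim).1 hinj

/-- The toric map has smooth local inverses. -/
theorem exists_partialDiffeomorph (S : IsToricSection p F U c r s) (h : IsIntegrableSystem X F)
    (H : IsLiouvilleTorusAction X F N U ρ) {w : Model p q} (hw : w ∈ toricDomain p q) :
    ∃ Φ : PartialDiffeomorph 𝓘(ℝ, Model p q) (𝓡 (p + q)) (Model p q) M ∞,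
      w ∈ Φ.source ∧ Φ.source ⊆ toricDomain p q ∧ ∀ y ∈ Φ.source, Φ y = toricMap ρ s y :=
  exists_partialDiffeomorph_of_bijective_mfderiv (f := toricMap ρ s) isOpen_toricDomain
    (fun _ hw => (S.contMDiffAt H hw).contMDiffWithinAt) hw (S.bijective_dmap h H hw)

theorem isInvertible_dmap (S : IsToricSection p F U c r s) (h : IsIntegrableSystem X F)
    (H : IsLiouvilleTorusAction X F N U ρ) {w : Model p q} (hw : w ∈ toricDomain p q) :
    (dmap (Model p q) (E (p + q)) (toricMap ρ s) w).IsInvertible :=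
  ⟨ContinuousLinearEquiv.ofBijective _ (LinearMap.ker_eq_bot.2 (S.bijective_dmap h H hw).1)
    (LinearMap.range_eq_top.2 (S.bijective_dmap h H hw).2),
    ContinuousLinearMap.ext fun _ => rfl⟩

theorem dmap_toricMap_add (S : IsToricSection p F U c r s) (H : IsLiouvilleTorusAction X F N U ρ)
    {w : Model p q} (hw : w ∈ toricDomain p q) (t : Fin p → ℝ) :
    dmap (Model p q) (E (p + q)) (toricMap ρ s) (t + w.1, w.2) =
      (dmap (E (p + q)) (E (p + q)) (ρ (toTorus t)) (toricMap ρ s w)).comp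
        (dmap (Model p q) (E (p + q)) (toricMap ρ s) w) := by
  have hd : HasFDerivAt (fun w' : Model p q => ((t, 0) : Model p q) + w')
      (ContinuousLinearMap.id ℝ (Model p q)) w := (hasFDerivAt_id (𝕜 := ℝ) w).const_add _
  have hw' : ((t, 0) : Model p q) + w ∈ toricDomain p q := ⟨mem_univ _, by simpa using hw.2⟩
  have h1 := dmap_comp (g := toricMap ρ s) (f := fun w' : Model p q => ((t, 0) : Model p q) + w')
    (x := w) (S.mdiffAt H hw') hd.differentiableAt.mdifferentiableAt
  rw [dmap_eq_fderiv (fun w' : Model p q => ((t, 0) : Model p q) + w'), hd.fderiv,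
    ContinuousLinearMap.comp_id] at h1
  have h2 : (((t, 0) : Model p q) + w) = (t + w.1, w.2) := by ext <;> simp
  rw [h2] at h1
  rw [← h1, ← dmap_comp (g := ρ (toTorus t)) (f := toricMap ρ s)
    (H.mdiffAt_apply _ (S.toricMap_mem H hw)) (S.mdiffAt H hw)]
  refine dmap_congr ?_
  filter_upwards [isOpen_toricDomain.mem_nhds hw] with y hy
  rw [← S.toricMap_add H hy]
  congr 1
  ext <;> simp

/-- The coefficients of the fields `X_i` in the coordinates given by the toric map. -/
noncomputable def frequency (X : Fin p → (x : M) → TangentSpace (𝓡 (p + q)) x)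
    (ρ : Torus p → M → M) (s : E q → M) (i : Fin p) (z : E q) : Fin p → ℝ :=
  ((dmap (Model p q) (E (p + q)) (toricMap ρ s) (0, z)).inverse
    (fieldVec (X i) (toricMap ρ s (0, z)))).1

/-- The `z`-component of `X_i` is zero because the `F_j` are first integrals. Its angular
components, defined at angle zero, are the same at all angles because `ρ` preserves `X_i`. -/
theorem dmap_frequency (S : IsToricSection p F U c r s) (h : IsIntegrableSystem X F)
    (H : IsLiouvilleTorusAction X F N U ρ) {w : Model p q} (hw : w ∈ toricDomain p q)
    (i : Fin p) :
    dmap (Model p q) (E (p + q)) (toricMap ρ s) w (frequency X ρ s i w.2, 0) =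
      fieldVec (X i) (toricMap ρ s w) := by
  have hw0 : ((0, w.2) : Model p q) ∈ toricDomain p q := ⟨mem_univ _, hw.2⟩
  obtain ⟨v, hv⟩ := (S.bijective_dmap h H hw0).2 (fieldVec (X i) (toricMap ρ s (0, w.2)))
  have h1 := S.dmap_integralMap_toricMap h H hw0 v
  rw [hv, h.dmap_integralMap_field] at h1
  have h2 : v.2 = 0 := (smul_eq_zero.1 h1.symm).resolve_left S.pos.ne'
  have h3 : frequency X ρ s i w.2 = v.1 := by
    rw [frequency, ← hv]
    congr 1
    obtain ⟨A, hA⟩ := S.isInvertible_dmap h H hw0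
    rw [← hA, ContinuousLinearMap.inverse_equiv]
    exact A.symm_apply_apply v
  have h4 : ((frequency X ρ s i w.2, 0) : Model p q) = v := by
    rw [h3, ← h2]
  have h5 := S.dmap_toricMap_add H hw0 w.1
  have h6 := S.toricMap_add H hw0 w.1
  simp only [add_zero] at h5 h6
  have h7 : dmap (Model p q) (E (p + q)) (toricMap ρ s) w = _ := h5
  rw [h7, ContinuousLinearMap.comp_apply, h4, hv]
  have h8 : toricMap ρ s w = ρ (toTorus w.1) (toricMap ρ s (0, w.2)) := h6
  rw [h8]
  exact H.preserves_fields _ _ (S.toricMap_mem H hw0) i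

theorem contDiffAt_frequency (S : IsToricSection p F U c r s) (h : IsIntegrableSystem X F)
    (H : IsLiouvilleTorusAction X F N U ρ) {z : E q} (hz : z ∈ Metric.ball (0 : E q) 1)
    (i : Fin p) : ContDiffAt ℝ ∞ (frequency X ρ s i) z := by
  have hw0 : ((0, z) : Model p q) ∈ toricDomain p q := ⟨mem_univ _, hz⟩
  obtain ⟨Φ, hw, hΦs, hΦ⟩ := S.exists_partialDiffeomorph h H hw0
  have h1 := contMDiffOn_dmap_apply Φ.open_target Φ.symm.contMDiffOn (Y := X i)
    (h.smooth_fields i).contMDiffOn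
  have h2 : ContMDiffAt 𝓘(ℝ, Model p q) 𝓘(ℝ, Model p q) ∞
      (fun w => dmap (E (p + q)) (Model p q) Φ.symm (Φ w) (X i (Φ w))) (0, z) :=
    ContMDiffAt.comp (0, z) (g := fun y => dmap (E (p + q)) (Model p q) Φ.symm y (X i y))
      (h1.contMDiffAt (Φ.open_target.mem_nhds (Φ.apply_mem_target hw))) (Φ.contMDiffAt hw)
  have h3 : ContDiffAt ℝ ∞ (fun z : E q => ((0, z) : Model p q)) z :=
    contDiffAt_const.prodMk contDiffAt_id
  have h4 : ContDiffAt ℝ ∞ (fun z : E q =>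
      (dmap (E (p + q)) (Model p q) Φ.symm (Φ (0, z)) (X i (Φ (0, z)))).1) z :=
    contDiffAt_fst.comp z (ContDiffAt.comp z (g := fun w : Model p q =>
      dmap (E (p + q)) (Model p q) Φ.symm (Φ w) (X i (Φ w))) h2.contDiffAt h3)
  refine h4.congr_of_eventuallyEq ?_
  filter_upwards [h3.continuousAt.eventually_mem (Φ.open_source.mem_nhds hw)] with z hz
  have h5 : dmap (Model p q) (E (p + q)) (toricMap ρ s) (0, z) =
      dmap (Model p q) (E (p + q)) Φ (0, z) :=
    dmap_congr (by filter_upwards [Φ.open_source.mem_nhds hz] with w hw using (hΦ w hw).symm)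
  rw [frequency, h5, Φ.inverse_dmap hz, ← hΦ _ hz]
  rfl

/-- A relation between the frequencies would be carried by the differential of the toric map to one
between the `X_i` at a regular point. -/
theorem linearIndependent_frequency (S : IsToricSection p F U c r s) (h : IsIntegrableSystem X F)
    (H : IsLiouvilleTorusAction X F N U ρ) {z : E q} (hz : z ∈ Metric.ball (0 : E q) 1) :
    LinearIndependent ℝ (fun i => frequency X ρ s i z) := by
  have hw0 : ((0, z) : Model p q) ∈ toricDomain p q := ⟨mem_univ _, hz⟩
  have h1 : LinearIndependent ℝ (fun i => fieldVec (X i) (toricMap ρ s (0, z))) :=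
    (H.regular _ (S.toricMap_mem H hw0)).1
  rw [Fintype.linearIndependent_iff] at h1 ⊢
  intro g hg
  refine h1 g ?_
  simp only [← S.dmap_frequency h H hw0, ← map_smul, ← map_sum]
  have h2 : ∑ i, g i • ((frequency X ρ s i z, 0) : Model p q) = 0 := by
    refine Prod.ext ?_ ?_
    · rw [Prod.fst_sum]
      exact hg
    · rw [Prod.snd_sum]
      simp
  rw [h2, map_zero]

/-- A point of `U` over the small ball shares its level with a point of the section, and the orbits
are the full level sets in `U`. -/
theorem image_toricMap (S : IsToricSection p F U c r s) (H : IsLiouvilleTorusAction X F N U ρ) :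
    toricMap ρ s '' toricDomain p q = U ∩ integralMap F ⁻¹' Metric.ball c r := by
  ext x
  constructor
  · rintro ⟨w, hw, rfl⟩
    refine ⟨S.toricMap_mem H hw, ?_⟩
    have h1 : ‖w.2‖ < 1 := by simpa using hw.2
    rw [mem_preimage, S.integralMap_toricMap H hw, mem_ball_iff_norm, add_sub_cancel_left,
      norm_smul, Real.norm_of_nonneg S.pos.le]
    exact mul_lt_of_lt_one_right S.pos h1
  · rintro ⟨hx, hx'⟩
    let z : E q := r⁻¹ • (integralMap F x - c)
    have hz : z ∈ Metric.ball (0 : E q) 1 := by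
      rw [mem_preimage, mem_ball_iff_norm] at hx'
      rw [mem_ball_zero_iff, norm_smul, norm_inv, Real.norm_of_nonneg S.pos.le,
        inv_mul_lt_iff₀ S.pos, mul_one]
      exact hx'
    have h1 : integralMap F x = integralMap F (s z) := by
      rw [S.integralMap_apply z hz, smul_inv_smul₀ S.pos.ne', add_sub_cancel]
    have h2 : x ∈ levelSet F (s z) ∩ U := ⟨integralMap_eq_iff.1 h1, hx⟩
    rw [← H.orbits _ (S.mem z hz)] at h2
    obtain ⟨g, hg⟩ := h2
    obtain ⟨t, rfl⟩ := toTorus_surjective g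
    exact ⟨(t, z), ⟨mem_univ _, hz⟩, hg⟩

/-- The image of the toric map is a tubular neighbourhood. -/
theorem isTubularNeighborhood (h : IsIntegrableSystem X F) {x₀ : M}
    (S : IsToricSection p F U (integralMap F x₀) r s)
    (H : IsLiouvilleTorusAction X F N U ρ) (hN : N = levelSet F x₀) :
    IsTubularNeighborhood p q N (toricMap ρ s '' toricDomain p q) := by
  have h0 : (0 : E q) ∈ Metric.ball (0 : E q) 1 := Metric.mem_ball_self one_pos
  refine ⟨?_, fun w => ρ w.1 (s w.2), ?_, ?_, ?_, ?_, ?_⟩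
  · rw [S.image_toricMap H]
    exact H.isOpen.inter (Metric.isOpen_ball.preimage
      (contMDiff_integralMap h.smooth_integrals).continuous)
  · rintro ⟨g, z⟩ ⟨-, hz⟩ ⟨g', z'⟩ ⟨-, hz'⟩ hgz
    obtain ⟨t, rfl⟩ := toTorus_surjective g
    obtain ⟨t', rfl⟩ := toTorus_surjective g'
    obtain ⟨h1, h2⟩ := (S.toricMap_eq_iff H (w := (t, z)) (w' := (t', z')) ⟨mem_univ _, hz⟩
      ⟨mem_univ _, hz'⟩).1 hgz
    exact Prod.ext h1 h2
  · ext x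
    constructor
    · rintro ⟨⟨g, z⟩, ⟨-, hz⟩, rfl⟩
      obtain ⟨t, rfl⟩ := toTorus_surjective g
      exact ⟨(t, z), ⟨mem_univ _, hz⟩, rfl⟩
    · rintro ⟨⟨t, z⟩, ⟨-, hz⟩, rfl⟩
      exact ⟨(toTorus t, z), ⟨mem_univ _, hz⟩, rfl⟩
  · have h1 : levelSet F (s 0) = N := by
      have h2 := integralMap_eq_iff.1 (show integralMap F (s 0) = integralMap F x₀ by
      rw [S.integralMap_apply 0 h0, smul_zero, add_zero])
      rw [hN]
      ext y
      exact forall_congr' fun j => by rw [h2 j]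
    have h3 := H.orbits _ (S.mem 0 h0)
    rw [h1, inter_eq_left.2 H.subset] at h3
    rw [← h3]
    ext x
    constructor
    · rintro ⟨⟨g, z⟩, ⟨-, rfl⟩, rfl⟩
      exact ⟨g, rfl⟩
    · rintro ⟨g, rfl⟩
      exact ⟨(g, 0), ⟨mem_univ _, rfl⟩, rfl⟩
  · exact fun w hw => (S.contMDiffAt H hw).contMDiffWithinAt
  · exact fun w hw => S.bijective_dmap h H hw

theorem mapsTo_image (S : IsToricSection p F U c r s) (H : IsLiouvilleTorusAction X F N U ρ)
    (g : Torus p) : MapsTo (ρ g) (toricMap ρ s '' toricDomain p q)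
      (toricMap ρ s '' toricDomain p q) := by
  rintro _ ⟨w, hw, rfl⟩
  obtain ⟨t, rfl⟩ := toTorus_surjective g
  exact ⟨(t + w.1, w.2), ⟨mem_univ _, hw.2⟩, S.toricMap_add H hw t⟩

end IsToricSection

end ToricMap
end LiouvilleSystem

namespace LiouvilleSystem

/-! ### The Lie derivative equation in local coordinates -/

section PullTensor
open Filter Topology

variable {E' : Type*} [NormedAddCommGroup E'] [NormedSpace ℝ E']
  {n k h : ℕ} {M : Type*} [TopologicalSpace M] [ChartedSpace (E n) M]

/-- The value at `y` of a tensor field, as a tensor on the model space. -/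
def tensorAt (G : TensorField n M k h) (y : M) :
    MultilinearMap ℝ (fun _ : Fin k => E n →L[ℝ] ℝ) (MultilinearMap ℝ (fun _ : Fin h => E n) ℝ) :=
  G y

/-- The pullback of the value at `y` of a tensor field by an isomorphism `A`. -/
noncomputable def pullTensor (G : TensorField n M k h) (y : M) (A : E' →L[ℝ] E n) :
    MultilinearMap ℝ (fun _ : Fin k => E' →L[ℝ] ℝ) (MultilinearMap ℝ (fun _ : Fin h => E') ℝ) :=
  (MultilinearMap.compLinearMapₗ (fun _ => (A : E' →ₗ[ℝ] E n))).compMultilinearMap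
    ((tensorAt G y).compLinearMap fun _ =>
      { toFun := fun φ : E' →L[ℝ] ℝ => φ.comp A.inverse
        map_add' := fun φ ψ => ContinuousLinearMap.add_comp φ ψ A.inverse
        map_smul' := fun a φ => ContinuousLinearMap.smul_comp a φ A.inverse })

theorem pullTensor_apply (G : TensorField n M k h) (y : M) (A : E' →L[ℝ] E n)
    (α : Fin k → E' →L[ℝ] ℝ) (v : Fin h → E') :
    pullTensor G y A α v =
      tensorAt G y (fun i => (α i).comp A.inverse) (fun j => A (v j)) := rfl

variable [IsManifold (𝓡 n) ∞ M]

/-- Smoothness and invariance of tensor fields are tested on global functions and fields, so local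
coordinate objects are extended by such cutoffs. -/
theorem exists_smooth_cutoff [T2Space M] {V : Set M} {y : M} (hV : V ∈ 𝓝 y) :
    ∃ χ : M → ℝ, IsSmoothFunction (n := n) χ ∧ tsupport χ ⊆ V ∧ ∀ᶠ x in 𝓝 y, χ x = 1 := by
  obtain ⟨χ, -, hχ⟩ := (SmoothBumpFunction.nhds_basis_tsupport (I := 𝓡 n) y).mem_iff.1 hV
  exact ⟨χ, χ.contMDiff, hχ, χ.eventuallyEq_one⟩

/-- Linear functions in a local parametrization extend to global smooth functions. -/
theorem exists_smoothFunction_comp_eq [T2Space M]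
    (Φ : PartialDiffeomorph 𝓘(ℝ, E') (𝓡 n) E' M ∞) {w : E'} (hw : w ∈ Φ.source)
    (α : E' →L[ℝ] ℝ) :
    ∃ f : M → ℝ, IsSmoothFunction (n := n) f ∧ ∀ᶠ w' in 𝓝 w, f (Φ w') = α w' := by
  obtain ⟨χ, hχ, hsupp, hone⟩ :=
    exists_smooth_cutoff (n := n) (Φ.open_target.mem_nhds (Φ.apply_mem_target hw))
  refine ⟨fun x => χ x * α (Φ.symm x), ?_, ?_⟩
  · refine contMDiff_of_tsupport fun x hx => ?_
    have hx' : x ∈ Φ.target := hsupp (tsupport_mul_subset_left hx)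
    have h1 : ContMDiffAt (𝓡 n) 𝓘(ℝ, ℝ) ∞ (fun x => α (Φ.symm x)) x :=
      ContMDiffAt.comp x (g := α) α.contDiff.contMDiff.contMDiffAt (Φ.contMDiffAt_symm hx')
    exact hχ.contMDiffAt.mul h1
  · filter_upwards [(Φ.contMDiffAt hw).continuousAt.eventually hone, Φ.open_source.mem_nhds hw]
      with w' h1 h2
    rw [h1, one_mul, Φ.symm_apply_apply h2]

/-- Constant fields in a local parametrization extend to global smooth fields. -/
theorem exists_smoothVectorField_comp_eq [T2Space M] [CompleteSpace E']
    (Φ : PartialDiffeomorph 𝓘(ℝ, E') (𝓡 n) E' M ∞) {w : E'} (hw : w ∈ Φ.source) (v : E') :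
    ∃ Y : (x : M) → TangentSpace (𝓡 n) x, IsSmoothVectorField Y ∧
      ∀ᶠ w' in 𝓝 w, fieldVec Y (Φ w') = dmap E' (E n) Φ w' v := by
  obtain ⟨χ, hχ, hsupp, hone⟩ :=
    exists_smooth_cutoff (n := n) (Φ.open_target.mem_nhds (Φ.apply_mem_target hw))
  let Y₀ : (x : M) → TangentSpace (𝓡 n) x :=
    mpullback (𝓡 n) 𝓘(ℝ, E') Φ.symm (fun _ => v)
  have hY₀ : ContMDiffOn (𝓡 n) (𝓡 n).tangent ∞
      (fun x => (⟨x, Y₀ x⟩ : TangentBundle (𝓡 n) M)) Φ.target := by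
    intro x hx
    have hinv : (mfderiv (𝓡 n) 𝓘(ℝ, E') Φ.symm x).IsInvertible := Φ.symm.isInvertible_dmap hx
    exact (ContMDiffAt.mpullback_vectorField_preimage (n := ∞) (m := ∞)
      (contMDiffAt_vectorSpace_iff_contDiffAt.2 contDiffAt_const)
      (Φ.contMDiffAt_symm hx) hinv (by simp)).contMDiffWithinAt
  refine ⟨χ • Y₀, ?_, ?_⟩
  · exact ContMDiffOn.smul_section_of_tsupport (V := fun x : M => TangentSpace (𝓡 n) x)
      hχ.contMDiffOn Φ.open_target hsupp hY₀
  · filter_upwards [(Φ.contMDiffAt hw).continuousAt.eventually hone, Φ.open_source.mem_nhds hw]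
      with w' h1 h2
    change χ (Φ w') • (dmap (E n) E' Φ.symm (Φ w')).inverse v = _
    rw [h1, one_smul, Φ.inverse_dmap_symm h2]

/-- The differential of a smooth function is a smooth one-form. -/
theorem isSmoothOneForm_diff {f : M → ℝ} (hf : IsSmoothFunction (n := n) f) :
    IsSmoothOneForm (n := n) (diff f) := by
  intro Y hY
  have h1 := contMDiffOn_dmap_apply isOpen_univ hf.contMDiffOn (Y := Y) hY.contMDiffOn
  exact contMDiffOn_univ.1 h1

/-- The coefficients of an invariant tensor field with respect to constant covectors and vectors
in a local parametrization that takes the field `V` to `X`: they are smooth, and their derivative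
along `V` is given by the derivative of `V`. -/
theorem fderiv_pullTensor [T2Space M] [CompleteSpace E'] {G : TensorField n M k h}
    (hG : IsSmoothTensorField G) (Φ : PartialDiffeomorph 𝓘(ℝ, E') (𝓡 n) E' M ∞) {w : E'}
    (hw : w ∈ Φ.source) (α : Fin k → E' →L[ℝ] ℝ) (v : Fin h → E') :
    DifferentiableAt ℝ (fun w => pullTensor G (Φ w) (dmap E' (E n) Φ w) α v) w ∧
    ∀ (X : (x : M) → TangentSpace (𝓡 n) x) (V : E' → E'), IsSmoothVectorField X →
      IsInvariantUnder G X → DifferentiableAt ℝ V w →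
      (∀ᶠ w' in 𝓝 w, dmap E' (E n) Φ w' (V w') = fieldVec X (Φ w')) →
      fderiv ℝ (fun w => pullTensor G (Φ w) (dmap E' (E n) Φ w) α v) w (V w) =
        ∑ i, pullTensor G (Φ w) (dmap E' (E n) Φ w)
          (Function.update α i ((α i).comp (fderiv ℝ V w))) v -
        ∑ j, pullTensor G (Φ w) (dmap E' (E n) Φ w) α
          (Function.update v j (fderiv ℝ V w (v j))) := by
  -- The constant covectors and vectors of the chart are realized near the point by global functions
  -- and fields, to which the definition of `IsInvariantUnder` applies.
  choose f hf hfα using fun i => exists_smoothFunction_comp_eq Φ hw (α i)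
  choose Y hY hYv using fun j => exists_smoothVectorField_comp_eq Φ hw (v j)
  have hinv : ∀ᶠ w' in 𝓝 w, (dmap E' (E n) Φ w').IsInvertible := by
    filter_upwards [Φ.open_source.mem_nhds hw] with w' hw' using Φ.isInvertible_dmap hw'
  have hcov : ∀ (φ : M → ℝ) (ψ : E' → ℝ) (w' : E'), w' ∈ Φ.source →
      MDifferentiableAt (𝓡 n) 𝓘(ℝ, ℝ) φ (Φ w') →
      (∀ᶠ y in 𝓝 w', φ (Φ y) = ψ y) →
      dmap (E n) ℝ φ (Φ w') = (fderiv ℝ ψ w').comp (dmap E' (E n) Φ w').inverse := by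
    intro φ ψ w' hw' hφ he
    have h1 := dmap_apply_of_comp_eq (f := φ) (g := ψ) (Φ.mdiffAt hw') hφ he
    rw [dmap_eq_fderiv] at h1
    ext u
    rw [ContinuousLinearMap.comp_apply, ← h1, ← ContinuousLinearMap.comp_apply
      (dmap E' (E n) Φ w'), (Φ.isInvertible_dmap hw').self_comp_inverse]
    rfl
  have hdf : ∀ i, ∀ᶠ w' in 𝓝 w, dmap (E n) ℝ (f i) (Φ w') =
      (α i).comp (dmap E' (E n) Φ w').inverse := by
    intro i
    filter_upwards [(hfα i).eventually_nhds, Φ.open_source.mem_nhds hw] with w' h1 h2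
    rw [hcov (f i) (α i) w' h2 ((hf i).mdifferentiable (by simp) _) h1, (α i).fderiv]
  let Q : M → ℝ := fun y => G y (fun i => diff (f i) y) (fun j => Y j y)
  have hQ : IsSmoothFunction (n := n) Q :=
    hG (fun i => diff (f i)) Y (fun i => isSmoothOneForm_diff (hf i)) hY
  have hQΦ : ∀ᶠ w' in 𝓝 w, Q (Φ w') = pullTensor G (Φ w') (dmap E' (E n) Φ w') α v := by
    filter_upwards [eventually_all.2 hdf, eventually_all.2 hYv] with w' h1 h2
    rw [pullTensor_apply]
    change tensorAt G (Φ w') (fun i => dmap (E n) ℝ (f i) (Φ w')) (fun j => fieldVec (Y j) (Φ w')) = _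
    simp only [h1, h2]
  refine ⟨?_, ?_⟩
  · have h1 : ContMDiffAt 𝓘(ℝ, E') 𝓘(ℝ, ℝ) ∞ (fun w => Q (Φ w)) w :=
      ContMDiffAt.comp w (g := Q) hQ.contMDiffAt (Φ.contMDiffAt hw)
    exact (h1.contDiffAt.differentiableAt (by simp)).congr_of_eventuallyEq
      (hQΦ.mono fun _ h => h.symm)
  · intro X V hX hinvX hV hVX
    have hΦV := hVX.self_of_nhds
    have h1 := dmap_apply_of_comp_eq (Φ.mdiffAt hw) (hQ.mdifferentiable (by simp) _) hQΦ (V w)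
    rw [dmap_eq_fderiv, hΦV] at h1
    have h2 := hinvX f Y hf hY (Φ w)
    have h3 : diff (n := n) Q (Φ w) (X (Φ w)) = dmap (E n) ℝ Q (Φ w) (fieldVec X (Φ w)) := rfl
    rw [← h1, ← h3]
    refine h2.trans ?_
    have hcovs : (fun i => dmap (E n) ℝ (f i) (Φ w)) =
        fun i => (α i).comp (dmap E' (E n) Φ w).inverse := funext fun i => (hdf i).self_of_nhds
    have hvecs : (fun j => fieldVec (Y j) (Φ w)) = fun j => dmap E' (E n) Φ w (v j) :=
      funext fun j => (hYv j).self_of_nhds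
    rw [sub_eq_add_neg, ← Finset.sum_neg_distrib]
    congr 1
    · refine Finset.sum_congr rfl fun i _ => ?_
      -- In the chart `X (f i)` is `α i (V)`, whose differential is `α i` composed with the
      -- derivative of `V`.
      have h4 : dmap (E n) ℝ (fun y => dmap (E n) ℝ (f i) y (fieldVec X y)) (Φ w) =
          ((α i).comp (fderiv ℝ V w)).comp (dmap E' (E n) Φ w).inverse := by
        have h5 : ∀ᶠ w' in 𝓝 w, dmap (E n) ℝ (f i) (Φ w') (fieldVec X (Φ w')) = α i (V w') := by
          filter_upwards [hdf i, hVX, hinv] with w' h6 h7 h8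
          rw [h6, ← h7, ContinuousLinearMap.comp_apply, ← ContinuousLinearMap.comp_apply
            (dmap E' (E n) Φ w').inverse, h8.inverse_comp_self]
          rfl
        refine (hcov (fun y => dmap (E n) ℝ (f i) y (fieldVec X y)) (fun w => α i (V w)) w hw
          (((isSmoothOneForm_diff (hf i)) X hX).mdifferentiable (by simp) _) h5).trans ?_
        congr 1
        exact ((α i).hasFDerivAt.comp w hV.hasFDerivAt).fderiv
      have h5 : (Function.update (fun i => dmap (E n) ℝ (f i) (Φ w)) i
          (dmap (E n) ℝ (fun y => dmap (E n) ℝ (f i) y (fieldVec X y)) (Φ w))) =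
          fun i' => (Function.update α i ((α i).comp (fderiv ℝ V w)) i').comp
            (dmap E' (E n) Φ w).inverse := by
        rw [hcovs, h4]
        funext i'
        by_cases hi : i' = i
        · subst hi
          simp
        · simp [hi]
      rw [pullTensor_apply, ← h5, ← hvecs]
      rfl
    · refine Finset.sum_congr rfl fun j _ => ?_
      -- The field `v j` is constant, so its bracket with `V` is minus the derivative of `V` in the
      -- direction `v j`; hence the minus sign in the formula.
      have h4 := dmap_lieBracket_eq (Φ.contMDiffAt hw) hinv hX (hY j) (W := fun _ => v j) hVX
        ((hYv j).mono fun _ h => h.symm)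
      have h6 : fderiv ℝ (fun _ : E' => v j) w = 0 := by simp
      rw [h6, _root_.zero_apply, zero_sub] at h4
      have h5 : (Function.update (fun j => fieldVec (Y j) (Φ w)) j
          (fieldVec (mlieBracket (𝓡 n) X (Y j)) (Φ w))) =
          fun j' => dmap E' (E n) Φ w (Function.update v j (-(fderiv ℝ V w (v j))) j') := by
        rw [hvecs, ← h4]
        funext j'
        by_cases hj : j' = j
        · subst hj
          simp
        · simp [hj]
      have h7 : pullTensor G (Φ w) (dmap E' (E n) Φ w) α
          (Function.update v j (-(fderiv ℝ V w (v j)))) =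
          -pullTensor G (Φ w) (dmap E' (E n) Φ w) α
          (Function.update v j (fderiv ℝ V w (v j))) := MultilinearMap.map_update_neg _ _ _ _
      rw [← h7, pullTensor_apply, ← h5, ← hcovs]
      rfl

end PullTensor
end LiouvilleSystem

namespace LiouvilleSystem

/-! ### Bounded transport by an endomorphism of square zero -/

section NilpotentTransport

variable {V : Type*} [NormedAddCommGroup V] [NormedSpace ℝ V] {k h : ℕ}

/-- A real function with constant derivative and bounded values is constant. -/
theorem eq_of_hasDerivAt_const_of_bounded {g : ℝ → ℝ} {d R : ℝ}
    (hd : ∀ t, HasDerivAt g d t) (hR : ∀ t, |g t| ≤ R) (t : ℝ) : g t = g 0 := by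
  have h1 : ∀ t, g t = g 0 + d * t := by
    intro t
    have h2 : ∀ s, HasDerivAt (fun s => g s - d * s) 0 s := fun s =>
      ((hd s).sub ((hasDerivAt_id s).const_mul d)).congr_deriv (by simp)
    have h3 := is_const_of_deriv_eq_zero (fun s => (h2 s).differentiableAt)
      (fun s => (h2 s).deriv) t 0
    simp only [mul_zero, sub_zero] at h3
    linarith
  have h2 : d = 0 := by
    by_contra hne
    have h3 := h1 ((2 * R + 1) / d)
    rw [mul_div_cancel₀ _ hne] at h3
    have h4 := abs_le.1 (hR ((2 * R + 1) / d))
    have h5 := abs_le.1 (hR 0)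
    linarith [h4.1, h4.2, h5.1, h5.2]
  rw [h1 t, h2, zero_mul, add_zero]

/-- A bounded curve of tensors whose derivative is given by the action of a fixed endomorphism of
square zero is constant. -/
theorem eq_of_hasDerivAt_nilpotent
    {T : ℝ → MultilinearMap ℝ (fun _ : Fin k => V →L[ℝ] ℝ)
      (MultilinearMap ℝ (fun _ : Fin h => V) ℝ)} {N : V →L[ℝ] V} (hN : ∀ x, N (N x) = 0)
    (hT : ∀ α v t, HasDerivAt (fun t => T t α v)
      (∑ i, T t (Function.update α i ((α i).comp N)) v -
        ∑ j, T t α (Function.update v j (N (v j)))) t)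
    (hb : ∀ α v, ∃ R, ∀ t, |T t α v| ≤ R) (α : Fin k → V →L[ℝ] ℝ) (v : Fin h → V) (t : ℝ) :
    T t α v = T 0 α v := by
  classical
  have hNN : ∀ φ : V →L[ℝ] ℝ, (φ.comp N).comp N = 0 := fun φ => by
    ext x
    simp [hN]
  -- Count the arguments not killed by `N`. Each nonzero term of the derivative has one such
  -- argument replaced by its image, which `N` kills, so the count drops and the term is constant in
  -- time by induction. A bounded function with constant derivative is constant.
  let c : (Fin k → V →L[ℝ] ℝ) → (Fin h → V) → ℕ := fun α v =>
    (Finset.univ.filter fun i => (α i).comp N ≠ 0).card +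
      (Finset.univ.filter fun j => N (v j) ≠ 0).card
  have key : ∀ m α v, c α v = m → ∀ t, T t α v = T 0 α v := by
    intro m
    induction m using Nat.strong_induction_on with
    | _ m ih =>
      intro α v hm
      have h1 : ∀ i t, T t (Function.update α i ((α i).comp N)) v =
          T 0 (Function.update α i ((α i).comp N)) v := by
        intro i t
        by_cases hi : (α i).comp N = 0
        · rw [hi, MultilinearMap.map_update_zero, MultilinearMap.map_update_zero]
        · refine ih _ ?_ _ _ rfl t
          rw [← hm]
          refine Nat.add_lt_add_right (Finset.card_lt_card ?_) _
          refine Finset.ssubset_iff_subset_ne.2 ⟨fun i' hi' => ?_, fun he => ?_⟩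
          · rw [Finset.mem_filter] at hi' ⊢
            refine ⟨Finset.mem_univ _, ?_⟩
            by_cases h2 : i' = i
            · rw [h2]
              exact hi
            · rw [Function.update_of_ne h2] at hi'
              exact hi'.2
          · have h2 : i ∈ Finset.univ.filter fun i => (α i).comp N ≠ 0 :=
              Finset.mem_filter.2 ⟨Finset.mem_univ _, hi⟩
            rw [← he, Finset.mem_filter, Function.update_self] at h2
            exact h2.2 (hNN _)
      have h2 : ∀ j t, T t α (Function.update v j (N (v j))) =
          T 0 α (Function.update v j (N (v j))) := by
        intro j t
        by_cases hj : N (v j) = 0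
        · rw [hj, MultilinearMap.map_update_zero, MultilinearMap.map_update_zero]
        · refine ih _ ?_ _ _ rfl t
          rw [← hm]
          refine Nat.add_lt_add_left (Finset.card_lt_card ?_) _
          refine Finset.ssubset_iff_subset_ne.2 ⟨fun j' hj' => ?_, fun he => ?_⟩
          · rw [Finset.mem_filter] at hj' ⊢
            refine ⟨Finset.mem_univ _, ?_⟩
            by_cases h2 : j' = j
            · rw [h2]
              exact hj
            · rw [Function.update_of_ne h2] at hj'
              exact hj'.2
          · have h2 : j ∈ Finset.univ.filter fun j => N (v j) ≠ 0 :=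
              Finset.mem_filter.2 ⟨Finset.mem_univ _, hj⟩
            rw [← he, Finset.mem_filter, Function.update_self] at h2
            exact h2.2 (hN _)
      obtain ⟨R, hR⟩ := hb α v
      refine eq_of_hasDerivAt_const_of_bounded (g := fun t => T t α v)
        (d := ∑ i, T 0 (Function.update α i ((α i).comp N)) v -
          ∑ j, T 0 α (Function.update v j (N (v j)))) (fun t => ?_) hR
      have h3 := hT α v t
      simp only [h1, h2] at h3
      exact h3
  exact key _ α v rfl t

end NilpotentTransport

/-! ### Tensor coefficients in angle coordinates -/

section Coefficients
open Filter Topology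

variable {p q : ℕ} {M : Type*} [TopologicalSpace M] [ChartedSpace (E (p + q)) M]
  [IsManifold (𝓡 (p + q)) ∞ M]
  {X : Fin p → (x : M) → TangentSpace (𝓡 (p + q)) x} {F : Fin q → M → ℝ}
  {N U : Set M} {ρ : Torus p → M → M} {c : E q} {r : ℝ} {s : E q → M} {k h : ℕ}
  {G : TensorField (p + q) M k h}

/-- The coefficients of a tensor field in the coordinates given by the toric map. -/
noncomputable def toricCoeff (G : TensorField (p + q) M k h) (ρ : Torus p → M → M) (s : E q → M)
    (w : Model p q) :
    MultilinearMap ℝ (fun _ : Fin k => Model p q →L[ℝ] ℝ)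
      (MultilinearMap ℝ (fun _ : Fin h => Model p q) ℝ) :=
  pullTensor G (toricMap ρ s w) (dmap (Model p q) (E (p + q)) (toricMap ρ s) w)

namespace IsToricSection

/-- The coefficients descend from the covering `ℝ^p` to the torus, because integral translations
leave the toric map and its derivative unchanged. -/
theorem toricCoeff_eq (S : IsToricSection p F U c r s) (H : IsLiouvilleTorusAction X F N U ρ)
    {w w' : Model p q} (hw : w ∈ toricDomain p q) (h1 : toTorus w.1 = toTorus w'.1)
    (h2 : w.2 = w'.2) : toricCoeff G ρ s w = toricCoeff G ρ s w' := by
  have h3 := S.dmap_toricMap_add H hw (w'.1 - w.1)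
  rw [sub_add_cancel, h2, toTorus_sub, ← h1, sub_self] at h3
  have h4 : dmap (E (p + q)) (E (p + q)) (ρ 0) (toricMap ρ s w) =
      ContinuousLinearMap.id ℝ _ := by
    rw [← dmap_id (toricMap ρ s w)]
    refine dmap_congr ?_
    filter_upwards [H.isOpen.mem_nhds (S.toricMap_mem H hw)] with y hy using H.zero y hy
  rw [h4, ContinuousLinearMap.id_comp] at h3
  have h5 : toricMap ρ s w = toricMap ρ s w' := by
    rw [toricMap, toricMap, h1, h2]
  have h6 : dmap (Model p q) (E (p + q)) (toricMap ρ s) w' =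
    dmap (Model p q) (E (p + q)) (toricMap ρ s) w := h3
  rw [toricCoeff, toricCoeff, h5, h6]

/-- This is `fderiv_pullTensor` for a local inverse of the toric map. There `X_i` is `(ω_i(z), 0)`,
and the derivative of this field is the shear `B`. -/
theorem fderiv_toricCoeff [T2Space M] (S : IsToricSection p F U c r s)
    (hs : IsIntegrableSystem X F) (H : IsLiouvilleTorusAction X F N U ρ)
    (hG : IsSmoothTensorField G) {w : Model p q} (hw : w ∈ toricDomain p q)
    (α : Fin k → Model p q →L[ℝ] ℝ) (v : Fin h → Model p q) :
    DifferentiableAt ℝ (fun w => toricCoeff G ρ s w α v) w ∧ ∀ i, IsInvariantUnder G (X i) →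
      ∀ B, B = (ContinuousLinearMap.inl ℝ (Fin p → ℝ) (E q)).comp
        ((fderiv ℝ (frequency X ρ s i) w.2).comp (ContinuousLinearMap.snd ℝ (Fin p → ℝ) (E q))) →
      fderiv ℝ (fun w => toricCoeff G ρ s w α v) w (frequency X ρ s i w.2, 0) =
        ∑ i, toricCoeff G ρ s w (Function.update α i ((α i).comp B)) v -
        ∑ j, toricCoeff G ρ s w α (Function.update v j (B (v j))) := by
  obtain ⟨Φ, hwΦ, hΦs, hΦ⟩ := S.exists_partialDiffeomorph hs H hw
  have hd : ∀ w' ∈ Φ.source, dmap (Model p q) (E (p + q)) Φ w' =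
      dmap (Model p q) (E (p + q)) (toricMap ρ s) w' := fun w' hw' =>
    dmap_congr (by filter_upwards [Φ.open_source.mem_nhds hw'] with y hy using hΦ y hy)
  have hC : ∀ w' ∈ Φ.source,
      pullTensor G (Φ w') (dmap (Model p q) (E (p + q)) Φ w') = toricCoeff G ρ s w' := by
    intro w' hw'
    rw [hd w' hw', hΦ w' hw', toricCoeff]
  have he : (fun w => toricCoeff G ρ s w α v) =ᶠ[𝓝 w]
      fun w => pullTensor G (Φ w) (dmap (Model p q) (E (p + q)) Φ w) α v := by
    filter_upwards [Φ.open_source.mem_nhds hwΦ] with w' hw'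
    rw [hC w' hw']
  obtain ⟨h1, h2⟩ := fderiv_pullTensor hG Φ hwΦ α v
  refine ⟨h1.congr_of_eventuallyEq he, fun i hi B hB => ?_⟩
  have hb : HasFDerivAt (frequency X ρ s i) (fderiv ℝ (frequency X ρ s i) w.2) w.2 :=
    ((S.contDiffAt_frequency hs H hw.2 i).differentiableAt (by simp)).hasFDerivAt
  have hV : HasFDerivAt (fun w : Model p q => ((frequency X ρ s i w.2, 0) : Model p q)) B w := by
    rw [hB]
    exact (ContinuousLinearMap.inl ℝ (Fin p → ℝ) (E q)).hasFDerivAt.comp w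
      (hb.comp w hasFDerivAt_snd)
  have h3 := h2 (X i) _ (hs.smooth_fields i) hi hV.differentiableAt (by
    filter_upwards [Φ.open_source.mem_nhds hwΦ] with w' hw'
    rw [hd w' hw', hΦ w' hw', S.dmap_frequency hs H (hΦs hw')])
  rw [hV.fderiv, hC w hwΦ] at h3
  rw [he.fderiv_eq, h3]

/-- Compactness of the torus: the coefficients are continuous and periodic in the angles. -/
theorem exists_forall_abs_toricCoeff_le [T2Space M] (S : IsToricSection p F U c r s)
    (hs : IsIntegrableSystem X F) (H : IsLiouvilleTorusAction X F N U ρ)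
    (hG : IsSmoothTensorField G) {z : E q} (hz : z ∈ Metric.ball (0 : E q) 1)
    (α : Fin k → Model p q →L[ℝ] ℝ) (v : Fin h → Model p q) :
    ∃ R, ∀ t, |toricCoeff G ρ s (t, z) α v| ≤ R := by
  have hD : ∀ t, ((t, z) : Model p q) ∈ toricDomain p q := fun t => ⟨mem_univ _, hz⟩
  have hc : Continuous fun t => toricCoeff G ρ s (t, z) α v := by
    rw [continuous_iff_continuousAt]
    intro t
    exact ContinuousAt.comp (f := fun t => ((t, z) : Model p q))
      (g := fun w => toricCoeff G ρ s w α v)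
      (S.fderiv_toricCoeff hs H hG (hD t) α v).1.continuousAt (by fun_prop)
  obtain ⟨R, hR⟩ := (isCompact_closedBall (0 : Fin p → ℝ) (1 / 2)).exists_bound_of_continuousOn
    hc.continuousOn
  refine ⟨R, fun t => ?_⟩
  let m : Fin p → ℝ := fun i => (round (t i) : ℝ)
  have hm : toTorus m = 0 := toTorus_eq_zero_iff.2 ⟨fun i => round (t i), rfl⟩
  rw [S.toricCoeff_eq H (w' := (t - m, z)) (hD t) (by
    simp only
    rw [toTorus_sub, hm, sub_zero]) rfl]
  refine hR _ ?_
  rw [mem_closedBall_zero_iff, pi_norm_le_iff_of_nonneg (by norm_num)]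
  intro i
  exact abs_sub_round (t i)

/-- The coefficients of an invariant tensor field are constant along the flow lines of the
field. -/
theorem toricCoeff_add_smul [T2Space M] (S : IsToricSection p F U c r s)
    (hs : IsIntegrableSystem X F) (H : IsLiouvilleTorusAction X F N U ρ)
    (hG : IsSmoothTensorField G) {i : Fin p} (hi : IsInvariantUnder G (X i)) {w : Model p q}
    (hw : w ∈ toricDomain p q) (t : ℝ) :
    toricCoeff G ρ s (w.1 + t • frequency X ρ s i w.2, w.2) = toricCoeff G ρ s w := by
  have hD : ∀ t : ℝ, ((w.1 + t • frequency X ρ s i w.2, w.2) : Model p q) ∈ toricDomain p q :=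
    fun t => ⟨mem_univ _, hw.2⟩
  let B : Model p q →L[ℝ] Model p q := (ContinuousLinearMap.inl ℝ (Fin p → ℝ) (E q)).comp
    ((fderiv ℝ (frequency X ρ s i) w.2).comp (ContinuousLinearMap.snd ℝ (Fin p → ℝ) (E q)))
  -- `B` takes its values in the angular directions and depends only on the `z`-component.
  have hB : ∀ x, B (B x) = 0 := fun x => by simp [B]
  ext α v
  have h1 := eq_of_hasDerivAt_nilpotent
    (T := fun t : ℝ => toricCoeff G ρ s (w.1 + t • frequency X ρ s i w.2, w.2)) hB
    (fun α v t => ?_) (fun α v => ?_) α v t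
  · simpa using h1
  · obtain ⟨h2, h3⟩ := S.fderiv_toricCoeff hs H hG (hD t) α v
    have h4 : HasDerivAt (fun t : ℝ => ((w.1 + t • frequency X ρ s i w.2, w.2) : Model p q))
        (frequency X ρ s i w.2, 0) t := by
      refine HasDerivAt.prodMk ?_ (hasDerivAt_const _ _)
      simpa using ((hasDerivAt_id t).smul_const (frequency X ρ s i w.2)).const_add w.1
    rw [← h3 i hi B rfl]
    exact h2.hasFDerivAt.comp_hasDerivAt t h4
  · obtain ⟨R, hR⟩ := S.exists_forall_abs_toricCoeff_le hs H hG hw.2 α v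
    exact ⟨R, fun t => hR _⟩

/-- A tensor field with coefficients that are constant on the tori is invariant under the torus
action. -/
theorem isInvariantUnderActionOn (S : IsToricSection p F U c r s) (hs : IsIntegrableSystem X F)
    (H : IsLiouvilleTorusAction X F N U ρ)
    (hC : ∀ w ∈ toricDomain p q, ∀ t : Fin p → ℝ,
      toricCoeff G ρ s (t + w.1, w.2) = toricCoeff G ρ s w) :
    IsInvariantUnderActionOn G ρ (toricMap ρ s '' toricDomain p q) := by
  rintro g _ ⟨w, hw, rfl⟩ α v
  obtain ⟨t, rfl⟩ := toTorus_surjective g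
  let A := dmap (Model p q) (E (p + q)) (toricMap ρ s) w
  let R := dmap (E (p + q)) (E (p + q)) (ρ (toTorus t)) (toricMap ρ s w)
  let α' : Fin k → E (p + q) →L[ℝ] ℝ := α
  let v' : Fin h → E (p + q) := v
  have hA : A.IsInvertible := S.isInvertible_dmap hs H hw
  have hw' : ((t + w.1, w.2) : Model p q) ∈ toricDomain p q := ⟨mem_univ _, hw.2⟩
  have hRA : (R.comp A).IsInvertible := by
    have h1 := S.isInvertible_dmap hs H hw'
    rwa [S.dmap_toricMap_add H hw t] at h1
  -- The arguments are chosen so that the pullbacks by `R.comp A` on the left and by `A` on the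
  -- right cancel, leaving `α` and `R v` at the image point and `α ∘ R` and `v` at the original one.
  have h1 := DFunLike.congr_fun (DFunLike.congr_fun (hC w hw t)
    fun i => (α' i).comp (R.comp A)) fun j => A.inverse (v' j)
  rw [toricCoeff, toricCoeff, S.dmap_toricMap_add H hw t, S.toricMap_add H hw t,
    pullTensor_apply, pullTensor_apply] at h1
  have h2 : ∀ u, A (A.inverse u) = u := fun u => by
    rw [← ContinuousLinearMap.comp_apply, hA.self_comp_inverse]
    rfl
  have h3 : ∀ i, (((α' i).comp (R.comp A)).comp (R.comp A).inverse) = α' i := fun i => by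
    rw [ContinuousLinearMap.comp_assoc, hRA.self_comp_inverse, ContinuousLinearMap.comp_id]
  have h4 : ∀ i, (((α' i).comp (R.comp A)).comp A.inverse) = (α' i).comp R := fun i => by
    rw [ContinuousLinearMap.comp_assoc, ContinuousLinearMap.comp_assoc, hA.self_comp_inverse,
      ContinuousLinearMap.comp_id]
  have h5 : tensorAt G (ρ (toTorus t) (toricMap ρ s w)) α' (fun j => R (v' j)) =
      tensorAt G (toricMap ρ s w) (fun i => (α' i).comp R) v' := by
    have h6 : (fun i => ((α' i).comp (R.comp A)).comp (R.comp A).inverse) = α' := funext h3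
    have h7 : (fun i => ((α' i).comp (R.comp A)).comp A.inverse) = fun i => (α' i).comp R :=
      funext h4
    have h8 : (fun j => (R.comp A) (A.inverse (v' j))) = fun j => R (v' j) := funext fun j => by
      rw [ContinuousLinearMap.comp_apply, h2]
    have h9 : (fun j => A (A.inverse (v' j))) = v' := funext fun j => h2 _
    exact (congrArg₂ (fun a b => tensorAt G _ a b) h6 h8).symm.trans
      (h1.trans (congrArg₂ (fun a b => tensorAt G _ a b) h7 h9))
  exact h5

end IsToricSection

end Coefficients
end LiouvilleSystem

namespace LiouvilleSystem

/-! ### Constancy of the coefficients on the tori -/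

section Invariance
open Filter Topology

variable {p q : ℕ} {M : Type*} [TopologicalSpace M] [ChartedSpace (E (p + q)) M]
  [IsManifold (𝓡 (p + q)) ∞ M]
  {X : Fin p → (x : M) → TangentSpace (𝓡 (p + q)) x} {F : Fin q → M → ℝ}
  {N U : Set M} {ρ : Torus p → M → M} {c : E q} {r : ℝ} {s : E q → M} {k h : ℕ}
  {G : TensorField (p + q) M k h}

theorem eq_of_frequently_eq {Y Z : Type*} [TopologicalSpace Y] [TopologicalSpace Z] [T2Space Z]
    {f g : Y → Z} {y : Y} (hf : ContinuousAt f y) (hg : ContinuousAt g y)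
    (h : ∃ᶠ y' in 𝓝 y, f y' = g y') : f y = g y := by
  by_contra hne
  exact h ((hf.ne_iff_eventually_ne hg).1 hne)

namespace IsToricSection

/-- The coefficients of a tensor field invariant under all the fields are constant on the tori. -/
theorem toricCoeff_add_of_forall [T2Space M] (S : IsToricSection p F U c r s)
    (hs : IsIntegrableSystem X F) (H : IsLiouvilleTorusAction X F N U ρ)
    (hG : IsSmoothTensorField G) (hi : ∀ i, IsInvariantUnder G (X i)) {w : Model p q}
    (hw : w ∈ toricDomain p q) (t : Fin p → ℝ) :
    toricCoeff G ρ s (t + w.1, w.2) = toricCoeff G ρ s w := by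
  -- The directions along which the coefficients do not change form a subspace. It contains the `p`
  -- independent frequencies and hence is everything.
  let P : Submodule ℝ (Fin p → ℝ) :=
    { carrier := {u | ∀ (a : ℝ) (θ : Fin p → ℝ),
        toricCoeff G ρ s (θ + a • u, w.2) = toricCoeff G ρ s (θ, w.2)}
      zero_mem' := fun a θ => by rw [smul_zero, add_zero]
      add_mem' := fun {u u'} hu hu' a θ => by rw [smul_add, ← add_assoc, hu', hu]
      smul_mem' := fun b u hu a θ => by rw [smul_smul, hu] }
  have h1 : ∀ i, frequency X ρ s i w.2 ∈ P := fun i a θ =>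
    S.toricCoeff_add_smul hs H hG (hi i) (w := (θ, w.2)) ⟨mem_univ _, hw.2⟩ a
  have h2 : P = ⊤ := by
    rw [eq_top_iff, ← (S.linearIndependent_frequency hs H hw.2).span_eq_top_of_card_eq_finrank'
      (by simp), Submodule.span_le]
    rintro _ ⟨i, rfl⟩
    exact h1 i
  have h3 : t ∈ P := by
    rw [h2]
    trivial
  have h4 := h3 1 w.1
  rw [one_smul, add_comm] at h4
  exact h4

/-- On a torus in which an orbit of `X_i` is dense, the coefficients of a tensor field invariant
under `X_i` are constant. -/
theorem toricCoeff_eq_of_dense_orbit [T2Space M] (S : IsToricSection p F U c r s)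
    (hs : IsIntegrableSystem X F) (H : IsLiouvilleTorusAction X F N U ρ)
    (hG : IsSmoothTensorField G) {i : Fin p} (hi : IsInvariantUnder G (X i)) {w : Model p q}
    (hw : w ∈ toricDomain p q) {T : Set M} (hT : IsLiouvilleTorus X F T)
    (hwT : toricMap ρ s w ∈ T) {γ : ℝ → M} (hγ : IsMIntegralCurve γ (X i))
    (hγ0 : γ 0 = toricMap ρ s w) (hd : T ⊆ closure (range γ)) (θ : Fin p → ℝ) :
    toricCoeff G ρ s (θ, w.2) = toricCoeff G ρ s w := by
  have hD : ∀ t, ((t, w.2) : Model p q) ∈ toricDomain p q := fun t => ⟨mem_univ _, hw.2⟩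
  -- Straight lines with direction the frequency are integral curves of `X_i`, so uniqueness
  -- identifies the given orbit with one of them.
  have hγt : γ = fun t : ℝ => toricMap ρ s (w.1 + t • frequency X ρ s i w.2, w.2) := by
    refine isMIntegralCurve_Ioo_eq_of_contMDiff_boundaryless (t₀ := 0) (I := 𝓡 (p + q)) (v := X i)
      ((hs.smooth_fields i).of_le (by simp)) hγ (fun t => ?_) (by simpa using hγ0)
    have h1 : HasFDerivAt
        (fun t : ℝ => ((w.1 + t • frequency X ρ s i w.2, w.2) : Model p q))
        ((1 : ℝ →L[ℝ] ℝ).smulRight ((frequency X ρ s i w.2, 0) : Model p q)) t := by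
      have h2 : HasFDerivAt (fun t : ℝ => w.1 + t • frequency X ρ s i w.2)
          ((1 : ℝ →L[ℝ] ℝ).smulRight (frequency X ρ s i w.2)) t :=
        ((hasFDerivAt_id t).smul_const _).const_add w.1
      refine (h2.prodMk (hasFDerivAt_const w.2 t)).congr_fderiv ?_
      ext1
      refine Prod.ext ?_ ?_ <;> simp
    have h4 := (S.mdiffAt H (hD (w.1 + t • frequency X ρ s i w.2))).hasMFDerivAt.comp t
      h1.hasMFDerivAt
    refine h4.congr_mfderiv ?_
    have h5 : (dmap (Model p q) (E (p + q)) (toricMap ρ s)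
        (w.1 + t • frequency X ρ s i w.2, w.2)).comp
        ((1 : ℝ →L[ℝ] ℝ).smulRight ((frequency X ρ s i w.2, 0) : Model p q)) =
        (1 : ℝ →L[ℝ] ℝ).smulRight (fieldVec (X i)
          (toricMap ρ s (w.1 + t • frequency X ρ s i w.2, w.2))) := by
      have h6 := S.dmap_frequency hs H (hD (w.1 + t • frequency X ρ s i w.2)) i
      simp only at h6
      rw [← h6]
      ext
      simp
    exact h5
  obtain ⟨-, ⟨x, rfl⟩, -⟩ := hT
  have hlev : levelSet F (toricMap ρ s w) = levelSet F x := by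
    have h1 := connectedComponentIn_subset _ _ hwT
    ext y
    exact forall_congr' fun j => by rw [h1 j]
  -- The torus orbit is connected and lies in the level set, so it is contained in the component
  -- `T`.
  have horb : toricMap ρ s (θ, w.2) ∈ closure (range γ) := by
    refine hd ?_
    rw [connectedComponentIn_eq hwT]
    have hcont : Continuous fun t => toricMap ρ s (t, w.2) := by
      rw [continuous_iff_continuousAt]
      intro t
      exact ContinuousAt.comp (f := fun t => ((t, w.2) : Model p q)) (g := toricMap ρ s)
        (S.contMDiffAt H (hD t)).continuousAt (by fun_prop)
    refine (isPreconnected_range hcont).subset_connectedComponentIn ⟨w.1, rfl⟩ ?_ ⟨θ, rfl⟩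
    rintro _ ⟨t, rfl⟩
    rw [← hlev]
    refine integralMap_eq_iff.1 ?_
    rw [S.integralMap_toricMap H (hD t), S.integralMap_toricMap H hw]
  obtain ⟨Φ, hwΦ, hΦs, hΦ⟩ := S.exists_partialDiffeomorph hs H (hD θ)
  rw [← hΦ _ hwΦ] at horb
  have htar := Φ.apply_mem_target hwΦ
  -- Points of the orbit close to `toricMap ρ s (θ, w.2)` are lifted near `(θ, w.2)` by a local
  -- inverse. These lifts differ from points of the straight line by integral vectors only, so their
  -- coefficients are those at `w`.
  have hfreq : ∃ᶠ w' in 𝓝 (((θ, w.2) : Model p q)),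
      toricCoeff G ρ s w' = toricCoeff G ρ s w := by
    have h1 := (mem_closure_iff_frequently.1 horb).and_eventually (Φ.open_target.mem_nhds htar)
    have h2 : Tendsto Φ.symm (𝓝 (Φ (θ, w.2))) (𝓝 (θ, w.2)) := by
      have h3 := (Φ.contMDiffAt_symm htar).continuousAt
      rwa [ContinuousAt, Φ.symm_apply_apply hwΦ] at h3
    refine h2.frequently (h1.mono ?_)
    rintro y ⟨⟨t, rfl⟩, hy⟩
    have h3 := Φ.symm_apply_mem_source hy
    have h4 : toricMap ρ s (Φ.symm (γ t)) =
        toricMap ρ s (w.1 + t • frequency X ρ s i w.2, w.2) := by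
      rw [← hΦ _ h3, Φ.apply_symm_apply hy, hγt]
    obtain ⟨h5, h6⟩ := (S.toricMap_eq_iff H (hΦs h3) (hD _)).1 h4
    rw [S.toricCoeff_eq H (hΦs h3) h5 h6, S.toricCoeff_add_smul hs H hG hi hw]
  ext α v
  exact eq_of_frequently_eq (f := fun w' => toricCoeff G ρ s w' α v)
    (g := fun _ => toricCoeff G ρ s w α v)
    (S.fderiv_toricCoeff hs H hG (hD θ) α v).1.continuousAt continuousAt_const
    (hfreq.mono fun w' h => by rw [h])

/-- If the orbits of `X_i` are dense in a dense family of tori, then the coefficients of a tensor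
field invariant under `X_i` are constant on the tori. -/
theorem toricCoeff_add_of_dense [T2Space M] (S : IsToricSection p F U c r s)
    (hs : IsIntegrableSystem X F) (H : IsLiouvilleTorusAction X F N U ρ)
    (hG : IsSmoothTensorField G) {i : Fin p} (hi : IsInvariantUnder G (X i)) {W : Set M}
    (hSW : ∀ w ∈ toricDomain p q, toricMap ρ s w ∈ W)
    (hW : W ⊆ closure {x ∈ W | ∃ T : Set M, IsLiouvilleTorus X F T ∧ x ∈ T ∧
      ∃ γ : ℝ → M, IsMIntegralCurve γ (X i) ∧ γ 0 = x ∧ T ⊆ closure (range γ)})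
    {w : Model p q} (hw : w ∈ toricDomain p q) (t : Fin p → ℝ) :
    toricCoeff G ρ s (t + w.1, w.2) = toricCoeff G ρ s w := by
  have hD : ∀ t, ((t, w.2) : Model p q) ∈ toricDomain p q := fun t => ⟨mem_univ _, hw.2⟩
  obtain ⟨Φ, hwΦ, hΦs, hΦ⟩ := S.exists_partialDiffeomorph hs H hw
  have hcl := hW (hSW w hw)
  rw [← hΦ _ hwΦ] at hcl
  have htar := Φ.apply_mem_target hwΦ
  -- The good points accumulate at the image of `w`, and their `z`-coordinates accumulate at `w.2`.
  -- Over each such `z` the coefficients are constant in the angle, and continuity in `z` transfers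
  -- this to `w.2`.
  have hfreq : ∃ᶠ z in 𝓝 w.2, ∀ θ θ',
      toricCoeff G ρ s (θ, z) = toricCoeff G ρ s (θ', z) := by
    have h1 := (mem_closure_iff_frequently.1 hcl).and_eventually (Φ.open_target.mem_nhds htar)
    have h2 : Tendsto (fun y => (Φ.symm y).2) (𝓝 (Φ w)) (𝓝 w.2) := by
      have h3 := (Φ.contMDiffAt_symm htar).continuousAt.snd
      rwa [ContinuousAt, Φ.symm_apply_apply hwΦ] at h3
    refine h2.frequently (h1.mono ?_)
    rintro y ⟨⟨-, T, hT, hyT, γ, hγ, hγ0, hd⟩, hy⟩ θ θ'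
    have h3 := Φ.symm_apply_mem_source hy
    have h4 : toricMap ρ s (Φ.symm y) = y := by
      rw [← hΦ _ h3, Φ.apply_symm_apply hy]
    rw [← h4] at hyT hγ0
    rw [S.toricCoeff_eq_of_dense_orbit hs H hG hi (hΦs h3) hT hyT hγ hγ0 hd θ,
      S.toricCoeff_eq_of_dense_orbit hs H hG hi (hΦs h3) hT hyT hγ hγ0 hd θ']
  ext α v
  have hc : ∀ θ, ContinuousAt (fun z => toricCoeff G ρ s (θ, z) α v) w.2 := fun θ =>
    ContinuousAt.comp (f := fun z => ((θ, z) : Model p q)) (g := fun w => toricCoeff G ρ s w α v)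
      (S.fderiv_toricCoeff hs H hG (hD θ) α v).1.continuousAt (by fun_prop)
  exact eq_of_frequently_eq (f := fun z => toricCoeff G ρ s (t + w.1, z) α v)
    (g := fun z => toricCoeff G ρ s (w.1, z) α v) (hc (t + w.1)) (hc w.1) (hfreq.mono fun z hz => by
      rw [hz (t + w.1) w.1])

end IsToricSection

/-- A Liouville torus action restricts to invariant open neighbourhoods given by the integrals. -/
theorem IsLiouvilleTorusAction.restrict (H : IsLiouvilleTorusAction X F N U ρ) {V : Set M}
    (hV : IsOpen V) (hNV : N ⊆ V) (hVU : V ⊆ U) (hm : ∀ g, MapsTo (ρ g) V V) :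
    IsLiouvilleTorusAction X F N V ρ where
  isOpen := hV
  subset := hNV
  mapsTo := hm
  zero x hx := H.zero x (hVU hx)
  add g g' x hx := H.add g g' x (hVU hx)
  smooth := H.smooth.mono (prod_mono subset_rfl hVU)
  free x hx := H.free x (hVU hx)
  preserves_fields g x hx := H.preserves_fields g x (hVU hx)
  preserves_integrals g x hx := H.preserves_integrals g x (hVU hx)
  orbits x hx := by
    have h1 := H.orbits x (hVU hx)
    refine Subset.antisymm ?_ ?_
    · rintro _ ⟨g, rfl⟩
      exact ⟨H.preserves_integrals g x (hVU hx), hm g hx⟩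
    · rintro y ⟨hy, hyV⟩
      rw [h1]
      exact ⟨hy, hVU hyV⟩
  regular x hx := H.regular x (hVU hx)

end Invariance
end LiouvilleSystem

/-! ### The main theorem -/

open LiouvilleSystem in
theorem mainTheorem1 {p q k h : ℕ} (hp : 0 < p)
    {M : Type*} [TopologicalSpace M] [T2Space M] [SecondCountableTopology M]
    [ChartedSpace (E (p + q)) M] [IsManifold (𝓡 (p + q)) ∞ M]
    (X : Fin p → (x : M) → TangentSpace (𝓡 (p + q)) x) (F : Fin q → M → ℝ)
    (hXF : IsIntegrableSystem X F)
    (c : Fin q → ℝ) (N : Set M) (hNc : N = {x | ∀ j, F j x = c j})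
    (hN : IsLiouvilleTorus X F N)
    (G : TensorField (p + q) M k h) (hG : IsSmoothTensorField G)
    (hinv : (∀ i, IsInvariantUnder G (X i)) ∨
      (IsInvariantUnder G (X ⟨0, hp⟩) ∧ HasDenseOrbitsOnDenseFamily X F (X ⟨0, hp⟩) N)) :
    (∃ (U : Set M) (ρ : Torus p → M → M),
      IsTubularNeighborhood p q N U ∧ IsLiouvilleTorusAction X F N U ρ) ∧
    ∀ (U : Set M) (ρ : Torus p → M → M), IsLiouvilleTorusAction X F N U ρ →
      ∃ V : Set M, V ⊆ U ∧ IsTubularNeighborhood p q N V ∧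
        (∀ g, MapsTo (ρ g) V V) ∧ IsInvariantUnderActionOn G ρ V := by
  obtain ⟨hcomp, ⟨x₀, hx₀⟩, hreg⟩ := hN
  have hx₀N : x₀ ∈ N := by
    rw [hx₀]
    exact mem_connectedComponentIn fun j => rfl
  have hNlev : N = levelSet F x₀ := by
    have h1 : ∀ j, F j x₀ = c j := by
      rw [hNc] at hx₀N
      exact hx₀N
    rw [hNc]
    ext x
    exact forall_congr' fun j => by rw [h1 j]
  have hconn : IsPreconnected N := by
    rw [hx₀]
    exact isPreconnected_connectedComponentIn
  have key : ∀ (U : Set M) (ρ : Torus p → M → M), IsLiouvilleTorusAction X F N U ρ →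
      ∃ V : Set M, V ⊆ U ∧ IsTubularNeighborhood p q N V ∧
        (∀ g, MapsTo (ρ g) V V) ∧ IsInvariantUnderActionOn G ρ V := by
    intro U ρ H
    -- Both conditions enter only through constancy of the coefficients on the tori. The set `W`
    -- confines the toric chart to the neighbourhood given by (ii) and is the whole manifold under
    -- (i).
    have main : ∀ W : Set M, IsOpen W → N ⊆ W →
        (∀ (r : ℝ) (s : E q → M), IsToricSection p F U (integralMap F x₀) r s →
          (∀ w ∈ toricDomain p q, toricMap ρ s w ∈ W) →
          ∀ w ∈ toricDomain p q, ∀ t : Fin p → ℝ,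
            toricCoeff G ρ s (t + w.1, w.2) = toricCoeff G ρ s w) →
        ∃ V : Set M, V ⊆ U ∧ IsTubularNeighborhood p q N V ∧
          (∀ g, MapsTo (ρ g) V V) ∧ IsInvariantUnderActionOn G ρ V := by
      intro W hW hNW hcoeff
      obtain ⟨r, s, S, hSW⟩ := H.exists_isToricSection hXF hx₀N hW (by rwa [← hNlev])
      refine ⟨toricMap ρ s '' toricDomain p q, ?_, S.isTubularNeighborhood hXF H hNlev,
        S.mapsTo_image H, S.isInvariantUnderActionOn hXF H (hcoeff r s S hSW)⟩
      rintro _ ⟨w, hw, rfl⟩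
      exact S.toricMap_mem H hw
    rcases hinv with hinv | ⟨hinv, W, hW, hNW, hdense⟩
    · exact main univ isOpen_univ (subset_univ _) fun r s S _ w hw t =>
        S.toricCoeff_add_of_forall hXF H hG hinv hw t
    · exact main W hW hNW fun r s S hSW w hw t =>
        S.toricCoeff_add_of_dense hXF H hG hinv hSW hdense hw t
  refine ⟨?_, key⟩
  -- The constructed action lives on some neighbourhood; applying `key` to it provides an invariant
  -- tubular one to which it is restricted.
  obtain ⟨U, ρ, H⟩ := exists_isLiouvilleTorusAction hXF hNlev hcomp hconn hreg
  obtain ⟨V, hVU, hV, hm, -⟩ := key U ρ H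
  refine ⟨V, ρ, hV, H.restrict hV.1 ?_ hVU hm⟩
  obtain ⟨-, Φ, -, h1, h2, -⟩ := hV
  rw [← h1, ← h2]
  exact image_mono (prod_mono subset_rfl (singleton_subset_iff.2 (Metric.mem_ball_self one_pos)))
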